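/- \textbf{Setting.} Consider $x_{t+1}=Ax_t+Bu_t+w_t$, $y_t=Cx_t+v_t$ ($t=0,1,\dots$) with $x_t\in\mathbb R^{n_x}$, $u_t\in\mathbb R^{n_u}$, $y_t\in\mathbb R^{n_y}$, where $v_t\sim\mathcal N(0,M)$ are independent, $M\succ0$, and $x_0$ has a law with finite second moment. Let $Q\succeq0$, $R\succ0$, $\lambda>0$, and let the nominal disturbance laws $\mathbb Q_t$ on $\mathbb R^{n_x}$ have finite second moments, mean $\hat w$ and covariance $\hat\Sigma$ for all $t$. Let $I_t=(y_0,\dots,y_t,u_0,\dots,u_{t-1})$. The controller chooses $u_t=\pi_t(I_t)$, and the adversary chooses the law $\mathbb P_t=\gamma_t(I_t)$ of $w_t$ (finite second moment), both measurably; given $I_t$, $w_t\sim\mathbb P_t$ is independent of $x_t$, and $v_{t+1}$ is independent of the past and of $w_t$. Write $\bar x_t=\mathbb E[x_t\mid I_t]$ for the conditional mean under the policy pair $(\pi,\gamma)$ in force; policies may be written in terms of $\bar x_t$ as well as $I_t$. For laws $\mathbb P,\mathbb Q$ with means $\bar w,\hat w$ and covariances $\Sigma,\hat\Sigma$ put $$\mathrm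 G(\mathbb P,\mathbb Q)^2=\|\bar w-\hat w\|^2+\mathrm{Tr}\big[\Sigma+\hat\Sigma-2(\hat\Sigma^{1/2}\Sigma\hat\Sigma^{1/2})^{1/2}\big],$$ $$J^\lambda_\infty(\pi,\gamma)=\limsup_{T\to\infty}\frac1T\,\mathbb E\Big[\sum_{t=0}^{T-1}\big(x_t^\top Qx_t+u_t^\top Ru_t-\lambda\,\mathrm G(\mathbb P_t,\mathbb Q_t)^2\big)\Big]\in[-\infty,\infty]$$ (the expectation being $-\infty$ in the indeterminate case $\infty-\infty$, i.e. when the expected cost and the expected penalty are both infinite). \textbf{Assumptions.} Let $\Phi=BR^{-1}B^\top-\lambda^{-1}I\succeq0$, let $(A,\Phi^{1/2})$ be stabilizable and $(A,Q^{1/2})$ observable. Let $P\succeq0$ solve $P=Q+A^\top(I+P\Phi)^{-1}PA$, and assume $\lambda I\succ P$. Put $S=Q+A^\top PA-P$, $r=[I-A^\top(I+P\Phi)^{-1}]^{-1}A^\top(I+P\Phi)^{-1}P\hat w$, $$K=-R^{-1}B^\top(I+P\Phi)^{-1}PA,\qquad L=-R^{-1}B^\top(I+P\Phi)^{-1}(P\hat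 w+r),$$ $$H=(\lambda I-P)^{-1}P(A+BK),\qquad G=(\lambda I-P)^{-1}(PBL+r+\lambda\hat w).$$ Let $(X^*,X^{-,*},\Sigma^*)$ be an optimal solution, with optimal value $z$, of maximizing $\mathrm{Tr}[SX+(P-\lambda I)\Sigma+2\lambda(\hat\Sigma^{1/2}\Sigma\hat\Sigma^{1/2})^{1/2}]$ over positive semidefinite $X,X^-,\Sigma$ with $X^-=AXA^\top+\Sigma$ and $X=X^--X^-C^\top(CX^-C^\top+M)^{-1}CX^-$. Let $(A,C)$ be detectable and $(A,(\Sigma^*)^{1/2})$ stabilizable. The stationary policy pair is $\pi^*_{ss}(I_t)=K\bar x_t+L$ and $\gamma^*_{ss}(I_t)=\mathcal N(H\bar x_t+G,\Sigma^*)$. Let $h(I_t)=\bar x_t^\top P\bar x_t+2r^\top\bar x_t+\mathrm{Tr}[(S+P)X^*]$ and $$\rho=(2\hat w-\Phi r)^\top(I+P\Phi)^{-1}r-\lambda\mathrm{Tr}\,\hat\Sigma+\hat w^\top(I+P\Phi)^{-1}P\hat w+z.$$ \textbf{Proposition.} Let $\bar\Pi\ni\pi^*_{ss}$ and $\bar\Gamma\ni\gamma^*_{ss}$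 be any sets of control policies and of distribution policies such that $h(I_T)$ is integrable for every $T$ under all the pairs below and $$\limsup_{T\to\infty}\tfrac1T\mathbb E[h(I_T)\mid\pi,\gamma^*_{ss}]=0\ \ \forall\pi\in\bar\Pi,\qquad \limsup_{T\to\infty}\tfrac1T\mathbb E[h(I_T)\mid\pi^*_{ss},\gamma]=0\ \ \forall\gamma\in\bar\Gamma.$$ Then $J^\lambda_\infty(\pi^*_{ss},\gamma^*_{ss})=\rho$, and $(\pi^*_{ss},\gamma^*_{ss})$ is minimax optimal: $$J^\lambda_\infty(\pi^*_{ss},\gamma)\le J^\lambda_\infty(\pi^*_{ss},\gamma^*_{ss})\le J^\lambda_\infty(\pi,\gamma^*_{ss})\qquad\forall\pi\in\bar\Pi,\ \gamma\in\bar\Gamma,$$ $$\inf_{\pi\in\bar\Pi}\sup_{\gamma\in\bar\Gamma}J^\lambda_\infty(\pi,\gamma)=\sup_{\gamma\in\bar\Gamma}J^\lambda_\infty(\pi^*_{ss},\gamma)=\rho .$$ -/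

import Mathlib

open MeasureTheory ProbabilityTheory Filter Topology
open scoped ENNReal Matrix MatrixOrder

noncomputable section

namespace GelbrichControl

/-! ### Vectors, matrices, moments -/

abbrev Vec (n : ℕ) := EuclideanSpace ℝ (Fin n)

abbrev Mat (m n : ℕ) := Matrix (Fin m) (Fin n) ℝ

/-- The matrix-vector product `A x` on Euclidean spaces. -/
def act {m n : ℕ} (A : Mat m n) (x : Vec n) : Vec m := WithLp.toLp 2 (A *ᵥ x.ofLp)

/-- The quadratic form `xᵀ Q x`. -/
def quad {n : ℕ} (Q : Mat n n) (x : Vec n) : ℝ := inner ℝ x (act Q x)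

def meanVec {n : ℕ} (μ : Measure (Vec n)) : Vec n := ∫ x, x ∂μ

/-- The covariance matrix of a distribution on `ℝⁿ`. -/
def covMat {n : ℕ} (μ : Measure (Vec n)) : Mat n n :=
  Matrix.of fun i j => cov[fun x : Vec n => x i, fun x : Vec n => x j; μ]

/-- `B²(Σ, Σ̂) = Tr[Σ + Σ̂ - 2 (Σ̂^{1/2} Σ Σ̂^{1/2})^{1/2}]`;
`CFC.sqrt` is the positive semidefinite square root. -/
def buresSq {n : ℕ} (S T : Mat n n) : ℝ :=
  Matrix.trace (S + T - (2 : ℝ) • CFC.sqrt (CFC.sqrt T * S * CFC.sqrt T))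

/-- The Gelbrich bound `G(ℙ, ℚ)`. -/
def gelbrich {n : ℕ} (μ ν : Measure (Vec n)) : ℝ :=
  Real.sqrt (‖meanVec μ - meanVec ν‖ ^ 2 + buresSq (covMat μ) (covMat ν))

/-! ### Notions from linear systems theory -/

/-- All complex eigenvalues lie in the open unit disc. -/
def IsSchurStable {n : ℕ} (A : Mat n n) : Prop :=
  ∀ z ∈ spectrum ℂ (A.map (algebraMap ℝ ℂ)), ‖z‖ < 1

def IsStabilizable {n m : ℕ} (A : Mat n n) (B : Mat n m) : Prop :=
  ∃ K : Mat m n, IsSchurStable (A + B * K)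

def IsDetectable {n m : ℕ} (A : Mat n n) (C : Mat m n) : Prop :=
  ∃ L : Mat n m, IsSchurStable (A + L * C)

/-- No nonzero initial state produces the zero output. -/
def IsObservable {n m : ℕ} (A : Mat n n) (C : Mat m n) : Prop :=
  ∀ x : Fin n → ℝ, (∀ k : ℕ, C *ᵥ ((A ^ k) *ᵥ x) = 0) → x = 0

/-! ### Data of the control problem -/

/-- The data of the problem: system matrices, cost weights `Q`, `R`, covariance `M` of the output
noise, penalty parameter `lam`, law of the initial state, nominal disturbance laws `ℚ_t`. -/
structure Data (nx nu ny : ℕ) where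
  A : Mat nx nx
  B : Mat nx nu
  C : Mat ny nx
  Q : Mat nx nx
  R : Mat nu nu
  M : Mat ny ny
  lam : ℝ
  init : ProbabilityMeasure (Vec nx)
  nominal : ℕ → ProbabilityMeasure (Vec nx)

/-- The information vector `I_t = (y_0, …, y_t, u_0, …, u_{t-1})`. -/
abbrev Info (ny nu t : ℕ) := (Fin (t + 1) → Vec ny) × (Fin t → Vec nu)

/-- `I_{t+1} = (I_t, y_{t+1}, u_t)`. -/
def Info.extend {ny nu t : ℕ} (I : Info ny nu t) (y : Vec ny) (u : Vec nu) : Info ny nu (t + 1) :=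
  (Fin.snoc (α := fun _ => Vec ny) I.1 y, Fin.snoc (α := fun _ => Vec nu) I.2 u)

/-- Measurable control policies `u_t = π_t(I_t)`. The second argument is the value at `I_t` of the
conditional mean `x̄_t = E[x_t | I_t]` under the policy pair in force (see `closedLoop`). It is
itself a function of `I_t`; the argument lets a policy be written in terms of `x̄_t`. -/
structure ControlPolicy (nx nu ny : ℕ) where
  toFun : ∀ t : ℕ, Info ny nu t × Vec nx → Vec nu
  measurable' : ∀ t, Measurable (toFun t)

/-- Measurable distribution policies `ℙ_t = γ_t(I_t)`, with values in the distributions of finite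
second moment (for which the mean vector and the covariance matrix are defined). The second
argument of `law t` is the value at `I_t` of `x̄_t`, as in `ControlPolicy`. -/
structure DistPolicy (nx nu ny : ℕ) where
  law : ∀ t : ℕ, Kernel (Info ny nu t × Vec nx) (Vec nx)
  markov : ∀ t, IsMarkovKernel (law t)
  sq_integrable : ∀ t p, MemLp (fun x : Vec nx => x) 2 (law t p)

/-! ### The closed loop -/

lemma measurable_act {m n : ℕ} (A : Mat m n) : Measurable (act A) := by
  have h : act A = fun x => Matrix.toLpLin 2 2 A x := by
    funext x; simp [act, Matrix.toLpLin_apply]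
  rw [h]
  exact (LinearMap.continuous_of_finiteDimensional _).measurable

lemma measurable_snoc {n k : ℕ} :
    Measurable (fun p : (Fin k → Vec n) × Vec n =>
      (Fin.snoc (α := fun _ => Vec n) p.1 p.2 : Fin (k + 1) → Vec n)) := by
  refine measurable_pi_iff.2 fun i => ?_
  refine Fin.lastCases ?_ (fun j => ?_) i
  · simpa using measurable_snd
  · simp only [Fin.snoc_castSucc]
    exact (measurable_pi_apply j).comp measurable_fst

/-- `I ↦ E[x | I]` for a joint law of the pair `(I, x)`, as the mean of the regular conditional
distribution of `x` given `I`. -/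
def condMean {α : Type*} [MeasurableSpace α] {n : ℕ} (ν : ProbabilityMeasure (α × Vec n)) (I : α) :
    Vec n :=
  ∫ x, x ∂((ν : Measure (α × Vec n)).condKernel I)

lemma measurable_condMean {α : Type*} [MeasurableSpace α] {n : ℕ}
    (ν : ProbabilityMeasure (α × Vec n)) : Measurable (condMean ν) :=
  (StronglyMeasurable.integral_kernel (κ := (ν : Measure (α × Vec n)).condKernel)
    (f := fun x : Vec n => x) stronglyMeasurable_id).measurable

section ClosedLoop

variable {nx nu ny : ℕ} (D : Data nx nu ny)

/-- The law of `(I_0, x_0)`, where `I_0 = y_0 = C x_0 + v_0` and `v_0 ∼ N(0, M)` is independent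
of `x_0`. -/
def initLaw : ProbabilityMeasure (Info ny nu 0 × Vec nx) :=
  ⟨((D.init : Measure (Vec nx)).prod (multivariateGaussian 0 D.M)).map
      (fun p => ((fun _ => act D.C p.1 + p.2, Fin.elim0), p.1)), by
    refine Measure.isProbabilityMeasure_map (Measurable.aemeasurable ?_)
    refine Measurable.prodMk (Measurable.prodMk ?_ measurable_const) measurable_fst
    exact measurable_pi_iff.2 fun _ => ((measurable_act D.C).comp measurable_fst).add measurable_snd⟩

/-- The law of `w_t` given `(I_t, x_t)`: it is `γ_t(I_t)` (conditionally on `I_t`, the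
disturbance is independent of the state), where `x̄_t` is computed from the law `ν` of
`(I_t, x_t)`. -/
def disturbance (γ : DistPolicy nx nu ny) {t : ℕ} (ν : ProbabilityMeasure (Info ny nu t × Vec nx)) :
    Kernel (Info ny nu t × Vec nx) (Vec nx) :=
  (γ.law t).comap (fun z => (z.1, condMean ν z.1))
    (measurable_fst.prodMk ((measurable_condMean ν).comp measurable_fst))

instance (γ : DistPolicy nx nu ny) {t : ℕ} (ν : ProbabilityMeasure (Info ny nu t × Vec nx)) :
    IsMarkovKernel (disturbance γ ν) := by
  have := γ.markov t
  unfold disturbance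
  infer_instance

/-- The control `u_t = π_t(I_t)`, where `x̄_t` is computed from the law `ν` of `(I_t, x_t)`. -/
def control (π : ControlPolicy nx nu ny) {t : ℕ} (ν : ProbabilityMeasure (Info ny nu t × Vec nx))
    (I : Info ny nu t) : Vec nu :=
  π.toFun t (I, condMean ν I)

/-- `((I_t, x_t), w_t), v_{t+1} ↦ (I_{t+1}, x_{t+1})`, where `x_{t+1} = A x_t + B u_t + w_t`,
`y_{t+1} = C x_{t+1} + v_{t+1}` and `I_{t+1} = (I_t, y_{t+1}, u_t)`. -/
def step (π : ControlPolicy nx nu ny) {t : ℕ} (ν : ProbabilityMeasure (Info ny nu t × Vec nx))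
    (p : ((Info ny nu t × Vec nx) × Vec nx) × Vec ny) : Info ny nu (t + 1) × Vec nx :=
  let u := control π ν p.1.1.1
  let x' := act D.A p.1.1.2 + act D.B u + p.1.2
  (p.1.1.1.extend (act D.C x' + p.2) u, x')

lemma measurable_control (π : ControlPolicy nx nu ny) {t : ℕ}
    (ν : ProbabilityMeasure (Info ny nu t × Vec nx)) : Measurable (control π ν) :=
  (π.measurable' t).comp (measurable_id.prodMk (measurable_condMean ν))

lemma measurable_step (π : ControlPolicy nx nu ny) {t : ℕ}
    (ν : ProbabilityMeasure (Info ny nu t × Vec nx)) : Measurable (step D π ν) := by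
  have hI : Measurable fun p : ((Info ny nu t × Vec nx) × Vec nx) × Vec ny => p.1.1.1 := by
    fun_prop
  have hu := (measurable_control π ν).comp hI
  have hx : Measurable fun p : ((Info ny nu t × Vec nx) × Vec nx) × Vec ny =>
      act D.A p.1.1.2 + act D.B (control π ν p.1.1.1) + p.1.2 :=
    (((measurable_act D.A).comp (by fun_prop)).add ((measurable_act D.B).comp hu)).add (by fun_prop)
  have hy := ((measurable_act D.C).comp hx).add
    (measurable_snd : Measurable fun p : ((Info ny nu t × Vec nx) × Vec nx) × Vec ny => p.2)
  exact ((measurable_snoc.comp ((measurable_fst.comp hI).prodMk hy)).prodMk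
    (measurable_snoc.comp ((measurable_snd.comp hI).prodMk hu))).prodMk hx

/-- The law of `(I_{t+1}, x_{t+1})` obtained from the law `ν` of `(I_t, x_t)`; the output noise
`v_{t+1} ∼ N(0, M)` is independent of `(I_t, x_t, w_t)`. -/
def nextLaw (π : ControlPolicy nx nu ny) (γ : DistPolicy nx nu ny) {t : ℕ}
    (ν : ProbabilityMeasure (Info ny nu t × Vec nx)) :
    ProbabilityMeasure (Info ny nu (t + 1) × Vec nx) :=
  ⟨(((ν : Measure (Info ny nu t × Vec nx)) ⊗ₘ disturbance γ ν).prod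
      (multivariateGaussian 0 D.M)).map (step D π ν),
    Measure.isProbabilityMeasure_map (measurable_step D π ν).aemeasurable⟩

/-- The law of `(I_t, x_t)` under the policy pair `(π, γ)`. -/
def closedLoop (π : ControlPolicy nx nu ny) (γ : DistPolicy nx nu ny) :
    (t : ℕ) → ProbabilityMeasure (Info ny nu t × Vec nx)
  | 0 => initLaw D
  | t + 1 => nextLaw D π γ (closedLoop π γ t)

/-- The conditional mean `x̄_t = E[x_t | I_t]` under `(π, γ)`, as a function of `I_t`. -/
def xbar (π : ControlPolicy nx nu ny) (γ : DistPolicy nx nu ny) (t : ℕ) (I : Info ny nu t) :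
    Vec nx :=
  condMean (closedLoop D π γ t) I

/-! ### The Gelbrich-penalized average cost -/

/-- `E_y[E[x_tᵀ Q x_t | I_t] + u_tᵀ R u_t] = E[x_tᵀ Q x_t + u_tᵀ R u_t]`, possibly infinite. -/
def stageCost (π : ControlPolicy nx nu ny) (γ : DistPolicy nx nu ny) (t : ℕ) : ℝ≥0∞ :=
  ∫⁻ z, ENNReal.ofReal (quad D.Q z.2 + quad D.R (π.toFun t (z.1, xbar D π γ t z.1)))
    ∂(closedLoop D π γ t : Measure (Info ny nu t × Vec nx))

/-- `E_y[λ G(ℙ_t, ℚ_t)²]`, where `ℙ_t = γ_t(I_t)`, possibly infinite. -/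
def stagePenalty (π : ControlPolicy nx nu ny) (γ : DistPolicy nx nu ny) (t : ℕ) : ℝ≥0∞ :=
  ∫⁻ z, ENNReal.ofReal
      (D.lam * gelbrich (γ.law t (z.1, xbar D π γ t z.1)) (D.nominal t : Measure (Vec nx)) ^ 2)
    ∂(closedLoop D π γ t : Measure (Info ny nu t × Vec nx))

/-- The cost accumulated up to the horizon `T`. It is the extended-real expectation of the sum of
the penalized stage costs; in the indeterminate case `⊤ - ⊤` its value is `⊥`. -/
def horizonCost (π : ControlPolicy nx nu ny) (γ : DistPolicy nx nu ny) (T : ℕ) : EReal :=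
  ((∑ t ∈ Finset.range T, stageCost D π γ t : ℝ≥0∞) : EReal) -
    ((∑ t ∈ Finset.range T, stagePenalty D π γ t : ℝ≥0∞) : EReal)

/-- `J_∞^λ(π, γ)`. -/
def avgCost (π : ControlPolicy nx nu ny) (γ : DistPolicy nx nu ny) : EReal :=
  limsup (fun T : ℕ => horizonCost D π γ T / ((T : ℝ) : EReal)) atTop

end ClosedLoop

/-! ### The stationary policy pair -/

namespace Data

variable {nx nu ny : ℕ} (D : Data nx nu ny)

/-- `ŵ`, the mean of the nominal distributions (stationary by assumption). -/
def wHat : Vec nx := meanVec (D.nominal 0 : Measure (Vec nx))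

/-- `Σ̂`, the covariance matrix of the nominal distributions (stationary by assumption). -/
def SigmaHat : Mat nx nx := covMat (D.nominal 0 : Measure (Vec nx))

/-- `Φ = B R⁻¹ Bᵀ - λ⁻¹ I`. -/
def Phi : Mat nx nx := D.B * D.R⁻¹ * D.Bᵀ - (D.lam)⁻¹ • (1 : Mat nx nx)

/-- `P` is a positive semidefinite solution of the algebraic Riccati equation
`P = Q + Aᵀ (I + P Φ)⁻¹ P A`. -/
def IsRiccatiSolution (P : Mat nx nx) : Prop :=
  P.PosSemidef ∧ P = D.Q + D.Aᵀ * (1 + P * D.Phi)⁻¹ * P * D.A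

/-- `S_ss = Q + Aᵀ P A - P`. -/
def Sss (P : Mat nx nx) : Mat nx nx := D.Q + D.Aᵀ * P * D.A - P

/-- `r_ss = [I - Aᵀ (I + P Φ)⁻¹]⁻¹ Aᵀ (I + P Φ)⁻¹ P ŵ`. -/
def rss (P : Mat nx nx) : Vec nx :=
  act ((1 - D.Aᵀ * (1 + P * D.Phi)⁻¹)⁻¹ * D.Aᵀ * (1 + P * D.Phi)⁻¹ * P) D.wHat

def Kss (P : Mat nx nx) : Mat nu nx := -(D.R⁻¹ * D.Bᵀ * (1 + P * D.Phi)⁻¹ * P * D.A)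

def Lss (P : Mat nx nx) : Vec nu :=
  -act (D.R⁻¹ * D.Bᵀ * (1 + P * D.Phi)⁻¹) (act P D.wHat + D.rss P)

def Hss (P : Mat nx nx) : Mat nx nx :=
  (D.lam • (1 : Mat nx nx) - P)⁻¹ * P * (D.A + D.B * D.Kss P)

def Gss (P : Mat nx nx) : Vec nx :=
  act (D.lam • (1 : Mat nx nx) - P)⁻¹
    (act (P * D.B) (D.Lss P) + D.rss P + D.lam • D.wHat)

/-- Objective of the stationary maximization problem:
`Tr[S_ss X + (P - λ I) Σ + 2 λ (Σ̂^{1/2} Σ Σ̂^{1/2})^{1/2}]`. -/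
def covObjective (P X Sig : Mat nx nx) : ℝ :=
  Matrix.trace (D.Sss P * X + (P - D.lam • (1 : Mat nx nx)) * Sig +
    (2 * D.lam) • CFC.sqrt (CFC.sqrt D.SigmaHat * Sig * CFC.sqrt D.SigmaHat))

/-- Feasibility of `(X, X⁻, Σ)`: positive semidefinite matrices with `X⁻ = A X Aᵀ + Σ` and
`X = X⁻ - X⁻ Cᵀ (C X⁻ Cᵀ + M)⁻¹ C X⁻`. -/
def CovFeasible (X Xm Sig : Mat nx nx) : Prop :=
  X.PosSemidef ∧ Xm.PosSemidef ∧ Sig.PosSemidef ∧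
    Xm = D.A * X * D.Aᵀ + Sig ∧
    X = Xm - Xm * D.Cᵀ * (D.C * Xm * D.Cᵀ + D.M)⁻¹ * D.C * Xm

/-- `(X, X⁻, Σ)` is an optimal solution of the stationary maximization problem. -/
def IsCovOptimal (P X Xm Sig : Mat nx nx) : Prop :=
  D.CovFeasible X Xm Sig ∧
    ∀ X' Xm' Sig', D.CovFeasible X' Xm' Sig' → D.covObjective P X' Sig' ≤ D.covObjective P X Sig

/-- The steady-state average cost
`ρ = (2ŵ - Φ r_ss)ᵀ (I + P Φ)⁻¹ r_ss - λ Tr Σ̂ + ŵᵀ (I + P Φ)⁻¹ P ŵ + z_ss`, where `z_ss` is the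
value of the objective at the optimal solution. -/
def rho (P X Sig : Mat nx nx) : ℝ :=
  inner ℝ ((2 : ℝ) • D.wHat - act D.Phi (D.rss P)) (act (1 + P * D.Phi)⁻¹ (D.rss P))
    - D.lam * Matrix.trace D.SigmaHat
    + inner ℝ D.wHat (act ((1 + P * D.Phi)⁻¹ * P) D.wHat)
    + D.covObjective P X Sig

/-- The bias `h(I_t) = x̄_tᵀ P x̄_t + 2 r_ssᵀ x̄_t + Tr[(S_ss + P) X̄_ss]`, as a function of
`x̄_t`. -/
def bias (P X : Mat nx nx) (x : Vec nx) : ℝ :=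
  quad P x + 2 * inner ℝ (D.rss P) x + Matrix.trace ((D.Sss P + P) * X)

/-- `π_ss^*(I_t) = K_ss x̄_t + L_ss`. -/
def piSS (P : Mat nx nx) : ControlPolicy nx nu ny where
  toFun _ p := act (D.Kss P) p.2 + D.Lss P
  measurable' _ := ((measurable_act _).comp measurable_snd).add measurable_const

lemma measurable_gaussian {α : Type*} [MeasurableSpace α] {n : ℕ} (S : Mat n n) {f : α → Vec n}
    (hf : Measurable f) : Measurable fun a => multivariateGaussian (f a) S := by
  refine Measure.measurable_of_measurable_coe _ fun s hs => ?_
  have hm : Measurable fun p : α × Vec n =>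
      f p.1 + Matrix.toEuclideanCLM (𝕜 := ℝ) (CFC.sqrt S) p.2 :=
    (hf.comp measurable_fst).add ((ContinuousLinearMap.measurable _).comp measurable_snd)
  have h : (fun a => multivariateGaussian (f a) S s) = fun a =>
      stdGaussian (Vec n) (Prod.mk a ⁻¹' ((fun p : α × Vec n =>
        f p.1 + Matrix.toEuclideanCLM (𝕜 := ℝ) (CFC.sqrt S) p.2) ⁻¹' s)) := by
    funext a
    rw [multivariateGaussian, Measure.map_apply (by fun_prop) hs]
    rfl
  rw [h]
  exact measurable_measure_prodMk_left (hm hs)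

/-- `γ_ss^*(I_t) = N(H_ss x̄_t + G_ss, Σ_ss^*)`. -/
def gammaSS (P Sig : Mat nx nx) : DistPolicy nx nu ny where
  law _ :=
    { toFun := fun p => multivariateGaussian (act (D.Hss P) p.2 + D.Gss P) Sig
      measurable' := measurable_gaussian Sig
        (((measurable_act _).comp measurable_snd).add measurable_const) }
  markov _ := ⟨fun _ => by
    change IsProbabilityMeasure (multivariateGaussian _ _); infer_instance⟩
  sq_integrable _ _ := IsGaussian.memLp_two_id (μ := multivariateGaussian _ _)

/-- `limsup_{T → ∞} T⁻¹ E_y[h(I_T) | π, γ] = 0`, all the expectations being well defined. -/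
def BiasVanishes (P X : Mat nx nx) (π : ControlPolicy nx nu ny) (γ : DistPolicy nx nu ny) : Prop :=
  (∀ T : ℕ, Integrable (fun z => D.bias P X (xbar D π γ T z.1))
    (closedLoop D π γ T : Measure (Info ny nu T × Vec nx))) ∧
  limsup (fun T : ℕ => (((1 / (T : ℝ)) * ∫ z, D.bias P X (xbar D π γ T z.1)
    ∂(closedLoop D π γ T : Measure (Info ny nu T × Vec nx)) : ℝ) : EReal)) atTop = 0

end Data

end GelbrichControl

end

open MeasureTheory ProbabilityTheory Filter Topology
open scoped ENNReal Matrix MatrixOrder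

noncomputable section

namespace GelbrichControl

/-! ### Positive semidefinite matrices -/

section PosSemidef

variable {n m : ℕ}

/-! The proof verifies a saddle point by two one-sided bounds: `avgCost_piSS_le` (the stationary
controller pays at most `ρ` against every admissible adversary) and `le_avgCost_gammaSS` (the
stationary adversary enforces at least `ρ`). Both apply to the stationary pair, so they meet there.

Both rest on the dynamic programming identity `StepL2.balance`, with potential `x̄ᵀPx̄ + 2rᵀx̄` plus
`Tr(P E_t)`, where `E_t` is the mean conditional covariance of the state. Each stage splits into a
deterministic game in the conditional means of state, control and disturbance, and terms linear in
`E_t` and in the mean conditional covariance `V_t` of the disturbance. The mean game is a quadratic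
saddle, convex in the control and, since `λI ≻ P`, concave in the disturbance mean. The Riccati
equation and the definition of `r` make its value reproduce the potential (`stageFn_saddle`,
`stageFn_le`, `le_stageFn`).

Upper bound. Conditional laws need not be Gaussian, but the conditional mean beats every linear
estimate, so `E_{t+1}` lies below an affine function of `(E_t, V_t)` for every gain. Averaging over
time with one common gain gives a subsolution of the stationary filter equation. Detectability puts
a solution above it (`exists_riccati_fixedPoint`), and optimality of `Σ*` bounds the average
(`sum_covObjective_le`). The square root in the Gelbrich penalty is linearized by `2 Tr N^{1/2} ≤ Tr
U + Tr(U⁻¹N)`, with a single `U` for the whole horizon.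

Lower bound. A genie reveals the initial state. Against the Gaussian adversary the state is then
conditionally Gaussian, whatever the control, with covariance `Z_t` given by the filter recursion
started at zero. Hence `E_t ≥ Z_t` (`GaussianGiven.le_errCov`), and stabilizability of `(A,
Σ*^{1/2})` gives `Z_t → X*` (`riccatiIter_zero_tendsto`). Since `S ⪰ 0`, this bounds the cost from
below, and the vanishing bias controls the terminal potential.

Integrability. Observability makes `P` positive definite, so an integrable bias puts `x̄_t` in `L²`.
An infinite penalty gives average cost `-∞`; with finite penalties, an infinite stage cost gives
`+∞`. Otherwise all variables are square integrable by induction. -/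

lemma PosSemidef.transpose_eq {X : Mat n n} (h : X.PosSemidef) : Xᵀ = X := by
  have := h.isHermitian.eq
  rwa [Matrix.conjTranspose_eq_transpose_of_trivial] at this

lemma PosSemidef.conj {X : Mat n n} (h : X.PosSemidef) (F : Mat m n) :
    (F * X * Fᵀ).PosSemidef := by
  have := h.mul_mul_conjTranspose_same F
  rwa [Matrix.conjTranspose_eq_transpose_of_trivial] at this

lemma PosSemidef.conj' {X : Mat n n} (h : X.PosSemidef) (F : Mat n m) :
    (Fᵀ * X * F).PosSemidef := by
  have := h.conjTranspose_mul_mul_same F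
  rwa [Matrix.conjTranspose_eq_transpose_of_trivial] at this

lemma conj_mono {X Y : Mat n n} (h : X ≤ Y) (F : Mat m n) : F * X * Fᵀ ≤ F * Y * Fᵀ := by
  rw [Matrix.le_iff] at h ⊢
  have := PosSemidef.conj h F
  rwa [Matrix.mul_sub, Matrix.sub_mul] at this

/-- By cyclicity, `Tr(XY) = Tr(X^{1/2} Y X^{1/2})`. -/
lemma trace_mul_nonneg {X Y : Mat n n} (hX : X.PosSemidef) (hY : Y.PosSemidef) :
    0 ≤ (X * Y).trace := by
  have hs : (CFC.sqrt X).PosSemidef := Matrix.nonneg_iff_posSemidef.1 (CFC.sqrt_nonneg X)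
  have hss := CFC.sqrt_mul_sqrt_self X hX.nonneg
  have h := (PosSemidef.conj hY (CFC.sqrt X)).trace_nonneg
  rwa [PosSemidef.transpose_eq hs, Matrix.trace_mul_comm, ← Matrix.mul_assoc, hss] at h

lemma trace_mul_mono {S X Y : Mat n n} (hS : S.PosSemidef) (h : X ≤ Y) :
    (S * X).trace ≤ (S * Y).trace := by
  have := trace_mul_nonneg hS (Matrix.le_iff.1 h)
  rw [Matrix.mul_sub, Matrix.trace_sub] at this
  linarith

lemma trace_mono {X Y : Mat n n} (h : X ≤ Y) : X.trace ≤ Y.trace := by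
  have := (Matrix.le_iff.1 h).trace_nonneg
  rw [Matrix.trace_sub] at this
  linarith

lemma dotProduct_nonneg {X : Mat n n} (h : X.PosSemidef) (x : Fin n → ℝ) : 0 ≤ x ⬝ᵥ X *ᵥ x := by
  simpa using h.dotProduct_mulVec_nonneg x

lemma posSemidef_of_dotProduct {X : Mat n n} (hX : Xᵀ = X) (h : ∀ x, 0 ≤ x ⬝ᵥ X *ᵥ x) :
    X.PosSemidef := by
  refine Matrix.PosSemidef.of_dotProduct_mulVec_nonneg ?_ (by simpa using h)
  rw [Matrix.IsHermitian, Matrix.conjTranspose_eq_transpose_of_trivial, hX]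

lemma mulVec_eq_zero_of_dotProduct {X : Mat n n} (h : X.PosSemidef) {x : Fin n → ℝ}
    (hx : x ⬝ᵥ X *ᵥ x = 0) : X *ᵥ x = 0 := by
  simpa using (h.dotProduct_mulVec_zero_iff x).1 (by simpa using hx)

/-- Testing with `e_i ± e_j` gives `2|X_ij| ≤ X_ii + X_jj`, and every diagonal entry is at most the
trace. -/
lemma abs_apply_le_trace {X : Mat n n} (h : X.PosSemidef) (i j : Fin n) : |X i j| ≤ X.trace := by
  have hd : ∀ k, X k k ≤ X.trace := fun k =>
    Finset.single_le_sum (f := fun k => X k k) (fun l _ => h.diag_nonneg) (Finset.mem_univ k)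
  have hs : X j i = X i j := congrFun (congrFun (PosSemidef.transpose_eq h) i) j
  have h1 := dotProduct_nonneg h (Pi.single i 1 + Pi.single j 1)
  have h2 := dotProduct_nonneg h (Pi.single i 1 - Pi.single j 1)
  simp [Matrix.mulVec_add, Matrix.mulVec_sub, add_dotProduct, sub_dotProduct] at h1 h2
  have := hd i; have := hd j
  rw [abs_le]; constructor <;> linarith

/-- A bounded monotone sequence of positive semidefinite matrices converges. -/
lemma exists_tendsto_of_monotone {Y : ℕ → Mat n n} (hY : Monotone Y) {c : ℝ}
    (hc : ∀ k, (Y k).trace ≤ c) : ∃ Z, Tendsto Y atTop (𝓝 Z) := by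
  have htr : CauchySeq fun k => (Y k).trace :=
    (tendsto_atTop_ciSup (fun a b h => trace_mono (hY h))
      ⟨c, by rintro _ ⟨k, rfl⟩; exact hc k⟩).cauchySeq
  -- The increments are positive semidefinite, so increments of the trace dominate those of each
  -- entry.
  have hij : ∀ i j, ∃ z, Tendsto (fun k => Y k i j) atTop (𝓝 z) := by
    intro i j
    refine cauchySeq_tendsto_of_complete ?_
    rw [Metric.cauchySeq_iff] at htr ⊢
    intro ε hε
    obtain ⟨N, hN⟩ := htr ε hε
    refine ⟨N, fun a ha b hb => ?_⟩
    wlog hab : a ≤ b generalizing a b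
    · rw [dist_comm]; exact this b hb a ha (le_of_not_ge hab)
    refine lt_of_le_of_lt ?_ (hN a ha b hb)
    have := abs_apply_le_trace (Matrix.le_iff.1 (hY hab)) i j
    rw [Matrix.trace_sub, Matrix.sub_apply] at this
    rw [dist_comm, dist_comm (Matrix.trace _), Real.dist_eq, Real.dist_eq]
    exact this.trans (le_abs_self _)
  choose Z hZ using hij
  exact ⟨Matrix.of Z, tendsto_pi_nhds.2 fun i => tendsto_pi_nhds.2 fun j => hZ i j⟩

lemma le_of_tendsto_mat {Y W : ℕ → Mat n n} {Z V : Mat n n} (hY : Tendsto Y atTop (𝓝 Z))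
    (hW : Tendsto W atTop (𝓝 V)) (h : ∀ᶠ k in atTop, Y k ≤ W k) : Z ≤ V := by
  have hd : Tendsto (fun k => W k - Y k) atTop (𝓝 (V - Z)) := hW.sub hY
  rw [Matrix.le_iff]
  refine posSemidef_of_dotProduct ?_ fun x => ?_
  · have h1 : Tendsto (fun k => (W k - Y k)ᵀ) atTop (𝓝 (V - Z)ᵀ) :=
      (continuous_id.matrix_transpose.tendsto _).comp hd
    refine tendsto_nhds_unique (h1.congr' ?_) hd
    filter_upwards [h] with k hk using PosSemidef.transpose_eq (Matrix.le_iff.1 hk)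
  · have h1 : Tendsto (fun k => x ⬝ᵥ (W k - Y k) *ᵥ x) atTop (𝓝 (x ⬝ᵥ (V - Z) *ᵥ x)) := by
      have hc : Continuous fun X : Mat n n => x ⬝ᵥ X *ᵥ x :=
        continuous_const.dotProduct (continuous_id.matrix_mulVec continuous_const)
      exact (hc.tendsto _).comp hd
    refine ge_of_tendsto h1 ?_
    filter_upwards [h] with k hk using dotProduct_nonneg (Matrix.le_iff.1 hk) x

end PosSemidef

/-! ### Trace of the square root -/

section Sqrt

variable {n : ℕ}

lemma sqrt_posSemidef (X : Mat n n) : (CFC.sqrt X).PosSemidef :=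
  Matrix.nonneg_iff_posSemidef.1 (CFC.sqrt_nonneg X)

lemma sqrt_mul_self {X : Mat n n} (h : X.PosSemidef) : CFC.sqrt X * CFC.sqrt X = X :=
  CFC.sqrt_mul_sqrt_self X h.nonneg

lemma sqrt_conj_posSemidef {S : Mat n n} (h : S.PosSemidef) (T : Mat n n) :
    (CFC.sqrt T * S * CFC.sqrt T).PosSemidef := by
  have := PosSemidef.conj h (CFC.sqrt T)
  rwa [PosSemidef.transpose_eq (sqrt_posSemidef T)] at this

lemma PosDef.mul_inv {T : Mat n n} (h : T.PosDef) : T * T⁻¹ = 1 :=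
  Matrix.mul_nonsing_inv _ ((Matrix.isUnit_iff_isUnit_det _).1 h.isUnit)

lemma PosDef.inv_mul {T : Mat n n} (h : T.PosDef) : T⁻¹ * T = 1 :=
  Matrix.nonsing_inv_mul _ ((Matrix.isUnit_iff_isUnit_det _).1 h.isUnit)

/-- With `s = N^{1/2}`, expand `Tr((T - s) T⁻¹ (T - s)) ≥ 0`. The bound is affine in `N`, so it
survives averaging over time and over the information. -/
lemma two_trace_sqrt_le {N T : Mat n n} (hN : N.PosSemidef) (hT : T.PosDef) :
    2 * (CFC.sqrt N).trace ≤ T.trace + (T⁻¹ * N).trace := by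
  set s := CFC.sqrt N with hs
  have hss : s * s = N := sqrt_mul_self hN
  have hsT : (T - s)ᵀ = T - s := by
    rw [Matrix.transpose_sub, PosSemidef.transpose_eq hT.posSemidef,
      PosSemidef.transpose_eq (sqrt_posSemidef N)]
  have h := (PosSemidef.conj hT.inv.posSemidef (T - s)).trace_nonneg
  have he : (T - s) * T⁻¹ * (T - s) = T - s - s + s * T⁻¹ * s := by
    have h1 := PosDef.mul_inv hT
    have h2 := PosDef.inv_mul hT
    calc (T - s) * T⁻¹ * (T - s) = (T * T⁻¹) * T - (T * T⁻¹) * s - s * (T⁻¹ * T) + s * T⁻¹ * s := by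
          noncomm_ring
      _ = _ := by rw [h1, h2]; simp
  rw [hsT, he, Matrix.trace_add, Matrix.trace_sub, Matrix.trace_sub, Matrix.mul_assoc,
    Matrix.trace_mul_comm s, Matrix.mul_assoc, hss] at h
  linarith

lemma posDef_add_smul_one {X : Mat n n} (h : X.PosSemidef) {ε : ℝ} (hε : 0 < ε) :
    (X + ε • (1 : Mat n n)).PosDef :=
  Matrix.PosDef.posSemidef_add h (Matrix.PosDef.one.smul hε)

/-- The bound of `two_trace_sqrt_le` is nearly attained at `T = s + εI`. The regularization is
needed because `s` may be singular. -/
lemma trace_add_inv_mul_sq_le {s : Mat n n} (hs : s.PosSemidef) {ε : ℝ} (hε : 0 < ε) :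
    (s + ε • (1 : Mat n n)).trace + ((s + ε • (1 : Mat n n))⁻¹ * (s * s)).trace ≤
      2 * s.trace + ε * n := by
  have hT := posDef_add_smul_one hs hε
  set T := s + ε • (1 : Mat n n) with hTd
  have h0 := trace_mul_nonneg hT.inv.posSemidef hs
  have he : T⁻¹ * (s * s) = s - ε • (T⁻¹ * s) := by
    have hsT : s = T - ε • (1 : Mat n n) := by rw [hTd]; simp
    calc T⁻¹ * (s * s) = T⁻¹ * ((T - ε • (1 : Mat n n)) * s) := by rw [← hsT]
      _ = (T⁻¹ * T) * s - ε • (T⁻¹ * s) := by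
        rw [Matrix.sub_mul, Matrix.mul_sub, Matrix.mul_assoc]; simp
      _ = _ := by rw [PosDef.inv_mul hT]; simp
  rw [he, Matrix.trace_sub, Matrix.trace_smul, hTd, Matrix.trace_add, Matrix.trace_smul,
    Matrix.trace_one, ← hTd]
  simp only [smul_eq_mul, Fintype.card_fin]
  nlinarith

/-- Use the test matrix `c(T + εI)` in `two_trace_sqrt_le` and let `ε → 0`. The case `c = 1` makes
the Bures term nonnegative; `c = 2` makes it coercive in `S`. -/
lemma two_trace_sqrt_conj_le {S T : Mat n n} (hS : S.PosSemidef) (hT : T.PosSemidef) {c : ℝ}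
    (hc : 0 < c) :
    2 * (CFC.sqrt (CFC.sqrt T * S * CFC.sqrt T)).trace ≤ c⁻¹ * S.trace + c * T.trace := by
  refine le_of_forall_pos_le_add fun δ hδ => ?_
  obtain ⟨ε, hε, hεδ⟩ : ∃ ε : ℝ, 0 < ε ∧ c * (ε * n) ≤ δ := by
    refine ⟨δ / (c * (n + 1)), by positivity, ?_⟩
    rw [← mul_assoc, mul_div_assoc', div_mul_eq_mul_div, div_le_iff₀ (by positivity)]
    nlinarith [mul_pos hc hδ, (Nat.cast_nonneg n : (0 : ℝ) ≤ n)]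
  have hU := posDef_add_smul_one hT hε
  set U := T + ε • (1 : Mat n n) with hUd
  set t := CFC.sqrt T with ht
  have htt : t * t = T := sqrt_mul_self hT
  have h1 := two_trace_sqrt_le (sqrt_conj_posSemidef hS T) (hU.smul hc)
  -- `U = t² + εI` commutes with `t`, so both factors `t` can be brought together under the trace.
  have hcomm : t * U⁻¹ = U⁻¹ * t := by
    have h2 : U * t = t * U := by
      rw [hUd, ← htt, Matrix.add_mul, Matrix.mul_add, Matrix.mul_assoc]; simp
    calc t * U⁻¹ = U⁻¹ * (U * t) * U⁻¹ := by
          rw [← Matrix.mul_assoc, PosDef.inv_mul hU, Matrix.one_mul]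
      _ = U⁻¹ * t * (U * U⁻¹) := by rw [h2]; simp only [Matrix.mul_assoc]
      _ = _ := by rw [PosDef.mul_inv hU, Matrix.mul_one]
  have hinv : (c • U)⁻¹ = c⁻¹ • U⁻¹ := by
    refine Matrix.inv_eq_right_inv ?_
    rw [Matrix.smul_mul, Matrix.mul_smul, PosDef.mul_inv hU, smul_smul, mul_inv_cancel₀ hc.ne',
      one_smul]
  have h3 : ((c • U)⁻¹ * (t * S * t)).trace = c⁻¹ * (S.trace - ε * (U⁻¹ * S).trace) := by
    have h4 : U⁻¹ * T = 1 - ε • U⁻¹ := by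
      have : T = U - ε • (1 : Mat n n) := by rw [hUd]; simp
      rw [this, Matrix.mul_sub, PosDef.inv_mul hU]; simp
    have h5 : (U⁻¹ * (t * S * t)).trace = (U⁻¹ * T * S).trace := by
      rw [← htt, ← Matrix.mul_assoc, Matrix.trace_mul_comm, ← Matrix.mul_assoc, ← Matrix.mul_assoc,
        hcomm, Matrix.mul_assoc U⁻¹]
    rw [hinv, Matrix.smul_mul, Matrix.trace_smul, h5, h4, Matrix.sub_mul, Matrix.trace_sub,
      Matrix.one_mul, Matrix.smul_mul, Matrix.trace_smul, smul_eq_mul, smul_eq_mul]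
  have h6 : (c • U).trace = c * (T.trace + ε * n) := by
    rw [hUd, Matrix.trace_smul, Matrix.trace_add, Matrix.trace_smul, Matrix.trace_one]; simp
  have h7 := trace_mul_nonneg hU.inv.posSemidef hS
  rw [h3, h6] at h1
  have : 0 ≤ c⁻¹ * (ε * (U⁻¹ * S).trace) := by positivity
  nlinarith

end Sqrt

/-! ### The measurement update of the error covariance -/

section Filter

variable {n m : ℕ} {A : Mat n n} {C : Mat m n} {M : Mat m m}

/-- The error covariance of the linear estimate with gain `L`, from the prior covariance `W`. -/
def gainMap (C : Mat m n) (M : Mat m m) (L : Mat n m) (W : Mat n n) : Mat n n :=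
  (1 - L * C) * W * (1 - L * C)ᵀ + L * M * Lᵀ

/-- The Kalman gain: it minimizes `gainMap` in the Loewner order, with minimum `filt`. -/
def optGain (C : Mat m n) (M : Mat m m) (W : Mat n n) : Mat n m :=
  W * Cᵀ * (C * W * Cᵀ + M)⁻¹

/-- The error covariance of the optimal linear estimate, from the prior covariance `W`. -/
def filt (C : Mat m n) (M : Mat m m) (W : Mat n n) : Mat n n :=
  W - W * Cᵀ * (C * W * Cᵀ + M)⁻¹ * C * W

lemma innovation_posDef (hM : M.PosDef) {W : Mat n n} (hW : W.PosSemidef) (C : Mat m n) :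
    (C * W * Cᵀ + M).PosDef :=
  Matrix.PosDef.posSemidef_add (PosSemidef.conj hW C) hM

/-- Completing the square in the gain, with the innovation covariance as weight. Keeping `A` general
covers both the update (`A = 1`) and the observer form `A + LC` that detectability speaks of. -/
lemma predict_eq (hM : M.PosDef) {W : Mat n n} (hW : W.PosSemidef) (A : Mat n n) (L : Mat n m) :
    (A + L * C) * W * (A + L * C)ᵀ + L * M * Lᵀ = A * filt C M W * Aᵀ +
      (L + A * optGain C M W) * (C * W * Cᵀ + M) * (L + A * optGain C M W)ᵀ := by
  have hV := innovation_posDef hM hW C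
  unfold filt optGain
  set V := C * W * Cᵀ + M with hVd
  have hMV : M = V - C * W * Cᵀ := by rw [hVd]; simp
  have hU : (V⁻¹)ᵀ = V⁻¹ := PosSemidef.transpose_eq hV.inv.posSemidef
  have hW' := PosSemidef.transpose_eq hW
  have h1 := PosDef.mul_inv hV
  have h2 := PosDef.inv_mul hV
  rw [hMV]
  simp only [Matrix.transpose_add, Matrix.transpose_mul, hU, hW', Matrix.transpose_transpose]
  have e1 : (L + A * (W * Cᵀ * V⁻¹)) * V = L * V + A * (W * Cᵀ) := by
    rw [Matrix.add_mul, ← Matrix.mul_assoc A (W * Cᵀ), Matrix.mul_assoc _ V⁻¹, h2, Matrix.mul_one]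
  have e2 : L * V * (V⁻¹ * (C * W) * Aᵀ) = L * (C * W) * Aᵀ := by
    rw [Matrix.mul_assoc L V, ← Matrix.mul_assoc V, ← Matrix.mul_assoc V, h1, Matrix.one_mul,
      Matrix.mul_assoc L]
  rw [e1, Matrix.add_mul _ _ (Lᵀ + _), Matrix.mul_add (L * V), e2]
  simp only [Matrix.mul_add, Matrix.add_mul, Matrix.mul_sub, Matrix.sub_mul, Matrix.mul_assoc]
  abel

lemma gainMap_eq (hM : M.PosDef) {W : Mat n n} (hW : W.PosSemidef) (L : Mat n m) :
    gainMap C M L W = filt C M W +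
      (L - optGain C M W) * (C * W * Cᵀ + M) * (L - optGain C M W)ᵀ := by
  -- The case `A = 1` with gain `-L`.
  have h := predict_eq (C := C) hM hW 1 (-L)
  rw [show -L + (1 : Mat n n) * optGain C M W = -(L - optGain C M W) by
    rw [Matrix.one_mul]; abel] at h
  simp only [Matrix.neg_mul, Matrix.transpose_neg, Matrix.mul_neg, neg_neg, Matrix.one_mul,
    Matrix.transpose_one, Matrix.mul_one, ← sub_eq_add_neg] at h
  exact h

lemma filt_le_gainMap (hM : M.PosDef) {W : Mat n n} (hW : W.PosSemidef) (L : Mat n m) :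
    filt C M W ≤ gainMap C M L W := by
  rw [Matrix.le_iff, gainMap_eq hM hW L, add_sub_cancel_left]
  exact PosSemidef.conj (innovation_posDef hM hW C).posSemidef _

lemma filt_eq_gainMap (hM : M.PosDef) {W : Mat n n} (hW : W.PosSemidef) :
    filt C M W = gainMap C M (optGain C M W) W := by
  rw [gainMap_eq hM hW]; simp

lemma gainMap_mono (L : Mat n m) {W V : Mat n n} (h : W ≤ V) :
    gainMap C M L W ≤ gainMap C M L V :=
  add_le_add_left (conj_mono h _) _

lemma filt_posSemidef (hM : M.PosDef) {W : Mat n n} (hW : W.PosSemidef) :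
    (filt C M W).PosSemidef := by
  rw [filt_eq_gainMap hM hW]
  exact (PosSemidef.conj hW _).add (PosSemidef.conj hM.posSemidef _)

/-- `filt` is an infimum over gains of maps that are monotone in the prior; it suffices to use the
gain optimal for the larger prior. -/
lemma filt_mono (hM : M.PosDef) {W V : Mat n n} (hW : W.PosSemidef) (hV : V.PosSemidef)
    (h : W ≤ V) : filt C M W ≤ filt C M V := by
  rw [filt_eq_gainMap hM hV]
  exact (filt_le_gainMap hM hW _).trans (gainMap_mono _ h)

lemma filt_le_self (hM : M.PosDef) {W : Mat n n} (hW : W.PosSemidef) : filt C M W ≤ W := by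
  have := filt_le_gainMap (C := C) hM hW 0
  simpa [gainMap] using this

/-- With `A + LC` Schur stable, this makes the prior covariances obey a contractive Lyapunov
inequality. -/
lemma conj_filt_le (hM : M.PosDef) {W : Mat n n} (hW : W.PosSemidef) (A : Mat n n) (L : Mat n m) :
    A * filt C M W * Aᵀ ≤ (A + L * C) * W * (A + L * C)ᵀ + L * M * Lᵀ := by
  rw [Matrix.le_iff, predict_eq hM hW, add_sub_cancel_left]
  exact PosSemidef.conj (innovation_posDef hM hW C).posSemidef _

lemma tendsto_filt (hM : M.PosDef) {W : ℕ → Mat n n} {V : Mat n n} (hV : V.PosSemidef)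
    (h : Tendsto W atTop (𝓝 V)) :
    Tendsto (fun k => filt C M (W k)) atTop (𝓝 (filt C M V)) := by
  have hU := (Matrix.isUnit_iff_isUnit_det _).1 (innovation_posDef hM hV C).isUnit
  -- Cramer's rule: the inverse is continuous where the determinant does not vanish.
  have hinn : ContinuousAt (fun W : Mat n n => (C * W * Cᵀ + M)⁻¹) V := by
    have hdet : ContinuousAt (fun W : Mat n n => (C * W * Cᵀ + M).det) V := by fun_prop
    have hadj : ContinuousAt (fun W : Mat n n => (C * W * Cᵀ + M).adjugate) V := by fun_prop
    simp only [Matrix.inv_def, Ring.inverse_eq_inv']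
    exact (hdet.inv₀ hU.ne_zero).smul hadj
  have hc : Continuous fun p : Mat n n × Mat m m => p.1 - p.1 * Cᵀ * p.2 * C * p.1 :=
    continuous_fst.sub ((((continuous_fst.matrix_mul continuous_const).matrix_mul
      continuous_snd).matrix_mul continuous_const).matrix_mul continuous_fst)
  exact (hc.tendsto _).comp (h.prodMk_nhds (hinn.tendsto.comp h))

end Filter

/-! ### Powers of Schur stable matrices -/

section Schur

attribute [local instance] Matrix.frobeniusNormedRing Matrix.frobeniusNormedAlgebra
  Matrix.frobeniusNormedAddCommGroup Matrix.frobeniusNormedSpace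

variable {n : ℕ}

/-- By Gelfand's formula the powers are eventually dominated by `q^k` for some `q` between the
spectral radius and `1`. The Frobenius norm does not change on passing to complex entries. -/
lemma summable_sq_norm_pow {F : Mat n n} (hF : IsSchurStable F) :
    Summable fun k => ‖F ^ k‖ ^ 2 := by
  set G : Matrix (Fin n) (Fin n) ℂ := F.map (algebraMap ℝ ℂ) with hG
  have hpow : ∀ k, ‖F ^ k‖ = ‖G ^ k‖ := by
    intro k
    have : G ^ k = (F ^ k).map (algebraMap ℝ ℂ) := by
      rw [hG]; exact (map_pow (RingHom.mapMatrix (algebraMap ℝ ℂ)) F k).symm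
    rw [this, Matrix.frobenius_norm_map_eq]
    intro a; simp
  have hr : spectralRadius ℂ G < 1 := by
    -- The spectrum is empty when `n = 0`.
    rcases (spectrum ℂ G).eq_empty_or_nonempty with h | h
    · simp [spectralRadius, h]
    · have := spectrum.spectralRadius_lt_of_forall_lt_of_nonempty (a := G) h (r := 1)
        (fun z hz => by simpa [← NNReal.coe_lt_coe] using hF z hz)
      simpa using this
  obtain ⟨q, hq, hq1⟩ := ENNReal.lt_iff_exists_nnreal_btwn.1 hr
  have hlim := (spectrum.pow_nnnorm_pow_one_div_tendsto_nhds_spectralRadius G).eventually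
    (gt_mem_nhds hq)
  have hq1' : (q : ℝ) < 1 := by exact_mod_cast hq1
  refine summable_of_isBigO_nat' (g := fun k => (q ^ 2 : ℝ) ^ k)
    (summable_geometric_of_lt_one (by positivity) (by nlinarith [q.2])) ?_
  refine Asymptotics.IsBigO.of_bound 1 ?_
  filter_upwards [hlim, eventually_gt_atTop 0] with k hk hk0
  have h1 : (‖G ^ k‖₊ : ℝ≥0∞) ≤ (q : ℝ≥0∞) ^ k := by
    have h2 := pow_le_pow_left' hk.le k
    rwa [← ENNReal.rpow_natCast, ← ENNReal.rpow_mul, one_div_mul_cancel (by positivity),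
      ENNReal.rpow_one] at h2
  have h3 : ‖G ^ k‖ ≤ (q : ℝ) ^ k := by exact_mod_cast h1
  rw [hpow, one_mul, Real.norm_of_nonneg (by positivity), Real.norm_of_nonneg (by positivity),
    ← pow_mul, mul_comm 2, pow_mul]
  exact pow_le_pow_left₀ (norm_nonneg _) h3 2

lemma exists_trace_conj_le (n : ℕ) : ∃ c : ℝ, 0 ≤ c ∧ ∀ F V : Mat n n,
    (F * V * Fᵀ).trace ≤ c * ‖V‖ * ‖F‖ ^ 2 := by
  obtain ⟨c, hc, h⟩ := (LinearMap.toContinuousLinearMap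
    (Matrix.traceLinearMap (Fin n) ℝ ℝ)).bound
  refine ⟨c, hc.le, fun F V => ?_⟩
  have h1 := h (F * V * Fᵀ)
  have h2 : ‖F * V * Fᵀ‖ ≤ ‖V‖ * ‖F‖ ^ 2 := by
    calc ‖F * V * Fᵀ‖ ≤ ‖F‖ * ‖V‖ * ‖Fᵀ‖ :=
          (norm_mul_le _ _).trans (by gcongr; exact norm_mul_le _ _)
      _ = _ := by rw [Matrix.frobenius_norm_transpose]; ring
  calc (F * V * Fᵀ).trace ≤ ‖(F * V * Fᵀ).trace‖ := le_abs_self _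
    _ ≤ c * ‖F * V * Fᵀ‖ := h1
    _ ≤ c * (‖V‖ * ‖F‖ ^ 2) := by gcongr
    _ = _ := by ring

/-- Unroll the Lyapunov inequality; the resulting series is bounded by `∑ ‖F^j‖²`. -/
lemma bounded_trace_of_contraction {F : Mat n n} (hF : IsSchurStable F) {W : ℕ → Mat n n}
    {V : Mat n n} (h : ∀ k, W (k + 1) ≤ F * W k * Fᵀ + V) :
    ∃ c, ∀ k, (W k).trace ≤ c := by
  have hk : ∀ k, W k ≤ F ^ k * W 0 * (F ^ k)ᵀ +
      ∑ j ∈ Finset.range k, F ^ j * V * (F ^ j)ᵀ := by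
    intro k
    induction k with
    | zero => simp
    | succ k ih =>
      refine (h k).trans ?_
      rw [Finset.sum_range_succ', pow_succ']
      have h1 := add_le_add_left (conj_mono ih F) V
      refine h1.trans (le_of_eq ?_)
      simp only [Matrix.mul_add, Matrix.add_mul, Matrix.transpose_mul, Matrix.mul_sum,
        Matrix.sum_mul, pow_succ', pow_zero, Matrix.transpose_one, Matrix.one_mul, Matrix.mul_one,
        Matrix.mul_assoc, add_assoc]
  obtain ⟨c, hc0, hc⟩ := exists_trace_conj_le n
  have hs := summable_sq_norm_pow hF
  refine ⟨c * ‖W 0‖ * (∑' j, ‖F ^ j‖ ^ 2) + c * ‖V‖ * ∑' j, ‖F ^ j‖ ^ 2, fun k => ?_⟩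
  refine (trace_mono (hk k)).trans ?_
  rw [Matrix.trace_add, Matrix.trace_sum]
  refine add_le_add ((hc _ _).trans ?_) ((Finset.sum_le_sum fun j _ => hc _ _).trans ?_)
  · gcongr
    exact hs.le_tsum k fun _ _ => by positivity
  · rw [← Finset.mul_sum]
    gcongr
    exact hs.sum_le_tsum _ fun _ _ => by positivity

/-- Iterating gives `X ≤ F^k X (F^k)ᵀ`, and the right-hand side tends to zero in trace. -/
lemma eq_zero_of_le_conj {F : Mat n n} (hF : IsSchurStable F) {X : Mat n n} (hX : X.PosSemidef)
    (h : X ≤ F * X * Fᵀ) : X = 0 := by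
  have hk : ∀ k, X ≤ F ^ k * X * (F ^ k)ᵀ := by
    intro k
    induction k with
    | zero => simp
    | succ k ih =>
      refine h.trans ((conj_mono ih F).trans (le_of_eq ?_))
      rw [pow_succ', Matrix.transpose_mul]; simp only [Matrix.mul_assoc]
  obtain ⟨c, -, hc⟩ := exists_trace_conj_le n
  have h0 := (summable_sq_norm_pow hF).tendsto_atTop_zero.const_mul (c * ‖X‖)
  rw [mul_zero] at h0
  refine hX.trace_eq_zero_iff.1 (le_antisymm ?_ hX.trace_nonneg)
  exact ge_of_tendsto' h0 fun k => (trace_mono (hk k)).trans (hc _ _)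

end Schur

/-! ### The filter Riccati recursion -/

section Riccati

variable {n m : ℕ} {A : Mat n n} {C : Mat m n} {M : Mat m m} {S : Mat n n}

lemma prior_posSemidef {X : Mat n n} (hX : X.PosSemidef) (hS : S.PosSemidef) (A : Mat n n) :
    (A * X * Aᵀ + S).PosSemidef :=
  (PosSemidef.conj hX A).add hS

lemma riccati_mono (hM : M.PosDef) (hS : S.PosSemidef) {X Y : Mat n n} (hX : X.PosSemidef)
    (hY : Y.PosSemidef) (h : X ≤ Y) :
    filt C M (A * X * Aᵀ + S) ≤ filt C M (A * Y * Aᵀ + S) :=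
  filt_mono hM (prior_posSemidef hX hS A) (prior_posSemidef hY hS A)
    (add_le_add_left (conj_mono h A) S)

/-- Under detectability, the error covariances of the filter are bounded. -/
lemma bounded_trace_of_le_riccati (hM : M.PosDef) (hS : S.PosSemidef) (hdet : IsDetectable A C)
    {E : ℕ → Mat n n} (hE : ∀ k, (E k).PosSemidef)
    (h : ∀ k, E (k + 1) ≤ filt C M (A * E k * Aᵀ + S)) : ∃ c, ∀ k, (E k).trace ≤ c := by
  obtain ⟨L, hL⟩ := hdet
  -- The contraction is seen on the prior covariances `A E_k Aᵀ + S`, where the observer form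
  -- applies.
  obtain ⟨c, hc⟩ := bounded_trace_of_contraction hL (W := fun k => A * E k * Aᵀ + S)
    (V := L * M * Lᵀ + S) fun k => by
      have h1 := (conj_mono (h k) A).trans (conj_filt_le hM (prior_posSemidef (hE k) hS A) A L)
      have h2 := add_le_add_left h1 S
      rwa [add_assoc] at h2
  -- `E 0` is not the update of any prior, so it enters the bound separately.
  refine ⟨max c (E 0).trace, fun k => ?_⟩
  cases k with
  | zero => exact le_max_right _ _
  | succ k =>
    exact (trace_mono ((h k).trans (filt_le_self hM (prior_posSemidef (hE k) hS A)))).trans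
      ((hc k).trans (le_max_left _ _))

def riccatiIter (A : Mat n n) (C : Mat m n) (M : Mat m m) (S Y : Mat n n) : ℕ → Mat n n
  | 0 => Y
  | k + 1 => filt C M (A * riccatiIter A C M S Y k * Aᵀ + S)

lemma riccatiIter_posSemidef (hM : M.PosDef) (hS : S.PosSemidef) {Y : Mat n n}
    (hY : Y.PosSemidef) (k : ℕ) : (riccatiIter A C M S Y k).PosSemidef := by
  induction k with
  | zero => exact hY
  | succ k ih => exact filt_posSemidef hM (prior_posSemidef ih hS A)

lemma riccatiIter_monotone (hM : M.PosDef) (hS : S.PosSemidef) {Y : Mat n n}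
    (hY : Y.PosSemidef) (h : Y ≤ filt C M (A * Y * Aᵀ + S)) :
    Monotone (riccatiIter A C M S Y) := by
  refine monotone_nat_of_le_succ fun k => ?_
  induction k with
  | zero => exact h
  | succ k ih =>
    exact riccati_mono hM hS (riccatiIter_posSemidef hM hS hY _)
      (riccatiIter_posSemidef hM hS hY _) ih

/-- From a subsolution the recursion increases. If bounded, it converges, and continuity of the
update makes the limit a fixed point above the start. -/
lemma riccatiIter_tendsto (hM : M.PosDef) (hS : S.PosSemidef) {Y : Mat n n}
    (hY : Y.PosSemidef) (h : Y ≤ filt C M (A * Y * Aᵀ + S)) {c : ℝ}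
    (hc : ∀ k, (riccatiIter A C M S Y k).trace ≤ c) :
    ∃ X, Tendsto (riccatiIter A C M S Y) atTop (𝓝 X) ∧ Y ≤ X ∧ X.PosSemidef ∧
      X = filt C M (A * X * Aᵀ + S) := by
  have hmono := riccatiIter_monotone hM hS hY h
  obtain ⟨X, hX⟩ := exists_tendsto_of_monotone hmono hc
  have hYX : Y ≤ X :=
    le_of_tendsto_mat tendsto_const_nhds hX (Eventually.of_forall fun k => hmono (Nat.zero_le k))
  have hXp : X.PosSemidef := Matrix.nonneg_iff_posSemidef.1 (hY.nonneg.trans hYX)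
  refine ⟨X, hX, hYX, hXp, ?_⟩
  have hcont : Continuous fun X : Mat n n => A * X * Aᵀ + S :=
    ((continuous_const.matrix_mul continuous_id).matrix_mul continuous_const).add continuous_const
  exact tendsto_nhds_unique (hX.comp (tendsto_add_atTop_nat 1))
    (tendsto_filt hM (prior_posSemidef hXp hS A) ((hcont.tendsto X).comp hX))

/-- Under detectability, a subsolution of the filter Riccati equation lies below a solution. -/
lemma exists_riccati_fixedPoint (hM : M.PosDef) (hS : S.PosSemidef) (hdet : IsDetectable A C)
    {Y : Mat n n} (hY : Y.PosSemidef) (h : Y ≤ filt C M (A * Y * Aᵀ + S)) :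
    ∃ X, Y ≤ X ∧ X.PosSemidef ∧ X = filt C M (A * X * Aᵀ + S) := by
  obtain ⟨c, hc⟩ := bounded_trace_of_le_riccati hM hS hdet
    (E := riccatiIter A C M S Y) (fun k => riccatiIter_posSemidef hM hS hY k) fun k => le_rfl
  obtain ⟨X, -, h1, h2, h3⟩ := riccatiIter_tendsto hM hS hY h hc
  exact ⟨X, h1, h2, h3⟩

lemma re_vecMul_map {k : ℕ} (v : Fin n → ℂ) (F : Mat n k) (i : Fin k) :
    ((v ᵥ* F.map (algebraMap ℝ ℂ)) i).re = ((fun j => (v j).re) ᵥ* F) i := by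
  simp [Matrix.vecMul, dotProduct]

lemma im_vecMul_map {k : ℕ} (v : Fin n → ℂ) (F : Mat n k) (i : Fin k) :
    ((v ᵥ* F.map (algebraMap ℝ ℂ)) i).im = ((fun j => (v j).im) ᵥ* F) i := by
  simp [Matrix.vecMul, dotProduct]

lemma exists_left_eigenvector {F : Matrix (Fin n) (Fin n) ℂ} {z : ℂ} (h : z ∈ spectrum ℂ F) :
    ∃ v : Fin n → ℂ, v ≠ 0 ∧ v ᵥ* F = z • v := by
  rw [spectrum.mem_iff, Matrix.isUnit_iff_isUnit_det, isUnit_iff_ne_zero, not_not] at h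
  obtain ⟨v, hv, h⟩ := Matrix.exists_vecMul_eq_zero_iff.2 h
  refine ⟨v, hv, ?_⟩
  rw [Matrix.vecMul_sub, sub_eq_zero, Algebra.algebraMap_eq_smul_one, Matrix.vecMul_smul,
    Matrix.vecMul_one] at h
  exact h.symm

lemma mem_spectrum_of_left_eigenvector {F : Matrix (Fin n) (Fin n) ℂ} {z : ℂ} {v : Fin n → ℂ}
    (hv : v ≠ 0) (h : v ᵥ* F = z • v) : z ∈ spectrum ℂ F := by
  rw [spectrum.mem_iff, Matrix.isUnit_iff_isUnit_det, isUnit_iff_ne_zero, not_not]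
  refine Matrix.exists_vecMul_eq_zero_iff.1 ⟨v, hv, ?_⟩
  rw [Matrix.vecMul_sub, Algebra.algebraMap_eq_smul_one, Matrix.vecMul_smul, Matrix.vecMul_one, h,
    sub_self]

lemma dotProduct_conj {k : ℕ} (F : Mat n k) (X : Mat k k) (a : Fin n → ℝ) :
    a ⬝ᵥ (F * X * Fᵀ) *ᵥ a = (a ᵥ* F) ⬝ᵥ X *ᵥ (a ᵥ* F) := by
  rw [← Matrix.mulVec_mulVec, ← Matrix.mulVec_mulVec, Matrix.dotProduct_mulVec,
    Matrix.mulVec_transpose]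

/-- If the disturbance excites the unstable modes, the error dynamics of a stationary filter are
Schur stable. -/
lemma isSchurStable_of_fixedPoint (hM : M.PosDef) (hS : S.PosSemidef)
    (hstab : IsStabilizable A (CFC.sqrt S)) {Z : Mat n n} (hZ : Z.PosSemidef) {L : Mat n m}
    (h : Z = gainMap C M L (A * Z * Aᵀ + S)) : IsSchurStable ((1 - L * C) * A) := by
  obtain ⟨K, hK⟩ := hstab
  intro z hz
  by_contra hlt
  rw [not_lt] at hlt
  -- Argue by contradiction with a left eigenvector for `|z| ≥ 1`, split into real and imaginary
  -- parts because `Z`, `S`, `M` are real.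
  obtain ⟨v, hv, hvF⟩ := exists_left_eigenvector hz
  set F := (1 - L * C) * A with hF
  set a : Fin n → ℝ := fun j => (v j).re with ha
  set b : Fin n → ℝ := fun j => (v j).im with hb
  have haF : a ᵥ* F = z.re • a - z.im • b := by
    ext i; rw [ha, ← re_vecMul_map, hvF]; simp [hb]
  have hbF : b ᵥ* F = z.re • b + z.im • a := by
    ext i; rw [hb, ← im_vecMul_map, hvF]; simp [ha]
  have hq : ∀ x : Fin n → ℝ, x ⬝ᵥ Z *ᵥ x = (x ᵥ* F) ⬝ᵥ Z *ᵥ (x ᵥ* F) +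
      (x ᵥ* (1 - L * C)) ⬝ᵥ S *ᵥ (x ᵥ* (1 - L * C)) + (x ᵥ* L) ⬝ᵥ M *ᵥ (x ᵥ* L) := by
    intro x
    have hZ' : Z = F * Z * Fᵀ + (1 - L * C) * S * (1 - L * C)ᵀ + L * M * Lᵀ := by
      conv_lhs => rw [h]
      rw [gainMap, Matrix.mul_add, Matrix.add_mul, hF, Matrix.transpose_mul]
      simp only [Matrix.mul_assoc]
    conv_lhs => rw [hZ']
    rw [Matrix.add_mulVec, Matrix.add_mulVec, dotProduct_add, dotProduct_add, dotProduct_conj,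
      dotProduct_conj, dotProduct_conj]
  have hnorm : 1 ≤ z.re ^ 2 + z.im ^ 2 := by
    have := Complex.sq_norm z
    rw [Complex.normSq_apply] at this
    nlinarith
  -- Multiplication by `z` rotates and scales the pair `(a, b)`: the total `Z`-energy is multiplied
  -- by `|z|²`.
  have hsum : (a ᵥ* F) ⬝ᵥ Z *ᵥ (a ᵥ* F) + (b ᵥ* F) ⬝ᵥ Z *ᵥ (b ᵥ* F) =
      (z.re ^ 2 + z.im ^ 2) * (a ⬝ᵥ Z *ᵥ a + b ⬝ᵥ Z *ᵥ b) := by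
    rw [haF, hbF]
    simp only [Matrix.mulVec_add, Matrix.mulVec_sub, Matrix.mulVec_smul, add_dotProduct,
      sub_dotProduct, dotProduct_add, dotProduct_sub, smul_dotProduct, dotProduct_smul, smul_eq_mul]
    ring
  have hpos := fun x => dotProduct_nonneg hZ x
  have hposS := fun x => dotProduct_nonneg hS x
  have hposM := fun x => dotProduct_nonneg hM.posSemidef x
  have hab : 0 ≤ (z.re ^ 2 + z.im ^ 2 - 1) * (a ⬝ᵥ Z *ᵥ a + b ⬝ᵥ Z *ᵥ b) :=
    mul_nonneg (by linarith) (add_nonneg (hpos a) (hpos b))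
  -- Adding `hq` for `a` and `b`, `|z| ≥ 1` forces all noise terms to vanish. Then `xL = 0` since `M
  -- ≻ 0`, hence `x(1 - LC) = x` and `x S^{1/2} = 0`. So `v` is a left eigenvector of the stabilized
  -- matrix with the same eigenvalue, which is impossible.
  have key : ∀ x, x = a ∨ x = b → x ᵥ* F = x ᵥ* (A + CFC.sqrt S * K) := by
    intro x hx
    have h1 := hq a
    have h2 := hq b
    have hM0 : (x ᵥ* L) ⬝ᵥ M *ᵥ (x ᵥ* L) = 0 := by
      rcases hx with rfl | rfl <;>
      linarith [hposM (a ᵥ* L), hposM (b ᵥ* L), hposS (a ᵥ* (1 - L * C)),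
        hposS (b ᵥ* (1 - L * C))]
    have hS0 : (x ᵥ* (1 - L * C)) ⬝ᵥ S *ᵥ (x ᵥ* (1 - L * C)) = 0 := by
      rcases hx with rfl | rfl <;>
      linarith [hposM (a ᵥ* L), hposM (b ᵥ* L), hposS (a ᵥ* (1 - L * C)),
        hposS (b ᵥ* (1 - L * C))]
    have hL0 : x ᵥ* L = 0 := by
      by_contra hne
      have := hM.dotProduct_mulVec_pos hne
      simp only [star_trivial] at this
      linarith
    have hx1 : x ᵥ* (1 - L * C) = x := by
      rw [Matrix.vecMul_sub, Matrix.vecMul_one, ← Matrix.vecMul_vecMul, hL0, Matrix.zero_vecMul,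
        sub_zero]
    rw [hx1] at hS0
    have hsx : x ᵥ* CFC.sqrt S = 0 := by
      have hsT := PosSemidef.transpose_eq (sqrt_posSemidef S)
      have h3 := dotProduct_conj (CFC.sqrt S) 1 x
      rw [hsT, Matrix.mul_one, sqrt_mul_self hS, hS0, Matrix.one_mulVec] at h3
      exact dotProduct_self_eq_zero.1 h3.symm
    rw [hF, ← Matrix.vecMul_vecMul, hx1, Matrix.vecMul_add, ← Matrix.vecMul_vecMul _ _ K, hsx,
      Matrix.zero_vecMul, add_zero]
  refine absurd (hK z (mem_spectrum_of_left_eigenvector hv ?_)) (not_lt.2 hlt)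
  rw [← hvF]
  ext i
  refine Complex.ext ?_ ?_
  · rw [re_vecMul_map, re_vecMul_map]; exact (congrFun (key a (Or.inl rfl)) i).symm
  · rw [im_vecMul_map, im_vecMul_map]; exact (congrFun (key b (Or.inr rfl)) i).symm

/-- Apply the optimal gain of `Z` to both: it is exact for `Z` and suboptimal for `X`. Subtracting
gives `X - Z ≤ F (X - Z) Fᵀ` with `F` Schur stable. -/
lemma fixedPoint_unique_of_le (hM : M.PosDef) (hS : S.PosSemidef)
    (hstab : IsStabilizable A (CFC.sqrt S)) {Z X : Mat n n} (hZ : Z.PosSemidef)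
    (hX : X.PosSemidef) (hZX : Z ≤ X) (hZf : Z = filt C M (A * Z * Aᵀ + S))
    (hXf : X = filt C M (A * X * Aᵀ + S)) : X = Z := by
  have hg := hZf.trans (filt_eq_gainMap hM (prior_posSemidef hZ hS A))
  set L := optGain C M (A * Z * Aᵀ + S)
  have hF := isSchurStable_of_fixedPoint hM hS hstab hZ hg
  refine sub_eq_zero.1 (eq_zero_of_le_conj hF (Matrix.le_iff.1 hZX) ?_)
  have h1 : X ≤ gainMap C M L (A * X * Aᵀ + S) := by
    conv_lhs => rw [hXf]
    exact filt_le_gainMap hM (prior_posSemidef hX hS A) L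
  refine (sub_le_sub h1 hg.ge).trans (le_of_eq ?_)
  unfold gainMap
  generalize 1 - L * C = G
  simp only [Matrix.mul_add, Matrix.add_mul, Matrix.mul_sub, Matrix.sub_mul,
    Matrix.transpose_mul, Matrix.mul_assoc]
  abel

/-- Started from zero, the filter Riccati recursion converges to its stationary solution. -/
lemma riccatiIter_zero_tendsto (hM : M.PosDef) (hS : S.PosSemidef)
    (hstab : IsStabilizable A (CFC.sqrt S)) {X : Mat n n} (hX : X.PosSemidef)
    (hXf : X = filt C M (A * X * Aᵀ + S)) :
    Tendsto (riccatiIter A C M S 0) atTop (𝓝 X) := by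
  -- Zero is a subsolution and `X` bounds the iterates, so they increase to a fixed point below `X`,
  -- which must be `X`.
  have h0 : (0 : Mat n n) ≤ filt C M (A * 0 * Aᵀ + S) :=
    (filt_posSemidef hM (prior_posSemidef Matrix.PosSemidef.zero hS A)).nonneg
  have hle : ∀ k, riccatiIter A C M S 0 k ≤ X := by
    intro k
    induction k with
    | zero => exact hX.nonneg
    | succ k ih =>
      rw [hXf]
      exact riccati_mono hM hS (riccatiIter_posSemidef hM hS Matrix.PosSemidef.zero k) hX ih
  obtain ⟨Z, hlim, -, hZ, hZf⟩ := riccatiIter_tendsto hM hS Matrix.PosSemidef.zero h0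
    fun k => trace_mono (hle k)
  rwa [fixedPoint_unique_of_le hM hS hstab hZ hX
    (le_of_tendsto_mat hlim tendsto_const_nhds (Eventually.of_forall hle)) hZf hXf]

end Riccati

/-! ### The stationary covariance problem bounds Cesàro averages -/

section Average

/-- For a fixed gain the map is affine, so it commutes with averages. -/
lemma sum_gainMap {n m : ℕ} (C : Mat m n) (M : Mat m m) (L : Mat n m) (W : ℕ → Mat n n) {T : ℕ}
    (hT : 0 < T) :
    (T : ℝ)⁻¹ • ∑ t ∈ Finset.range T, gainMap C M L (W t) =
      gainMap C M L ((T : ℝ)⁻¹ • ∑ t ∈ Finset.range T, W t) := by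
  have hT' : (T : ℝ) ≠ 0 := by positivity
  simp only [gainMap, Finset.sum_add_distrib, Finset.sum_const, Finset.card_range, smul_add,
    Matrix.mul_smul, Matrix.smul_mul, Matrix.mul_sum, Matrix.sum_mul]
  rw [← Nat.cast_smul_eq_nsmul ℝ T, smul_smul, inv_mul_cancel₀ hT', one_smul]

variable {nx nu ny : ℕ} {D : Data nx nu ny}

lemma covObjective_eq (P X S : Mat nx nx) : D.covObjective P X S = (D.Sss P * X).trace +
    ((P - D.lam • (1 : Mat nx nx)) * S).trace +
    D.lam * (2 * (CFC.sqrt (CFC.sqrt D.SigmaHat * S * CFC.sqrt D.SigmaHat)).trace) := by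
  rw [Data.covObjective, Matrix.trace_add, Matrix.trace_add, Matrix.trace_smul, smul_eq_mul]
  ring

/-- Time averages of the covariances are nearly feasible for the stationary problem, up to a total
error independent of `T`. The hypothesis holds for every gain, so one gain, optimal for the averaged
prior, can be used at all times. `U` may depend on `T` but not on `t`. -/
lemma sum_covObjective_le (hM : D.M.PosDef) (hlam : 0 < D.lam) (hdet : IsDetectable D.A D.C)
    {P X Xm Sig : Mat nx nx} (hP : P.PosSemidef) (hS : (D.Sss P).PosSemidef)
    (hopt : D.IsCovOptimal P X Xm Sig) {E V : ℕ → Mat nx nx} (hE : ∀ t, (E t).PosSemidef)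
    (hV : ∀ t, (V t).PosSemidef)
    (h : ∀ t L, E (t + 1) ≤ gainMap D.C D.M L (D.A * E t * D.Aᵀ + V t)) {T : ℕ} (hT : 0 < T) :
    ∃ U : Mat nx nx, U.PosDef ∧
      ∑ t ∈ Finset.range T, ((D.Sss P * E t).trace +
        ((P - D.lam • (1 : Mat nx nx)) * V t).trace +
        D.lam * (U.trace + (U⁻¹ * (CFC.sqrt D.SigmaHat * V t * CFC.sqrt D.SigmaHat)).trace)) ≤
      T * D.covObjective P X Sig + ((D.Sss P * E 0).trace +
        D.lam * (D.A * E 0 * D.Aᵀ).trace + D.lam * nx) := by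
  have hT' : (0 : ℝ) < T := by exact_mod_cast hT
  set τ : ℝ := (T : ℝ)⁻¹ with hτ
  have hτ0 : 0 < τ := by positivity
  have hτT : (T : ℝ) * τ = 1 := mul_inv_cancel₀ hT'.ne'
  set Y := τ • ∑ t ∈ Finset.range T, E (t + 1) with hY
  -- The extra term absorbs the shift between the averages of `E t` and `E (t + 1)`.
  set W := τ • ∑ t ∈ Finset.range T, V t + τ • (D.A * E 0 * D.Aᵀ) with hW
  have hA0 : (D.A * E 0 * D.Aᵀ).PosSemidef := PosSemidef.conj (hE 0) _
  have hVs : (∑ t ∈ Finset.range T, V t).PosSemidef := Matrix.posSemidef_sum _ fun t _ => hV t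
  have hYp : Y.PosSemidef := (Matrix.posSemidef_sum _ fun t _ => hE (t + 1)).smul hτ0.le
  have hWp : W.PosSemidef := (hVs.smul hτ0.le).add (hA0.smul hτ0.le)
  have hsum : ∑ t ∈ Finset.range T, E t ≤ (T : ℝ) • Y + E 0 := by
    have h1 := Finset.sum_range_succ' E T
    rw [Finset.sum_range_succ] at h1
    have h2 : (T : ℝ) • Y = ∑ t ∈ Finset.range T, E (t + 1) := by
      rw [hY, smul_smul, hτT, one_smul]
    rw [h2, ← h1]
    exact le_add_of_nonneg_right (hE T).nonneg
  have hVW : (T : ℝ) • W = ∑ t ∈ Finset.range T, V t + D.A * E 0 * D.Aᵀ := by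
    rw [hW, smul_add, smul_smul, smul_smul, hτT, one_smul, one_smul]
  have hsub : Y ≤ filt D.C D.M (D.A * Y * D.Aᵀ + W) := by
    rw [filt_eq_gainMap hM (prior_posSemidef hYp hWp D.A)]
    set L := optGain D.C D.M (D.A * Y * D.Aᵀ + W)
    have h1 : Y ≤ τ • ∑ t ∈ Finset.range T, gainMap D.C D.M L (D.A * E t * D.Aᵀ + V t) := by
      rw [hY, Matrix.le_iff, ← smul_sub, ← Finset.sum_sub_distrib]
      exact (Matrix.posSemidef_sum _ fun t _ => Matrix.le_iff.1 (h t L)).smul hτ0.le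
    rw [sum_gainMap D.C D.M L _ hT] at h1
    refine h1.trans (gainMap_mono L ?_)
    have h2 : τ • ∑ t ∈ Finset.range T, E t ≤ Y + τ • E 0 := by
      have h3 := (Matrix.le_iff.1 hsum).smul hτ0.le
      rw [smul_sub, smul_add, smul_smul, mul_comm, hτT, one_smul] at h3
      exact Matrix.le_iff.2 h3
    have h4 := add_le_add_left (conj_mono h2 D.A) (τ • ∑ t ∈ Finset.range T, V t)
    rw [Finset.sum_add_distrib, smul_add, ← Matrix.sum_mul, ← Matrix.mul_sum, hW]
    refine le_trans (le_of_eq ?_) (h4.trans (le_of_eq ?_))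
    · simp only [Matrix.mul_smul, Matrix.smul_mul, hτ]
    · simp only [Matrix.mul_add, Matrix.add_mul, Matrix.mul_smul, Matrix.smul_mul]
      abel
  -- A stationary solution for the noise covariance `W` dominates the averaged error; it is
  -- feasible, and the objective increases with `X` because `S ⪰ 0`.
  obtain ⟨X', hYX, hXp, hXf⟩ := exists_riccati_fixedPoint hM hWp hdet hYp hsub
  have hz := hopt.2 X' (D.A * X' * D.Aᵀ + W) W
    ⟨hXp, prior_posSemidef hXp hWp D.A, hWp, rfl, hXf⟩
  rw [covObjective_eq] at hz
  set t := CFC.sqrt D.SigmaHat with ht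
  have htT : tᵀ = t := PosSemidef.transpose_eq (sqrt_posSemidef _)
  set s := CFC.sqrt (t * W * t) with hs
  have hsp : s.PosSemidef := sqrt_posSemidef _
  have hss : s * s = t * W * t := sqrt_mul_self (sqrt_conj_posSemidef hWp _)
  have hU := posDef_add_smul_one hsp hτ0
  -- With regularization `1/T`, the loss summed over the horizon is at most `λ · nx`.
  refine ⟨s + τ • (1 : Mat nx nx), hU, ?_⟩
  have hU1 := trace_add_inv_mul_sq_le hsp hτ0
  set U := s + τ • (1 : Mat nx nx)
  have h1 : ∑ k ∈ Finset.range T, (D.Sss P * E k).trace ≤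
      T * (D.Sss P * X').trace + (D.Sss P * E 0).trace := by
    rw [← Matrix.trace_sum, ← Matrix.mul_sum]
    refine (trace_mul_mono hS hsum).trans ?_
    rw [Matrix.mul_add, Matrix.mul_smul, Matrix.trace_add, Matrix.trace_smul, smul_eq_mul]
    have := mul_le_mul_of_nonneg_left (trace_mul_mono hS hYX) hT'.le
    linarith
  have hVs' : ∑ k ∈ Finset.range T, V k = (T : ℝ) • W - D.A * E 0 * D.Aᵀ := by
    rw [hVW, add_sub_cancel_right]
  have h2 : ∑ k ∈ Finset.range T, ((P - D.lam • (1 : Mat nx nx)) * V k).trace ≤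
      T * ((P - D.lam • (1 : Mat nx nx)) * W).trace + D.lam * (D.A * E 0 * D.Aᵀ).trace := by
    rw [← Matrix.trace_sum, ← Matrix.mul_sum, hVs', Matrix.mul_sub, Matrix.trace_sub,
      Matrix.mul_smul, Matrix.trace_smul, smul_eq_mul, Matrix.sub_mul _ _ (D.A * E 0 * D.Aᵀ),
      Matrix.trace_sub, Matrix.smul_mul, Matrix.one_mul, Matrix.trace_smul, smul_eq_mul]
    have := trace_mul_nonneg hP hA0
    linarith
  have h3 : ∑ k ∈ Finset.range T, (U⁻¹ * (t * V k * t)).trace ≤ T * (U⁻¹ * (s * s)).trace := by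
    have hT'' : (T : ℝ) * (U⁻¹ * (t * W * t)).trace =
        (U⁻¹ * (t * ((T : ℝ) • W) * t)).trace := by
      simp only [Matrix.mul_smul, Matrix.smul_mul, Matrix.trace_smul, smul_eq_mul]
    rw [← Matrix.trace_sum, ← Matrix.mul_sum, ← Matrix.sum_mul, ← Matrix.mul_sum, hss, hT'']
    refine trace_mul_mono hU.inv.posSemidef ?_
    have := conj_mono (show ∑ k ∈ Finset.range T, V k ≤ (T : ℝ) • W by
      rw [hVW]; exact le_add_of_nonneg_right hA0.nonneg) t
    rwa [htT] at this
  have h4 : ∑ _k ∈ Finset.range T, U.trace = T * U.trace := by simp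
  simp only [Finset.sum_add_distrib, ← Finset.mul_sum, h4]
  have h5 := mul_le_mul_of_nonneg_left hz hT'.le
  have h6 := mul_le_mul_of_nonneg_left (mul_le_mul_of_nonneg_left hU1 hlam.le) hT'.le
  have h7 := mul_le_mul_of_nonneg_left h3 hlam.le
  have h8 : (T : ℝ) * (D.lam * (2 * s.trace + τ * nx)) =
      T * (D.lam * (2 * s.trace)) + D.lam * nx * (T * τ) := by ring
  rw [h8, hτT] at h6
  linarith

end Average

/-! ### The action of matrices on Euclidean vectors -/

section Act

variable {l m n : ℕ}

lemma act_add (A : Mat m n) (x y : Vec n) : act A (x + y) = act A x + act A y := by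
  simp [act, Matrix.mulVec_add]

lemma act_sub (A : Mat m n) (x y : Vec n) : act A (x - y) = act A x - act A y := by
  simp [act, Matrix.mulVec_sub]

lemma act_smul (A : Mat m n) (c : ℝ) (x : Vec n) : act A (c • x) = c • act A x := by
  simp [act, Matrix.mulVec_smul]

lemma act_neg (A : Mat m n) (x : Vec n) : act A (-x) = -act A x := by
  simp [act, Matrix.mulVec_neg]

lemma add_act (A B : Mat m n) (x : Vec n) : act (A + B) x = act A x + act B x := by
  simp [act, Matrix.add_mulVec]

lemma sub_act (A B : Mat m n) (x : Vec n) : act (A - B) x = act A x - act B x := by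
  simp [act, Matrix.sub_mulVec]

lemma neg_act (A : Mat m n) (x : Vec n) : act (-A) x = -act A x := by
  simp [act, Matrix.neg_mulVec]

lemma smul_act (c : ℝ) (A : Mat m n) (x : Vec n) : act (c • A) x = c • act A x := by
  simp [act, Matrix.smul_mulVec]

lemma one_act (x : Vec n) : act (1 : Mat n n) x = x := by
  simp [act]

lemma mul_act (A : Mat l m) (B : Mat m n) (x : Vec n) : act (A * B) x = act A (act B x) := by
  simp [act, Matrix.mulVec_mulVec]

lemma inner_eq_dotProduct (x y : Vec n) : inner ℝ x y = x.ofLp ⬝ᵥ y.ofLp := by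
  rw [EuclideanSpace.inner_eq_star_dotProduct, dotProduct_comm]; simp

lemma inner_act (A : Mat m n) (x : Vec m) (y : Vec n) :
    inner ℝ x (act A y) = inner ℝ (act Aᵀ x) y := by
  simp only [inner_eq_dotProduct, act]
  rw [Matrix.dotProduct_mulVec, Matrix.mulVec_transpose]

lemma inner_transpose_act (A : Mat m n) (x : Vec n) (y : Vec m) :
    inner ℝ x (act Aᵀ y) = inner ℝ (act A x) y := by
  rw [inner_act, Matrix.transpose_transpose]

lemma quad_eq_dotProduct (Q : Mat n n) (x : Vec n) : quad Q x = x.ofLp ⬝ᵥ Q *ᵥ x.ofLp := by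
  simp [quad, inner_eq_dotProduct, act]

lemma quad_nonneg {Q : Mat n n} (h : Q.PosSemidef) (x : Vec n) : 0 ≤ quad Q x := by
  rw [quad_eq_dotProduct]; exact dotProduct_nonneg h _

lemma inner_act_comm {Q : Mat n n} (h : Qᵀ = Q) (x y : Vec n) :
    inner ℝ x (act Q y) = inner ℝ y (act Q x) := by
  rw [inner_act, h, real_inner_comm]

lemma quad_add {Q : Mat n n} (h : Qᵀ = Q) (x y : Vec n) :
    quad Q (x + y) = quad Q x + 2 * inner ℝ y (act Q x) + quad Q y := by
  simp only [quad, act_add, inner_add_left, inner_add_right]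
  rw [inner_act_comm h x y]; ring

/-- A positive definite quadratic form dominates the squared norm. -/
lemma exists_norm_sq_le_quad {P : Mat n n} (hP : P.PosDef) :
    ∃ c : ℝ, 0 < c ∧ ∀ x : Vec n, ‖x‖ ^ 2 ≤ c * quad P x := by
  -- The trace of `P⁻¹` bounds its largest eigenvalue; the `1` keeps the constant positive in
  -- dimension zero.
  refine ⟨(P⁻¹).trace + 1, by linarith [hP.inv.posSemidef.trace_nonneg], fun x => ?_⟩
  have hs : (CFC.sqrt P)ᵀ = CFC.sqrt P := PosSemidef.transpose_eq (sqrt_posSemidef P)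
  have hP' := PosSemidef.transpose_eq hP.posSemidef
  have hx := quad_nonneg hP.posSemidef x
  have htr : ∀ V : Mat n n, V.PosSemidef → ∀ y : Vec n, quad V y ≤ V.trace * ‖y‖ ^ 2 := by
    intro V hV y
    set r := CFC.sqrt V
    have hr : rᵀ = r := PosSemidef.transpose_eq (sqrt_posSemidef V)
    have h1 : quad V y = ‖act r y‖ ^ 2 := by
      rw [← real_inner_self_eq_norm_sq, inner_act, ← mul_act, hr, sqrt_mul_self hV,
        real_inner_comm]; rfl
    have h2 : V.trace = ∑ i, ∑ j, r i j ^ 2 := by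
      rw [← sqrt_mul_self hV, Matrix.trace]
      refine Finset.sum_congr rfl fun i _ => ?_
      rw [Matrix.diag_apply, Matrix.mul_apply]
      refine Finset.sum_congr rfl fun j _ => ?_
      have : r j i = r i j := congrFun (congrFun hr i) j
      change r i j * r j i = _
      rw [this, sq]
    rw [h1, h2, EuclideanSpace.real_norm_sq_eq, EuclideanSpace.real_norm_sq_eq, Finset.sum_mul]
    refine Finset.sum_le_sum fun i _ => ?_
    exact Finset.sum_mul_sq_le_sq_mul_sq Finset.univ (fun j => r i j) (fun j => y j)
  have h3 : ‖x‖ ^ 2 ≤ (P⁻¹).trace * quad P x := by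
    -- Cauchy–Schwarz between the forms of `P` and `P⁻¹`, read off from the discriminant of a
    -- nonnegative quadratic polynomial.
    have hle : ‖x‖ ^ 2 * ‖x‖ ^ 2 ≤ quad P x * quad P⁻¹ x := by
      have hcs : ∀ a : ℝ, 0 ≤ quad P x - 2 * a * ‖x‖ ^ 2 + a ^ 2 * quad P⁻¹ x := by
        intro a
        have := quad_nonneg hP.inv.posSemidef (act P x - a • x)
        have e1 : quad P⁻¹ (act P x - a • x) =
            quad P x - 2 * a * ‖x‖ ^ 2 + a ^ 2 * quad P⁻¹ x := by
          have e2 : act P⁻¹ (act P x) = x := by rw [← mul_act, PosDef.inv_mul hP, one_act]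
          have e3 : inner ℝ (act P x) (act P⁻¹ x) = ‖x‖ ^ 2 := by
            rw [real_inner_comm, ← real_inner_self_eq_norm_sq, inner_act, hP', ← mul_act,
              PosDef.mul_inv hP, one_act]
          simp only [quad, act_sub, act_smul, e2, inner_sub_left, inner_sub_right,
            real_inner_smul_left, real_inner_smul_right, real_inner_self_eq_norm_sq, e3]
          rw [real_inner_comm x (act P x)]; ring
        linarith
      have hcs' : ∀ a : ℝ, 0 ≤ quad P⁻¹ x * (a * a) + -2 * ‖x‖ ^ 2 * a + quad P x :=
        fun a => by linarith [hcs a]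
      have := discrim_le_zero hcs'
      rw [discrim] at this
      nlinarith
    have h4 := htr P⁻¹ hP.inv.posSemidef x
    rcases eq_or_lt_of_le (sq_nonneg ‖x‖) with h0 | h0
    · rw [← h0]; exact mul_nonneg hP.inv.posSemidef.trace_nonneg hx
    · refine le_of_mul_le_mul_right (hle.trans ?_) h0
      nlinarith [mul_le_mul_of_nonneg_left h4 hx]
  linarith

end Act

/-! ### The Riccati equation and the one-stage game -/

section Saddle

variable {nx nu ny : ℕ} {D : Data nx nu ny} {P : Mat nx nx}

/-- The closed-loop matrix `(I + Φ P)⁻¹ A` of the saddle point. -/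
def Data.Acl (D : Data nx nu ny) (P : Mat nx nx) : Mat nx nx := (1 + D.Phi * P)⁻¹ * D.A

/-- If `v + ΦPv = 0`, pairing with `Pv` gives `vᵀPv + (Pv)ᵀΦ(Pv) = 0`. Both terms are nonnegative,
so `ΦPv = 0` and then `v = 0`. -/
lemma isUnit_one_add_mul {Phi P : Mat nx nx} (hPhi : Phi.PosSemidef) (hP : P.PosSemidef) :
    IsUnit (1 + Phi * P).det := by
  rw [isUnit_iff_ne_zero]
  intro h0
  obtain ⟨v, hv, h⟩ := Matrix.exists_mulVec_eq_zero_iff.2 h0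
  rw [Matrix.add_mulVec, Matrix.one_mulVec, ← Matrix.mulVec_mulVec] at h
  have h1 : (P *ᵥ v) ⬝ᵥ (v + Phi *ᵥ (P *ᵥ v)) = 0 := by rw [h, dotProduct_zero]
  rw [dotProduct_add, dotProduct_comm] at h1
  have h2 := dotProduct_nonneg hP v
  have h3 := dotProduct_nonneg hPhi (P *ᵥ v)
  have h4 := mulVec_eq_zero_of_dotProduct hPhi (x := P *ᵥ v) (by linarith)
  rw [h4, add_zero] at h
  exact hv h

lemma isUnit_one_add_mul' {Phi P : Mat nx nx} (hPhi : Phi.PosSemidef) (hP : P.PosSemidef) :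
    IsUnit (1 + P * Phi).det := by
  rw [← Matrix.det_transpose, Matrix.transpose_add, Matrix.transpose_mul, Matrix.transpose_one,
    PosSemidef.transpose_eq hPhi, PosSemidef.transpose_eq hP]
  exact isUnit_one_add_mul hPhi hP

lemma Data.Acl_spec (hPhi : D.Phi.PosSemidef) (hP : P.PosSemidef) :
    (1 + D.Phi * P) * D.Acl P = D.A := by
  rw [Data.Acl, ← Matrix.mul_assoc, Matrix.mul_nonsing_inv _ (isUnit_one_add_mul hPhi hP),
    Matrix.one_mul]

/-- The push-through identity, from `P(1 + ΦP) = (1 + PΦ)P`. -/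
lemma inv_mul_eq_mul_inv (hPhi : D.Phi.PosSemidef) (hP : P.PosSemidef) :
    (1 + P * D.Phi)⁻¹ * P = P * (1 + D.Phi * P)⁻¹ := by
  have h1 := isUnit_one_add_mul hPhi hP
  have h2 := isUnit_one_add_mul' hPhi hP
  calc (1 + P * D.Phi)⁻¹ * P
      = (1 + P * D.Phi)⁻¹ * (P * (1 + D.Phi * P)) * (1 + D.Phi * P)⁻¹ := by
        rw [Matrix.mul_assoc, Matrix.mul_assoc P, Matrix.mul_nonsing_inv _ h1, Matrix.mul_one]
    _ = (1 + P * D.Phi)⁻¹ * ((1 + P * D.Phi) * P) * (1 + D.Phi * P)⁻¹ := by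
        congr 2; simp [Matrix.mul_add, Matrix.add_mul, Matrix.mul_assoc]
    _ = _ := by
        rw [← Matrix.mul_assoc, Matrix.nonsing_inv_mul _ h2, Matrix.one_mul]

/-- Substituting `A = (I + ΦP) Acl` removes the inverse and exhibits `P` as a sum of positive
semidefinite terms. -/
lemma riccati_closedLoop (hPhi : D.Phi.PosSemidef) (hP : D.IsRiccatiSolution P) :
    P = D.Q + (D.Acl P)ᵀ * (P + P * D.Phi * P) * D.Acl P := by
  have h1 := hP.2
  have h2 : D.Aᵀ * (1 + P * D.Phi)⁻¹ * P * D.A = D.Aᵀ * P * D.Acl P := by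
    rw [Matrix.mul_assoc D.Aᵀ, inv_mul_eq_mul_inv hPhi hP.1, Data.Acl]
    simp only [Matrix.mul_assoc]
  have h3 : D.Aᵀ * P = (D.Acl P)ᵀ * (P + P * D.Phi * P) := by
    conv_lhs => rw [← Data.Acl_spec hPhi hP.1]
    rw [Matrix.transpose_mul, Matrix.transpose_add, Matrix.transpose_mul, Matrix.transpose_one,
      PosSemidef.transpose_eq hPhi, PosSemidef.transpose_eq hP.1, Matrix.mul_assoc, Matrix.add_mul,
      Matrix.one_mul]
  rw [h2, h3] at h1
  exact h1

/-- In closed-loop form `S = Aclᵀ (PΦP + PΦPΦP) Acl`. -/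
lemma Sss_posSemidef (hPhi : D.Phi.PosSemidef) (hP : D.IsRiccatiSolution P) :
    (D.Sss P).PosSemidef := by
  have hP' := PosSemidef.transpose_eq hP.1
  have hF' := PosSemidef.transpose_eq hPhi
  have h1 := riccati_closedLoop hPhi hP
  have h2 : D.Sss P = (D.Acl P)ᵀ *
      (P * D.Phi * Pᵀ + (P * D.Phi) * P * (P * D.Phi)ᵀ) * D.Acl P := by
    have h3 : D.Aᵀ * P * D.A = (D.Acl P)ᵀ * ((1 + P * D.Phi) * P * (1 + D.Phi * P)) * D.Acl P := by
      conv_lhs => rw [← Data.Acl_spec hPhi hP.1]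
      rw [Matrix.transpose_mul, Matrix.transpose_add, Matrix.transpose_mul, Matrix.transpose_one,
        hF', hP']
      simp only [Matrix.mul_assoc]
    rw [Data.Sss, h3, eq_sub_of_add_eq h1.symm, Matrix.transpose_mul, hP', hF']
    simp only [Matrix.mul_add, Matrix.add_mul, Matrix.mul_one, Matrix.one_mul, Matrix.mul_assoc]
    abel
  rw [h2]
  exact PosSemidef.conj' ((PosSemidef.conj hPhi P).add (PosSemidef.conj hP.1 _)) _

lemma sqrt_mulVec_eq_zero {Q : Mat nx nx} (hQ : Q.PosSemidef) {v : Fin nx → ℝ}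
    (h : v ⬝ᵥ Q *ᵥ v = 0) : CFC.sqrt Q *ᵥ v = 0 := by
  have hs := PosSemidef.transpose_eq (sqrt_posSemidef Q)
  rw [← sqrt_mul_self hQ, ← Matrix.mulVec_mulVec, Matrix.dotProduct_mulVec,
    ← Matrix.mulVec_transpose, hs] at h
  exact dotProduct_self_eq_zero.1 h

lemma riccati_dotProduct (hPhi : D.Phi.PosSemidef) (hP : D.IsRiccatiSolution P)
    (v : Fin nx → ℝ) :
    v ⬝ᵥ P *ᵥ v = v ⬝ᵥ D.Q *ᵥ v + ((D.Acl P *ᵥ v) ⬝ᵥ P *ᵥ (D.Acl P *ᵥ v) +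
      (P *ᵥ (D.Acl P *ᵥ v)) ⬝ᵥ D.Phi *ᵥ (P *ᵥ (D.Acl P *ᵥ v))) := by
  have hP' := PosSemidef.transpose_eq hP.1
  conv_lhs => rw [riccati_closedLoop hPhi hP]
  simp only [Matrix.add_mulVec, ← Matrix.mulVec_mulVec, dotProduct_add, Matrix.mulVec_add]
  rw [Matrix.dotProduct_mulVec v (D.Acl P)ᵀ, Matrix.vecMul_transpose,
    Matrix.dotProduct_mulVec v (D.Acl P)ᵀ, Matrix.vecMul_transpose,
    Matrix.dotProduct_mulVec (D.Acl P *ᵥ v) P (D.Phi *ᵥ _), ← Matrix.mulVec_transpose P, hP']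

lemma Acl_mulVec (hPhi : D.Phi.PosSemidef) (hP : P.PosSemidef) (v : Fin nx → ℝ) :
    D.A *ᵥ v = D.Acl P *ᵥ v + D.Phi *ᵥ (P *ᵥ (D.Acl P *ᵥ v)) := by
  conv_lhs => rw [← Data.Acl_spec hPhi hP]
  simp only [← Matrix.mulVec_mulVec, Matrix.add_mulVec, Matrix.one_mulVec]

/-- Observability of the state cost makes the Riccati solution positive definite. -/
lemma riccati_posDef (hQ : D.Q.PosSemidef) (hPhi : D.Phi.PosSemidef)
    (hobs : IsObservable D.A (CFC.sqrt D.Q)) (hP : D.IsRiccatiSolution P) : P.PosDef := by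
  -- The kernel of `P` is invariant under `A` and contained in the kernel of `Q^{1/2}`, so
  -- observability makes it trivial.
  have step : ∀ v, P *ᵥ v = 0 → CFC.sqrt D.Q *ᵥ v = 0 ∧ P *ᵥ (D.A *ᵥ v) = 0 := by
    intro v hv
    have h := riccati_dotProduct hPhi hP v
    rw [hv, dotProduct_zero] at h
    have h1 := dotProduct_nonneg hQ v
    have h2 := dotProduct_nonneg hP.1 (D.Acl P *ᵥ v)
    have h3 := dotProduct_nonneg hPhi (P *ᵥ (D.Acl P *ᵥ v))
    refine ⟨sqrt_mulVec_eq_zero hQ (by linarith), ?_⟩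
    have h4 := mulVec_eq_zero_of_dotProduct hP.1 (x := D.Acl P *ᵥ v) (by linarith)
    rw [Acl_mulVec hPhi hP.1, h4, Matrix.mulVec_zero, add_zero, h4]
  refine Matrix.PosDef.of_dotProduct_mulVec_pos hP.1.isHermitian fun v hv => ?_
  rw [star_trivial]
  refine lt_of_le_of_ne (dotProduct_nonneg hP.1 v) fun h0 => hv ?_
  have hk : ∀ k : ℕ, P *ᵥ ((D.A ^ k) *ᵥ v) = 0 := by
    intro k
    induction k with
    | zero => simpa using mulVec_eq_zero_of_dotProduct hP.1 h0.symm
    | succ k ih => rw [pow_succ', ← Matrix.mulVec_mulVec]; exact (step _ ih).2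
  exact hobs v fun k => (step _ (hk k)).1

/-- A singular matrix would give `v = Acl v`. The Riccati form then yields `vᵀQv = 0` and `ΦPv = 0`,
so `Av = v` is an unobservable mode. This makes the formula for `r` meaningful. -/
lemma isUnit_one_sub (hQ : D.Q.PosSemidef) (hPhi : D.Phi.PosSemidef)
    (hobs : IsObservable D.A (CFC.sqrt D.Q)) (hP : D.IsRiccatiSolution P) :
    IsUnit (1 - D.Aᵀ * (1 + P * D.Phi)⁻¹).det := by
  rw [isUnit_iff_ne_zero, ← Matrix.det_transpose]
  intro h0
  obtain ⟨v, hv, h⟩ := Matrix.exists_mulVec_eq_zero_iff.2 h0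
  have he : (1 - D.Aᵀ * (1 + P * D.Phi)⁻¹)ᵀ = 1 - D.Acl P := by
    rw [Matrix.transpose_sub, Matrix.transpose_one, Matrix.transpose_mul,
      Matrix.transpose_transpose, Matrix.transpose_nonsing_inv, Matrix.transpose_add,
      Matrix.transpose_mul, Matrix.transpose_one, PosSemidef.transpose_eq hPhi,
      PosSemidef.transpose_eq hP.1, Data.Acl]
  rw [he, Matrix.sub_mulVec, Matrix.one_mulVec, sub_eq_zero] at h
  have h1 := riccati_dotProduct hPhi hP v
  rw [← h] at h1
  have h2 := dotProduct_nonneg hQ v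
  have h3 := dotProduct_nonneg hPhi (P *ᵥ v)
  have h4 := mulVec_eq_zero_of_dotProduct hPhi (x := P *ᵥ v) (by linarith)
  have h5 := Acl_mulVec hPhi hP.1 v
  rw [← h, h4, add_zero] at h5
  refine hv (hobs v fun k => ?_)
  have hk : (D.A ^ k) *ᵥ v = v := by
    induction k with
    | zero => simp
    | succ k ih => rw [pow_succ, ← Matrix.mulVec_mulVec, h5, ih]
  rw [hk]
  exact sqrt_mulVec_eq_zero hQ (by linarith)

lemma rss_spec (h : IsUnit (1 - D.Aᵀ * (1 + P * D.Phi)⁻¹).det) :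
    D.rss P = act (D.Aᵀ * (1 + P * D.Phi)⁻¹) (act P D.wHat + D.rss P) := by
  have h1 : act (1 - D.Aᵀ * (1 + P * D.Phi)⁻¹) (D.rss P) =
      act (D.Aᵀ * (1 + P * D.Phi)⁻¹) (act P D.wHat) := by
    rw [Data.rss, ← mul_act, ← mul_act, ← Matrix.mul_assoc, ← Matrix.mul_assoc, ← Matrix.mul_assoc,
      Matrix.mul_nonsing_inv _ h, Matrix.one_mul]
  rw [sub_act, one_act, sub_eq_iff_eq_add] at h1
  rw [act_add]
  exact h1

/-- The cost of one stage of the game plus the cost-to-go, as a function of the conditional mean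
`m` of the state, the control `u` and the mean `w` of the disturbance. -/
def stageFn (D : Data nx nu ny) (P : Mat nx nx) (m : Vec nx) (u : Vec nu) (w : Vec nx) : ℝ :=
  quad D.Q m + quad D.R u - D.lam * ‖w - D.wHat‖ ^ 2 +
    quad P (act D.A m + act D.B u + w) + 2 * inner ℝ (D.rss P) (act D.A m + act D.B u + w)

/-- The part of `ρ` that does not involve covariance matrices. -/
def meanValue (D : Data nx nu ny) (P : Mat nx nx) : ℝ :=
  inner ℝ ((2 : ℝ) • D.wHat - act D.Phi (D.rss P)) (act (1 + P * D.Phi)⁻¹ (D.rss P)) +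
    inner ℝ D.wHat (act ((1 + P * D.Phi)⁻¹ * P) D.wHat)

/-- The gradient of the cost-to-go at the saddle point. -/
def costate (D : Data nx nu ny) (P : Mat nx nx) (m : Vec nx) : Vec nx :=
  act (1 + P * D.Phi)⁻¹ (act P (act D.A m) + (act P D.wHat + D.rss P))

/-- The first-order condition `R u + Bᵀ q = 0` in the costate `q`. -/
lemma control_eq (m : Vec nx) :
    act (D.Kss P) m + D.Lss P = -act (D.R⁻¹ * D.Bᵀ) (costate D P m) := by
  rw [Data.Kss, Data.Lss, costate, act_add, neg_act]
  simp only [mul_act, act_add, neg_add]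

lemma act_Phi (x : Vec nx) :
    act D.Phi x = act D.B (act (D.R⁻¹ * D.Bᵀ) x) - (D.lam)⁻¹ • x := by
  rw [Data.Phi, sub_act, smul_act, one_act, Matrix.mul_assoc, mul_act]

lemma saddle_state (m : Vec nx) :
    act D.A m + act D.B (act (D.Kss P) m + D.Lss P) + (D.wHat + (D.lam)⁻¹ • costate D P m) =
      act D.A m + D.wHat - act D.Phi (costate D P m) := by
  rw [control_eq, act_neg, act_Phi]; abel

/-- This is `q = P x⁺ + r` at the mean successor state `x⁺` of `saddle_state`, that is, half the
gradient of the cost-to-go there. -/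
lemma costate_eq (hPhi : D.Phi.PosSemidef) (hP : P.PosSemidef) (m : Vec nx) :
    costate D P m = act P (act D.A m + D.wHat - act D.Phi (costate D P m)) + D.rss P := by
  have h1 : act (1 + P * D.Phi) (costate D P m) =
      act P (act D.A m) + (act P D.wHat + D.rss P) := by
    rw [costate, ← mul_act, Matrix.mul_nonsing_inv _ (isUnit_one_add_mul' hPhi hP), one_act]
  rw [add_act, one_act, mul_act] at h1
  refine (eq_sub_of_add_eq h1).trans ?_
  rw [act_sub, act_add]
  abel

/-- The first-order condition `λ(w - ŵ) = P x⁺ + r`, solved for `w` by inverting `λI - P`. -/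
lemma disturbance_mean_eq (hPhi : D.Phi.PosSemidef) (hP : P.PosSemidef) (hlam : 0 < D.lam)
    (hpen : (D.lam • (1 : Mat nx nx) - P).PosDef) (m : Vec nx) :
    act (D.Hss P) m + D.Gss P = D.wHat + (D.lam)⁻¹ • costate D P m := by
  set w := D.wHat + (D.lam)⁻¹ • costate D P m with hw
  have h1 := costate_eq hPhi hP m
  rw [← saddle_state, ← hw] at h1
  have h2 : act (D.lam • (1 : Mat nx nx) - P) w = act (P * (D.A + D.B * D.Kss P)) m +
      (act (P * D.B) (D.Lss P) + D.rss P + D.lam • D.wHat) := by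
    have h3 : D.lam • w = D.lam • D.wHat + costate D P m := by
      rw [hw, smul_add, smul_smul, mul_inv_cancel₀ hlam.ne', one_smul]
    rw [sub_act, smul_act, one_act, h3, h1]
    simp only [mul_act, add_act, act_add]
    abel
  have h4 : w = act (D.lam • (1 : Mat nx nx) - P)⁻¹ (act (D.lam • (1 : Mat nx nx) - P) w) := by
    rw [← mul_act, PosDef.inv_mul hpen, one_act]
  rw [h4, h2, act_add, Data.Hss, Data.Gss, Matrix.mul_assoc, mul_act]

/-- The Bellman equation of the mean game. Everything is expressed through the costate; terms
quadratic in `m` are matched by the Riccati equation, linear ones by the equation for `r`, and the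
rest is `meanValue`. -/
lemma stageFn_saddle (hPhi : D.Phi.PosSemidef) (hP : D.IsRiccatiSolution P) (hR : D.R.PosDef)
    (hlam : 0 < D.lam) (h1 : IsUnit (1 - D.Aᵀ * (1 + P * D.Phi)⁻¹).det) (m : Vec nx) :
    stageFn D P m (-act (D.R⁻¹ * D.Bᵀ) (costate D P m)) (D.wHat + (D.lam)⁻¹ • costate D P m) =
      quad P m + 2 * inner ℝ (D.rss P) m + meanValue D P := by
  have hx := saddle_state (D := D) (P := P) m
  have hq := costate_eq hPhi hP.1 m
  rw [control_eq] at hx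
  have hr := rss_spec h1
  have hF' := PosSemidef.transpose_eq hPhi
  have hP' := PosSemidef.transpose_eq hP.1
  have hU := isUnit_one_add_mul' hPhi hP.1
  have hU' := isUnit_one_add_mul hPhi hP.1
  rw [stageFn, hx, add_sub_cancel_left]
  set q := costate D P m with hqd
  set r := D.rss P with hrd
  set N := (1 + P * D.Phi)⁻¹ with hN
  have hNt : Nᵀ = (1 + D.Phi * P)⁻¹ := by
    rw [hN, Matrix.transpose_nonsing_inv, Matrix.transpose_add, Matrix.transpose_mul,
      Matrix.transpose_one, hF', hP']
  have hNP : N * P = P * Nᵀ := by rw [hNt]; exact inv_mul_eq_mul_inv hPhi hP.1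
  have hNs : (N * P)ᵀ = N * P := by
    rw [Matrix.transpose_mul, hP', hNP]
  set s := act D.A m + D.wHat with hs
  have hRu : quad D.R (-act (D.R⁻¹ * D.Bᵀ) q) - D.lam * ‖(D.lam)⁻¹ • q‖ ^ 2 =
      inner ℝ q (act D.Phi q) := by
    have e1 : act D.R (act (D.R⁻¹ * D.Bᵀ) q) = act D.Bᵀ q := by
      rw [← mul_act, ← Matrix.mul_assoc, PosDef.mul_inv hR, Matrix.one_mul]
    have e2 : inner ℝ q (act D.B (act (D.R⁻¹ * D.Bᵀ) q)) =
        inner ℝ (act (D.R⁻¹ * D.Bᵀ) q) (act D.Bᵀ q) := by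
      rw [inner_act, real_inner_comm]
    rw [quad, act_neg, inner_neg_neg, e1, act_Phi, inner_sub_right, e2, real_inner_smul_right,
      norm_smul, mul_pow, real_inner_self_eq_norm_sq, norm_inv, Real.norm_of_nonneg hlam.le]
    field_simp
  have hqN : q = act (N * P) s + act N r := by
    rw [hqd, costate, ← hN, ← hrd, act_add, act_add, hs, act_add, mul_act, mul_act]; abel
  have hPx : act P (s - act D.Phi q) = q - r := eq_sub_of_add_eq hq.symm
  have hQm : quad D.Q m + inner ℝ (act D.A m) (act (N * P) (act D.A m)) = quad P m := by
    conv_rhs => rw [hP.2]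
    rw [quad, quad, add_act, inner_add_right]
    congr 1
    have e : D.Aᵀ * (1 + P * D.Phi)⁻¹ * P * D.A = D.Aᵀ * ((N * P) * D.A) := by
      simp only [hN, Matrix.mul_assoc]
    rw [e, mul_act D.Aᵀ, inner_transpose_act, mul_act (N * P)]
  have hrm : inner ℝ (act D.A m) (act (N * P) D.wHat) + inner ℝ (act D.A m) (act N r) =
      inner ℝ r m := by
    conv_rhs => rw [hr, real_inner_comm, mul_act D.Aᵀ, inner_transpose_act, act_add,
      inner_add_right, ← mul_act]
  -- This is the identity `Nᵀ + Φ N P = I`, tested on `r` and `s`.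
  have hNr : inner ℝ s r - inner ℝ (act D.Phi r) (act (N * P) s) = inner ℝ s (act N r) := by
    have e1 : Nᵀ + D.Phi * (N * P) = 1 := by
      rw [hNP, hNt]
      calc (1 + D.Phi * P)⁻¹ + D.Phi * (P * (1 + D.Phi * P)⁻¹)
          = (1 + D.Phi * P) * (1 + D.Phi * P)⁻¹ := by
            rw [Matrix.add_mul, Matrix.one_mul, Matrix.mul_assoc]
        _ = 1 := Matrix.mul_nonsing_inv _ hU'
    have e2 : inner ℝ s (act N r) = inner ℝ r (act Nᵀ s) := by
      rw [inner_act, real_inner_comm]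
    have e3 : inner ℝ (act D.Phi r) (act (N * P) s) = inner ℝ r (act (D.Phi * (N * P)) s) := by
      rw [mul_act D.Phi, inner_act D.Phi, hF']
    rw [e2, e3, sub_eq_iff_eq_add, ← inner_add_right, ← add_act, e1, one_act, real_inner_comm]
  calc quad D.Q m + quad D.R (-act (D.R⁻¹ * D.Bᵀ) q) - D.lam * ‖(D.lam)⁻¹ • q‖ ^ 2 +
        quad P (s - act D.Phi q) + 2 * inner ℝ r (s - act D.Phi q)
      = quad D.Q m + inner ℝ q (act D.Phi q) + inner ℝ (s - act D.Phi q) (q - r) +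
          2 * inner ℝ r (s - act D.Phi q) := by
        have e : quad P (s - act D.Phi q) = inner ℝ (s - act D.Phi q) (q - r) := by
          rw [quad, hPx]
        rw [e, ← hRu]; ring
    _ = quad D.Q m + inner ℝ s q + inner ℝ s r - inner ℝ (act D.Phi r) q := by
        simp only [inner_sub_left, inner_sub_right]
        rw [real_inner_comm q (act D.Phi q), real_inner_comm s r, real_inner_comm r (act D.Phi q),
          inner_act D.Phi r q, hF']
        ring
    _ = quad D.Q m + inner ℝ s (act (N * P) s) + 2 * inner ℝ s (act N r) -
          inner ℝ (act D.Phi r) (act N r) := by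
        rw [hqN, inner_add_right, inner_add_right]
        linarith
    _ = quad P m + 2 * inner ℝ r m + meanValue D P := by
        have e1 : inner ℝ D.wHat (act (N * P) (act D.A m)) =
            inner ℝ (act D.A m) (act (N * P) D.wHat) := inner_act_comm hNs _ _
        rw [← hQm, ← hrm, meanValue, ← hN, ← hrd, hs]
        simp only [act_add, inner_add_left, inner_add_right, inner_sub_left,
          real_inner_smul_left, e1]
        ring

/-- Against the control of the saddle point, no disturbance mean is better for the adversary. -/
lemma stageFn_le (hPhi : D.Phi.PosSemidef) (hP : D.IsRiccatiSolution P) (hR : D.R.PosDef)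
    (hlam : 0 < D.lam) (hpen : (D.lam • (1 : Mat nx nx) - P).PosDef)
    (h1 : IsUnit (1 - D.Aᵀ * (1 + P * D.Phi)⁻¹).det) (m w : Vec nx) :
    stageFn D P m (act (D.Kss P) m + D.Lss P) w ≤
      quad P m + 2 * inner ℝ (D.rss P) m + meanValue D P := by
  rw [← stageFn_saddle hPhi hP hR hlam h1 m]
  have hx := saddle_state (D := D) (P := P) m
  have hq := costate_eq hPhi hP.1 m
  rw [← hx] at hq
  rw [control_eq] at hq ⊢
  set q := costate D P m
  set u := -act (D.R⁻¹ * D.Bᵀ) q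
  -- Perturb the optimal mean by `d`: the linear terms cancel by the costate equation, leaving
  -- `-dᵀ(λI - P)d ≤ 0`.
  obtain ⟨d, rfl⟩ : ∃ d, w = D.wHat + (D.lam)⁻¹ • q + d := ⟨w - (D.wHat + (D.lam)⁻¹ • q), by abel⟩
  have hd := quad_nonneg hpen.posSemidef d
  rw [quad, sub_act, smul_act, one_act, inner_sub_right, real_inner_smul_right,
    real_inner_self_eq_norm_sq] at hd
  rw [stageFn, stageFn, ← add_assoc]
  set x := act D.A m + act D.B u + (D.wHat + (D.lam)⁻¹ • q)
  rw [quad_add (PosSemidef.transpose_eq hP.1) x d, inner_add_right (D.rss P),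
    show D.wHat + (D.lam)⁻¹ • q + d - D.wHat = (D.lam)⁻¹ • q + d by abel,
    show D.wHat + (D.lam)⁻¹ • q - D.wHat = (D.lam)⁻¹ • q by abel, norm_add_sq_real,
    real_inner_smul_left]
  have h2 : inner ℝ d (act P x) + inner ℝ (D.rss P) d = inner ℝ q d := by
    conv_rhs => rw [hq, inner_add_left, real_inner_comm]
  have h3 : D.lam * ((D.lam)⁻¹ * inner ℝ q d) = inner ℝ q d := by
    rw [← mul_assoc, mul_inv_cancel₀ hlam.ne', one_mul]
  have h4 : quad P d = inner ℝ d (act P d) := rfl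
  nlinarith

/-- Against the disturbance mean of the saddle point, no control is better for the controller. -/
lemma le_stageFn (hPhi : D.Phi.PosSemidef) (hP : D.IsRiccatiSolution P) (hR : D.R.PosDef)
    (hlam : 0 < D.lam) (hpen : (D.lam • (1 : Mat nx nx) - P).PosDef)
    (h1 : IsUnit (1 - D.Aᵀ * (1 + P * D.Phi)⁻¹).det) (m : Vec nx) (u : Vec nu) :
    quad P m + 2 * inner ℝ (D.rss P) m + meanValue D P ≤
      stageFn D P m u (act (D.Hss P) m + D.Gss P) := by
  rw [← stageFn_saddle hPhi hP hR hlam h1 m, disturbance_mean_eq hPhi hP.1 hlam hpen]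
  have hx := saddle_state (D := D) (P := P) m
  have hq := costate_eq hPhi hP.1 m
  rw [← hx, control_eq] at hq
  set q := costate D P m
  set w := D.wHat + (D.lam)⁻¹ • q
  -- Perturb the optimal control by `d`: the linear terms cancel, leaving `dᵀRd + (Bd)ᵀP(Bd) ≥ 0`.
  obtain ⟨d, rfl⟩ : ∃ d, u = -act (D.R⁻¹ * D.Bᵀ) q + d := ⟨u + act (D.R⁻¹ * D.Bᵀ) q, by abel⟩
  rw [stageFn, stageFn, act_add, show act D.A m + (act D.B (-act (D.R⁻¹ * D.Bᵀ) q) + act D.B d) + w =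
    act D.A m + act D.B (-act (D.R⁻¹ * D.Bᵀ) q) + w + act D.B d by abel,
    quad_add (PosSemidef.transpose_eq hR.posSemidef)]
  set x := act D.A m + act D.B (-act (D.R⁻¹ * D.Bᵀ) q) + w
  rw [quad_add (PosSemidef.transpose_eq hP.1) x, inner_add_right (D.rss P) x]
  have e1 : act D.R (-act (D.R⁻¹ * D.Bᵀ) q) = -act D.Bᵀ q := by
    rw [act_neg, ← mul_act, ← Matrix.mul_assoc, PosDef.mul_inv hR, Matrix.one_mul]
  have h2 : inner ℝ (act D.B d) (act P x) + inner ℝ (D.rss P) (act D.B d) =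
      inner ℝ d (act D.Bᵀ q) := by
    rw [real_inner_comm (act D.B d) (D.rss P), ← inner_add_right, ← hq, real_inner_comm, inner_act,
      real_inner_comm]
  rw [e1, inner_neg_right]
  have h3 := quad_nonneg hR.posSemidef d
  have h4 := quad_nonneg hP.1 (act D.B d)
  linarith

end Saddle

/-! ### Matrices of second moments -/

section Moments

variable {Ω : Type*} [MeasurableSpace Ω] {μ : Measure Ω} {k l m n : ℕ}

/-- The matrix `E[f gᵀ]`. -/
def crossMom (μ : Measure Ω) (f : Ω → Vec m) (g : Ω → Vec n) : Mat m n :=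
  Matrix.of fun i j => ∫ ω, f ω i * g ω j ∂μ

def actCLM (A : Mat m n) : Vec n →L[ℝ] Vec m := LinearMap.toContinuousLinearMap
  { toFun := act A, map_add' := act_add A, map_smul' := act_smul A }

lemma MemLp.act {f : Ω → Vec n} (hf : MemLp f 2 μ) (A : Mat m n) :
    MemLp (fun ω => GelbrichControl.act A (f ω)) 2 μ :=
  (actCLM A).comp_memLp' hf

lemma MemLp.coord {f : Ω → Vec n} (hf : MemLp f 2 μ) (i : Fin n) : MemLp (fun ω => f ω i) 2 μ :=
  (EuclideanSpace.proj (𝕜 := ℝ) i).comp_memLp' hf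

lemma memLp_add {f g : Ω → Vec n} (hf : MemLp f 2 μ) (hg : MemLp g 2 μ) :
    MemLp (fun ω => f ω + g ω) 2 μ := hf.add hg

lemma memLp_sub {f g : Ω → Vec n} (hf : MemLp f 2 μ) (hg : MemLp g 2 μ) :
    MemLp (fun ω => f ω - g ω) 2 μ := hf.sub hg

lemma MemLp.integrable_coord_mul {f : Ω → Vec m} {g : Ω → Vec n} (hf : MemLp f 2 μ)
    (hg : MemLp g 2 μ) (i : Fin m) (j : Fin n) : Integrable (fun ω => f ω i * g ω j) μ :=
  MemLp.integrable_mul (MemLp.coord hf i) (MemLp.coord hg j)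

lemma MemLp.integrable_inner {f g : Ω → Vec n} (hf : MemLp f 2 μ) (hg : MemLp g 2 μ) :
    Integrable (fun ω => inner ℝ (f ω) (g ω)) μ := by
  simp only [inner_eq_dotProduct, dotProduct]
  exact integrable_finsetSum _ fun i _ => MemLp.integrable_coord_mul hf hg i i

lemma MemLp.integrable_quad {f : Ω → Vec n} (hf : MemLp f 2 μ) (Q : Mat n n) :
    Integrable (fun ω => quad Q (f ω)) μ :=
  MemLp.integrable_inner hf (MemLp.act hf Q)

lemma crossMom_transpose (f : Ω → Vec m) (g : Ω → Vec n) :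
    (crossMom μ f g)ᵀ = crossMom μ g f := by
  ext i j; simp [crossMom, mul_comm]

lemma crossMom_add_left {f f' : Ω → Vec m} {g : Ω → Vec n} (hf : MemLp f 2 μ)
    (hf' : MemLp f' 2 μ) (hg : MemLp g 2 μ) :
    crossMom μ (fun ω => f ω + f' ω) g = crossMom μ f g + crossMom μ f' g := by
  ext i j
  simp only [crossMom, Matrix.of_apply, Matrix.add_apply, PiLp.add_apply, add_mul]
  exact integral_add (MemLp.integrable_coord_mul hf hg i j) (MemLp.integrable_coord_mul hf' hg i j)

lemma crossMom_add_right {f : Ω → Vec m} {g g' : Ω → Vec n} (hf : MemLp f 2 μ)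
    (hg : MemLp g 2 μ) (hg' : MemLp g' 2 μ) :
    crossMom μ f (fun ω => g ω + g' ω) = crossMom μ f g + crossMom μ f g' := by
  rw [← crossMom_transpose, crossMom_add_left hg hg' hf, Matrix.transpose_add, crossMom_transpose,
    crossMom_transpose]

lemma crossMom_act_left {f : Ω → Vec m} {g : Ω → Vec n} (hf : MemLp f 2 μ) (hg : MemLp g 2 μ)
    (A : Mat k m) : crossMom μ (fun ω => act A (f ω)) g = A * crossMom μ f g := by
  ext i j
  simp only [crossMom, Matrix.of_apply, Matrix.mul_apply, act, Matrix.mulVec, dotProduct,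
    Finset.sum_mul, mul_assoc]
  rw [integral_finsetSum _ fun a _ => (MemLp.integrable_coord_mul hf hg a j).const_mul _]
  simp only [integral_const_mul]

lemma crossMom_act_right {f : Ω → Vec m} {g : Ω → Vec n} (hf : MemLp f 2 μ) (hg : MemLp g 2 μ)
    (A : Mat k n) : crossMom μ f (fun ω => act A (g ω)) = crossMom μ f g * Aᵀ := by
  rw [← crossMom_transpose, crossMom_act_left hg hf, Matrix.transpose_mul, crossMom_transpose]

lemma crossMom_comm_zero {f : Ω → Vec m} {g : Ω → Vec n} (h : crossMom μ f g = 0) :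
    crossMom μ g f = 0 := by
  rw [← crossMom_transpose, h, Matrix.transpose_zero]

lemma crossMom_add_self {f g : Ω → Vec n} (hf : MemLp f 2 μ) (hg : MemLp g 2 μ)
    (h : crossMom μ f g = 0) :
    crossMom μ (fun ω => f ω + g ω) (fun ω => f ω + g ω) = crossMom μ f f + crossMom μ g g := by
  rw [crossMom_add_left hf hg (memLp_add hf hg), crossMom_add_right hf hf hg, crossMom_add_right hg hf hg,
    h, crossMom_comm_zero h, add_zero, zero_add]

lemma crossMom_act_self {f : Ω → Vec m} (hf : MemLp f 2 μ) (A : Mat k m) :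
    crossMom μ (fun ω => act A (f ω)) (fun ω => act A (f ω)) = A * crossMom μ f f * Aᵀ := by
  rw [crossMom_act_left hf (MemLp.act hf A), crossMom_act_right hf hf, Matrix.mul_assoc]

lemma integral_inner_act {f : Ω → Vec m} {g : Ω → Vec n} (hf : MemLp f 2 μ) (hg : MemLp g 2 μ)
    (A : Mat m n) : ∫ ω, inner ℝ (f ω) (act A (g ω)) ∂μ = (A * crossMom μ g f).trace := by
  rw [← crossMom_act_left hg hf]
  simp only [inner_eq_dotProduct, dotProduct]
  rw [integral_finsetSum _ fun i _ => MemLp.integrable_coord_mul hf (MemLp.act hg A) i i]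
  simp [Matrix.trace, crossMom, mul_comm]

lemma integral_quad {f : Ω → Vec n} (hf : MemLp f 2 μ) (Q : Mat n n) :
    ∫ ω, quad Q (f ω) ∂μ = (Q * crossMom μ f f).trace :=
  integral_inner_act hf hf Q

lemma crossMom_self_posSemidef {f : Ω → Vec n} (hf : MemLp f 2 μ) :
    (crossMom μ f f).PosSemidef := by
  refine posSemidef_of_dotProduct (crossMom_transpose f f) fun x => ?_
  have h1 : x ⬝ᵥ crossMom μ f f *ᵥ x = ∫ ω, quad (Matrix.vecMulVec x x) (f ω) ∂μ := by
    rw [integral_quad hf, Matrix.vecMulVec_mul, Matrix.trace_vecMulVec,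
      ← Matrix.mulVec_transpose, crossMom_transpose]
  rw [h1]
  refine integral_nonneg fun ω => ?_
  rw [quad_eq_dotProduct, Matrix.vecMulVec_mulVec, dotProduct_comm]
  simp only [op_smul_eq_smul, smul_dotProduct, smul_eq_mul]
  rw [dotProduct_comm]
  exact mul_self_nonneg _

lemma crossMom_map {Ω' : Type*} [MeasurableSpace Ω'] {T : Ω → Ω'} (hT : Measurable T)
    {f : Ω' → Vec m} {g : Ω' → Vec n} (hf : Measurable f) (hg : Measurable g) :
    crossMom (μ.map T) f g = crossMom μ (f ∘ T) (g ∘ T) := by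
  ext i j
  simp only [crossMom, Matrix.of_apply, Function.comp_apply]
  exact integral_map hT.aemeasurable (by fun_prop)

end Moments

/-! ### Conditional means -/

section CondMean

variable {α : Type*} [MeasurableSpace α] {k n : ℕ}

lemma meanVec_apply {μ : Measure (Vec n)} (h : Integrable (fun x : Vec n => x) μ) (i : Fin n) :
    meanVec μ i = ∫ x, x i ∂μ :=
  ((EuclideanSpace.proj (𝕜 := ℝ) i).integral_comp_comm h).symm

lemma measurable_meanVec (κ : Kernel α (Vec n)) [IsSFiniteKernel κ] :
    Measurable fun a => meanVec (κ a) :=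
  (StronglyMeasurable.integral_kernel (κ := κ) (f := fun x : Vec n => x)
    stronglyMeasurable_id).measurable

/-- The residual has mean zero in almost every fibre, so it is orthogonal to functions of the base.
This serves both the conditional mean of the state and the disturbance. -/
lemma crossMom_compProd {μ : Measure α} [SFinite μ] {κ : Kernel α (Vec n)} [IsMarkovKernel κ]
    {f : α → Vec k} (hf : MemLp (fun p : α × Vec n => f p.1) 2 (μ ⊗ₘ κ))
    (hx : MemLp (fun p : α × Vec n => p.2) 2 (μ ⊗ₘ κ))
    (hm : MemLp (fun p : α × Vec n => meanVec (κ p.1)) 2 (μ ⊗ₘ κ)) [IsFiniteMeasure μ] :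
    crossMom (μ ⊗ₘ κ) (fun p => f p.1) (fun p => p.2 - meanVec (κ p.1)) = 0 := by
  ext i j
  have hint := MemLp.integrable_coord_mul hf (memLp_sub hx hm) i j
  simp only [crossMom, Matrix.of_apply, Matrix.zero_apply]
  rw [Measure.integral_compProd hint]
  have hxi := hx.integrable (by norm_num)
  have hae := ((Measure.integrable_compProd_iff hxi.aestronglyMeasurable).1 hxi).1
  refine integral_eq_zero_of_ae ?_
  filter_upwards [hae] with a ha
  have hai : Integrable (fun x : Vec n => x j) (κ a) :=
    (EuclideanSpace.proj (𝕜 := ℝ) j).integrable_comp ha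
  simp only [PiLp.sub_apply, Pi.zero_apply]
  rw [integral_const_mul, integral_sub hai (integrable_const _), integral_const,
    meanVec_apply ha]
  simp

lemma condMean_spec (ν : ProbabilityMeasure (α × Vec n))
    (hx : MemLp (fun p : α × Vec n => p.2) 2 (ν : Measure (α × Vec n)))
    (hm : MemLp (fun p : α × Vec n => condMean ν p.1) 2 (ν : Measure (α × Vec n)))
    {f : α → Vec k} (hf : MemLp (fun p : α × Vec n => f p.1) 2 (ν : Measure (α × Vec n))) :
    crossMom (ν : Measure (α × Vec n)) (fun p => f p.1) (fun p => p.2 - condMean ν p.1) = 0 := by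
  have h := (ν : Measure (α × Vec n)).disintegrate (ν : Measure (α × Vec n)).condKernel
  have h1 := crossMom_compProd (μ := (ν : Measure (α × Vec n)).fst)
    (κ := (ν : Measure (α × Vec n)).condKernel) (f := f)
  rw [h] at h1
  exact h1 hf hx hm

/-- The mean of the conditional covariance matrix. -/
def errCov (ν : ProbabilityMeasure (α × Vec n)) : Mat n n :=
  crossMom (ν : Measure (α × Vec n)) (fun p => p.2 - condMean ν p.1)
    (fun p => p.2 - condMean ν p.1)

variable {ν : ProbabilityMeasure (α × Vec n)}

lemma errCov_posSemidef (hx : MemLp (fun p : α × Vec n => p.2) 2 (ν : Measure (α × Vec n)))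
    (hm : MemLp (fun p : α × Vec n => condMean ν p.1) 2 (ν : Measure (α × Vec n))) :
    (errCov ν).PosSemidef :=
  crossMom_self_posSemidef (memLp_sub hx hm)

/-- Pythagoras: the conditional error is orthogonal to `condMean - g`. -/
lemma crossMom_sub_eq (hx : MemLp (fun p : α × Vec n => p.2) 2 (ν : Measure (α × Vec n)))
    (hm : MemLp (fun p : α × Vec n => condMean ν p.1) 2 (ν : Measure (α × Vec n)))
    {g : α → Vec n} (hg : MemLp (fun p : α × Vec n => g p.1) 2 (ν : Measure (α × Vec n))) :
    crossMom (ν : Measure (α × Vec n)) (fun p => p.2 - g p.1) (fun p => p.2 - g p.1) =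
      crossMom (ν : Measure (α × Vec n)) (fun p => condMean ν p.1 - g p.1)
        (fun p => condMean ν p.1 - g p.1) + errCov ν := by
  have h := crossMom_add_self (memLp_sub hm hg) (memLp_sub hx hm)
    (condMean_spec ν hx hm (f := fun a => condMean ν a - g a) (memLp_sub hm hg))
  simp only [sub_add_sub_cancel'] at h
  exact h

/-- The conditional mean is the best estimate. -/
lemma errCov_le (hx : MemLp (fun p : α × Vec n => p.2) 2 (ν : Measure (α × Vec n)))
    (hm : MemLp (fun p : α × Vec n => condMean ν p.1) 2 (ν : Measure (α × Vec n)))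
    {g : α → Vec n} (hg : MemLp (fun p : α × Vec n => g p.1) 2 (ν : Measure (α × Vec n))) :
    errCov ν ≤
      crossMom (ν : Measure (α × Vec n)) (fun p => p.2 - g p.1) (fun p => p.2 - g p.1) := by
  rw [crossMom_sub_eq hx hm hg]
  exact le_add_of_nonneg_left (crossMom_self_posSemidef (memLp_sub hm hg)).nonneg

lemma integral_quad_state (hx : MemLp (fun p : α × Vec n => p.2) 2 (ν : Measure (α × Vec n)))
    (hm : MemLp (fun p : α × Vec n => condMean ν p.1) 2 (ν : Measure (α × Vec n))) (Q : Mat n n) :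
    ∫ p, quad Q p.2 ∂(ν : Measure (α × Vec n)) =
      ∫ p, quad Q (condMean ν p.1) ∂(ν : Measure (α × Vec n)) + (Q * errCov ν).trace := by
  have h := crossMom_sub_eq hx hm (g := fun _ => 0) (memLp_const 0)
  simp only [sub_zero] at h
  rw [integral_quad hx, integral_quad hm, h, Matrix.mul_add, Matrix.trace_add]

lemma integral_inner_condMean
    (hx : MemLp (fun p : α × Vec n => p.2) 2 (ν : Measure (α × Vec n)))
    (hm : MemLp (fun p : α × Vec n => condMean ν p.1) 2 (ν : Measure (α × Vec n))) (r : Vec n) :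
    ∫ p, inner ℝ r (condMean ν p.1) ∂(ν : Measure (α × Vec n)) =
      ∫ p, inner ℝ r p.2 ∂(ν : Measure (α × Vec n)) := by
  have hr : MemLp (fun _ : α × Vec n => r) 2 (ν : Measure (α × Vec n)) := memLp_const r
  have h := integral_inner_act hr (memLp_sub hx hm) 1
  have h1 := crossMom_comm_zero (condMean_spec ν hx hm (f := fun _ => r) hr)
  simp only [one_act, Matrix.one_mul, inner_sub_right, h1, Matrix.trace_zero] at h
  rw [integral_sub (MemLp.integrable_inner hr hx) (MemLp.integrable_inner hr hm)] at h
  linarith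

end CondMean

/-! ### One step of the closed loop -/

section Transfer

variable {Ω Ω' : Type*} [MeasurableSpace Ω] [MeasurableSpace Ω'] {μ : Measure Ω} {ν : Measure Ω'}
  {m n : ℕ}

lemma crossMom_comp {T : Ω → Ω'} (hT : MeasurePreserving T μ ν) {f : Ω' → Vec m} {g : Ω' → Vec n}
    (hf : MemLp f 2 ν) (hg : MemLp g 2 ν) :
    crossMom μ (fun ω => f (T ω)) (fun ω => g (T ω)) = crossMom ν f g := by
  ext i j
  simp only [crossMom, Matrix.of_apply]
  rw [← hT.map_eq]
  symm
  refine integral_map (f := fun ω => f ω i * g ω j) hT.measurable.aemeasurable ?_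
  rw [hT.map_eq]
  exact (MemLp.integrable_coord_mul hf hg i j).aestronglyMeasurable

lemma measurePreserving_fst_compProd (μ : Measure Ω) [SFinite μ] (κ : Kernel Ω Ω')
    [IsMarkovKernel κ] : MeasurePreserving Prod.fst (μ ⊗ₘ κ) μ :=
  ⟨measurable_fst, Measure.fst_compProd μ κ⟩

lemma integral_gaussian_coord (M : Mat n n) (i : Fin n) :
    ∫ v, v i ∂(multivariateGaussian (0 : Vec n) M) = 0 := by
  rw [← meanVec_apply IsGaussian.integrable_id i, meanVec, integral_id_multivariateGaussian]
  rfl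

lemma memLp_gaussian (w : Vec n) (M : Mat n n) :
    MemLp (fun x : Vec n => x) 2 (multivariateGaussian w M) :=
  IsGaussian.memLp_two_id

lemma crossMom_gaussian {M : Mat n n} (hM : M.PosSemidef) :
    crossMom (multivariateGaussian (0 : Vec n) M) (fun x => x) (fun x => x) = M := by
  ext i j
  rw [← covariance_eval_multivariateGaussian (μ := (0 : Vec n)) hM i j, covariance]
  simp only [integral_gaussian_coord, sub_zero, crossMom, Matrix.of_apply]

/-- A centered noise is uncorrelated with everything independent of it. -/
lemma crossMom_prod_gaussian {μ : Measure Ω} [SFinite μ] (M : Mat n n) (f : Ω → Vec m) :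
    crossMom (μ.prod (multivariateGaussian (0 : Vec n) M)) (fun p => f p.1) (fun p => p.2) = 0 := by
  ext i j
  simp only [crossMom, Matrix.of_apply, Matrix.zero_apply]
  rw [integral_prod_mul (fun ω => f ω i) (fun v : Vec n => v j), integral_gaussian_coord, mul_zero]

end Transfer

/-! ### Second moments along one transition -/

section Step

variable {nx nu ny : ℕ} {D : Data nx nu ny} {π : ControlPolicy nx nu ny}
  {γ : DistPolicy nx nu ny} {t : ℕ} {ν : ProbabilityMeasure (Info ny nu t × Vec nx)}

/-- The mean of the disturbance given the information. -/
def distMean (γ : DistPolicy nx nu ny) {t : ℕ} (ν : ProbabilityMeasure (Info ny nu t × Vec nx))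
    (I : Info ny nu t) : Vec nx :=
  meanVec (γ.law t (I, condMean ν I))

lemma measurable_distMean (γ : DistPolicy nx nu ny) {t : ℕ}
    (ν : ProbabilityMeasure (Info ny nu t × Vec nx)) : Measurable (distMean γ ν) := by
  have := γ.markov t
  exact (measurable_meanVec (γ.law t)).comp (measurable_id.prodMk (measurable_condMean ν))

/-- The joint law of `((I_t, x_t), w_t)`. -/
def distLaw (γ : DistPolicy nx nu ny) {t : ℕ} (ν : ProbabilityMeasure (Info ny nu t × Vec nx)) :
    Measure ((Info ny nu t × Vec nx) × Vec nx) :=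
  (ν : Measure (Info ny nu t × Vec nx)) ⊗ₘ disturbance γ ν

instance (γ : DistPolicy nx nu ny) {t : ℕ} (ν : ProbabilityMeasure (Info ny nu t × Vec nx)) :
    IsProbabilityMeasure (distLaw γ ν) := by
  unfold distLaw; infer_instance

/-- The mean of the conditional covariance matrix of the disturbance. -/
def distCov (γ : DistPolicy nx nu ny) {t : ℕ} (ν : ProbabilityMeasure (Info ny nu t × Vec nx)) :
    Mat nx nx :=
  crossMom (distLaw γ ν) (fun p => p.2 - distMean γ ν p.1.1) (fun p => p.2 - distMean γ ν p.1.1)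

/-- The predicted mean of the next state. -/
def predMean (D : Data nx nu ny) (π : ControlPolicy nx nu ny) (γ : DistPolicy nx nu ny) {t : ℕ}
    (ν : ProbabilityMeasure (Info ny nu t × Vec nx)) (I : Info ny nu t) : Vec nx :=
  act D.A (condMean ν I) + act D.B (control π ν I) + distMean γ ν I

lemma measurable_predMean (D : Data nx nu ny) (π : ControlPolicy nx nu ny)
    (γ : DistPolicy nx nu ny) {t : ℕ} (ν : ProbabilityMeasure (Info ny nu t × Vec nx)) :
    Measurable (predMean D π γ ν) :=
  (((measurable_act _).comp (measurable_condMean ν)).add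
    ((measurable_act _).comp (measurable_control π ν))).add (measurable_distMean γ ν)

/-- All the random vectors of one step have finite second moments. -/
structure StepL2 (π : ControlPolicy nx nu ny) (γ : DistPolicy nx nu ny) {t : ℕ}
    (ν : ProbabilityMeasure (Info ny nu t × Vec nx)) : Prop where
  state : MemLp (fun p : Info ny nu t × Vec nx => p.2) 2 (ν : Measure (Info ny nu t × Vec nx))
  mean : MemLp (fun p : Info ny nu t × Vec nx => condMean ν p.1) 2
    (ν : Measure (Info ny nu t × Vec nx))
  ctrl : MemLp (fun p : Info ny nu t × Vec nx => control π ν p.1) 2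
    (ν : Measure (Info ny nu t × Vec nx))
  dist : MemLp (fun p : (Info ny nu t × Vec nx) × Vec nx => p.2) 2 (distLaw γ ν)
  distMean : MemLp (fun p : Info ny nu t × Vec nx => distMean γ ν p.1) 2
    (ν : Measure (Info ny nu t × Vec nx))

namespace StepL2

lemma pred (h : StepL2 π γ ν) (D : Data nx nu ny) :
    MemLp (fun p : Info ny nu t × Vec nx => predMean D π γ ν p.1) 2
      (ν : Measure (Info ny nu t × Vec nx)) :=
  memLp_add (memLp_add (MemLp.act h.mean _) (MemLp.act h.ctrl _)) h.distMean

lemma preserving_fst (γ : DistPolicy nx nu ny)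
    (ν : ProbabilityMeasure (Info ny nu t × Vec nx)) :
    MeasurePreserving Prod.fst (distLaw γ ν) (ν : Measure (Info ny nu t × Vec nx)) :=
  measurePreserving_fst_compProd _ _

lemma distNoise (h : StepL2 π γ ν) :
    MemLp (fun p : (Info ny nu t × Vec nx) × Vec nx => p.2 - GelbrichControl.distMean γ ν p.1.1) 2
      (distLaw γ ν) :=
  memLp_sub h.dist (h.distMean.comp_measurePreserving (preserving_fst γ ν))

lemma distCov_posSemidef (h : StepL2 π γ ν) : (distCov γ ν).PosSemidef :=
  crossMom_self_posSemidef h.distNoise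

/-- Given `(I, x)` the disturbance law depends on `I` only, so its centered part is orthogonal to
functions of the state as well. -/
lemma distNoise_orthogonal (h : StepL2 π γ ν) {k : ℕ} {f : Info ny nu t × Vec nx → Vec k}
    (hf : MemLp f 2 (ν : Measure (Info ny nu t × Vec nx))) :
    crossMom (distLaw γ ν) (fun p => f p.1)
      (fun p => p.2 - GelbrichControl.distMean γ ν p.1.1) = 0 :=
  crossMom_compProd (μ := (ν : Measure (Info ny nu t × Vec nx))) (κ := disturbance γ ν) (f := f)
    (hf.comp_measurePreserving (preserving_fst γ ν)) h.dist
    (h.distMean.comp_measurePreserving (preserving_fst γ ν))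

/-- The prediction error. -/
lemma predErr (h : StepL2 π γ ν) (A : Mat nx nx) :
    MemLp (fun p : (Info ny nu t × Vec nx) × Vec nx => act A (p.1.2 - condMean ν p.1.1) +
      (p.2 - GelbrichControl.distMean γ ν p.1.1)) 2 (distLaw γ ν) :=
  memLp_add ((MemLp.act (memLp_sub h.state h.mean) A).comp_measurePreserving (preserving_fst γ ν))
    h.distNoise

lemma crossMom_predErr (h : StepL2 π γ ν) (A : Mat nx nx) :
    crossMom (distLaw γ ν)
      (fun p => act A (p.1.2 - condMean ν p.1.1) + (p.2 - GelbrichControl.distMean γ ν p.1.1))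
      (fun p => act A (p.1.2 - condMean ν p.1.1) + (p.2 - GelbrichControl.distMean γ ν p.1.1)) =
      A * errCov ν * Aᵀ + distCov γ ν := by
  have he := memLp_sub h.state h.mean
  have h1 := crossMom_add_self
    ((MemLp.act he A).comp_measurePreserving (preserving_fst γ ν)) h.distNoise
    (h.distNoise_orthogonal (MemLp.act he A))
  refine h1.trans ?_
  rw [distCov, errCov, ← crossMom_act_self he A]
  congr 1
  exact crossMom_comp (preserving_fst γ ν) (MemLp.act he A) (MemLp.act he A)

lemma predErr_orthogonal (h : StepL2 π γ ν) (A : Mat nx nx) {k : ℕ} {f : Info ny nu t → Vec k}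
    (hf : MemLp (fun p : Info ny nu t × Vec nx => f p.1) 2
      (ν : Measure (Info ny nu t × Vec nx))) :
    crossMom (distLaw γ ν) (fun p => f p.1.1)
      (fun p => act A (p.1.2 - condMean ν p.1.1) +
        (p.2 - GelbrichControl.distMean γ ν p.1.1)) = 0 := by
  have he := memLp_sub h.state h.mean
  have hf' := hf.comp_measurePreserving (preserving_fst γ ν)
  have h1 := crossMom_add_right hf'
    ((MemLp.act he A).comp_measurePreserving (preserving_fst γ ν)) h.distNoise
  refine h1.trans ?_
  have h2 := h.distNoise_orthogonal hf
  have h3 : crossMom (distLaw γ ν) (fun p => f p.1.1)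
      (fun p => act A (p.1.2 - condMean ν p.1.1)) = 0 := by
    rw [crossMom_comp (f := fun p : Info ny nu t × Vec nx => f p.1)
      (g := fun p : Info ny nu t × Vec nx => act A (p.2 - condMean ν p.1))
      (preserving_fst γ ν) hf (MemLp.act he A), crossMom_act_right hf he,
      condMean_spec ν h.state h.mean hf, Matrix.zero_mul]
  exact (congrArg₂ (· + ·) h3 h2).trans (add_zero _)

/-- The next state is the predicted mean plus the prediction error. -/
lemma next_state_eq (D : Data nx nu ny) (π : ControlPolicy nx nu ny) (γ : DistPolicy nx nu ny)
    (ν : ProbabilityMeasure (Info ny nu t × Vec nx))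
    (p : (Info ny nu t × Vec nx) × Vec nx) :
    act D.A p.1.2 + act D.B (control π ν p.1.1) + p.2 = predMean D π γ ν p.1.1 +
      (act D.A (p.1.2 - condMean ν p.1.1) + (p.2 - GelbrichControl.distMean γ ν p.1.1)) := by
  rw [predMean, act_sub]; abel

lemma map_step (D : Data nx nu ny) (π : ControlPolicy nx nu ny) (γ : DistPolicy nx nu ny)
    (ν : ProbabilityMeasure (Info ny nu t × Vec nx)) :
    MeasurePreserving (step D π ν) ((distLaw γ ν).prod (multivariateGaussian 0 D.M))
      (nextLaw D π γ ν : Measure (Info ny nu (t + 1) × Vec nx)) :=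
  ⟨measurable_step D π ν, rfl⟩

lemma next_state (h : StepL2 π γ ν) (D : Data nx nu ny) :
    MemLp (fun p : Info ny nu (t + 1) × Vec nx => p.2) 2
      (nextLaw D π γ ν : Measure (Info ny nu (t + 1) × Vec nx)) := by
  have hm := map_step D π γ ν
  rw [← hm.map_eq, memLp_map_measure_iff measurable_snd.aestronglyMeasurable
    hm.measurable.aemeasurable]
  have h1 : MemLp (fun p : (Info ny nu t × Vec nx) × Vec nx =>
      act D.A p.1.2 + act D.B (control π ν p.1.1) + p.2) 2 (distLaw γ ν) := by
    have h2 := ((memLp_add (MemLp.act h.state D.A) (MemLp.act h.ctrl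
      D.B)).comp_measurePreserving (preserving_fst γ ν))
    exact memLp_add h2 h.dist
  exact h1.comp_fst _

lemma integral_next_quad (h : StepL2 π γ ν) (D : Data nx nu ny) (P : Mat nx nx) :
    ∫ p, quad P p.2 ∂(nextLaw D π γ ν : Measure (Info ny nu (t + 1) × Vec nx)) =
      ∫ p, quad P (predMean D π γ ν p.1) ∂(ν : Measure (Info ny nu t × Vec nx)) +
        (P * (D.A * errCov ν * D.Aᵀ + distCov γ ν)).trace := by
  have hm := map_step D π γ ν
  have h1 := h.pred D
  have h1' := h1.comp_measurePreserving (preserving_fst γ ν)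
  have h2 := h.predErr D.A
  have h3 := crossMom_add_self h1' h2 (h.predErr_orthogonal D.A h1)
  have h4 : crossMom (nextLaw D π γ ν : Measure (Info ny nu (t + 1) × Vec nx)) (fun p => p.2)
      (fun p => p.2) = crossMom (distLaw γ ν)
        (fun p => act D.A p.1.2 + act D.B (control π ν p.1.1) + p.2)
        (fun p => act D.A p.1.2 + act D.B (control π ν p.1.1) + p.2) := by
    rw [← crossMom_comp hm (h.next_state D) (h.next_state D)]
    have h5 := memLp_add h1' h2
    exact crossMom_comp (μ := (distLaw γ ν).prod (multivariateGaussian 0 D.M))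
      measurePreserving_fst
      (f := fun p => act D.A p.1.2 + act D.B (control π ν p.1.1) + p.2)
      (g := fun p => act D.A p.1.2 + act D.B (control π ν p.1.1) + p.2)
      (by simp only [next_state_eq D π γ ν]; exact h5) (by simp only [next_state_eq D π γ ν]; exact h5)
  rw [integral_quad (h.next_state D), integral_quad h1, h4, ← Matrix.trace_add, ← Matrix.mul_add]
  simp only [next_state_eq D π γ ν]
  rw [← h.crossMom_predErr D.A, ← crossMom_comp (preserving_fst γ ν) h1 h1]
  exact congrArg (fun Z => (P * Z).trace) h3

lemma integral_next_inner (h : StepL2 π γ ν) (D : Data nx nu ny) (r : Vec nx) :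
    ∫ p, inner ℝ r p.2 ∂(nextLaw D π γ ν : Measure (Info ny nu (t + 1) × Vec nx)) =
      ∫ p, inner ℝ r (predMean D π γ ν p.1) ∂(ν : Measure (Info ny nu t × Vec nx)) := by
  have hm := map_step D π γ ν
  have h1 := h.pred D
  have h1' := h1.comp_measurePreserving (preserving_fst γ ν)
  have h2 := h.predErr D.A
  have hr : MemLp (fun _ : (Info ny nu t × Vec nx) × Vec nx => r) 2 (distLaw γ ν) := memLp_const r
  have h3 := integral_inner_act hr h2 1
  rw [crossMom_comm_zero (h.predErr_orthogonal D.A (f := fun _ => r) (memLp_const r))] at h3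
  simp only [one_act, Matrix.mul_zero, Matrix.trace_zero] at h3
  have hmeas : Measurable fun p : Info ny nu (t + 1) × Vec nx => (inner ℝ r p.2 : ℝ) := by fun_prop
  rw [← hm.map_eq, integral_map hm.measurable.aemeasurable hmeas.aestronglyMeasurable]
  have h4 : ∫ p, inner ℝ r (step D π ν p).2 ∂(distLaw γ ν).prod (multivariateGaussian 0 D.M) =
      ∫ p, inner ℝ r (act D.A p.1.2 + act D.B (control π ν p.1.1) + p.2) ∂(distLaw γ ν) := by
    have := integral_fun_fst (μ := distLaw γ ν) (ν := multivariateGaussian (0 : Vec ny) D.M)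
      (fun p => inner ℝ r (act D.A p.1.2 + act D.B (control π ν p.1.1) + p.2) )
    rw [probReal_univ, one_smul] at this
    exact this
  rw [h4]
  simp only [next_state_eq D π γ ν, inner_add_right r (predMean _ _ _ _ _)]
  have h5 := integral_add (MemLp.integrable_inner hr h1') (MemLp.integrable_inner hr h2)
  refine h5.trans ?_
  rw [h3, add_zero]
  have hp := preserving_fst γ ν
  rw [← hp.map_eq, integral_map hp.measurable.aemeasurable]
  · rfl
  · have := (measurable_predMean D π γ ν).comp
      (measurable_fst : Measurable (Prod.fst : Info ny nu t × Vec nx → _))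
    exact (Measurable.inner measurable_const this).aestronglyMeasurable

/-- The error of a linear estimate with gain `L` bounds the next conditional covariance. -/
lemma errCov_next_le (h : StepL2 π γ ν) (hM : D.M.PosSemidef)
    (hmean : MemLp (fun p : Info ny nu (t + 1) × Vec nx => condMean (nextLaw D π γ ν) p.1) 2
      (nextLaw D π γ ν : Measure (Info ny nu (t + 1) × Vec nx))) (L : Mat nx ny) :
    errCov (nextLaw D π γ ν) ≤
      gainMap D.C D.M L (D.A * errCov ν * D.Aᵀ + distCov γ ν) := by
  have hm := map_step D π γ ν
  set ρ : Measure (Vec ny) := multivariateGaussian 0 D.M with hρ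
  -- The linear estimate: recover `I_t` by dropping the last entries of `I_{t+1}`, then correct the
  -- predicted mean by `L` times the innovation.
  set g : Info ny nu (t + 1) → Vec nx := fun I =>
    predMean D π γ ν (Fin.init I.1, Fin.init I.2) + act L (I.1 (Fin.last _) -
      act D.C (predMean D π γ ν (Fin.init I.1, Fin.init I.2))) with hg
  have hinit : Measurable fun I : Info ny nu (t + 1) =>
      ((Fin.init I.1, Fin.init I.2) : Info ny nu t) :=
    (measurable_pi_iff.2 fun i => (measurable_pi_apply _).comp measurable_fst).prodMk
      (measurable_pi_iff.2 fun i => (measurable_pi_apply _).comp measurable_snd)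
  have hz := (measurable_predMean D π γ ν).comp hinit
  have hlast : Measurable fun I : Info ny nu (t + 1) => I.1 (Fin.last _) :=
    (measurable_pi_apply _).comp measurable_fst
  have hgm : Measurable g :=
    hz.add ((measurable_act L).comp (hlast.sub ((measurable_act D.C).comp hz)))
  set e : (Info ny nu t × Vec nx) × Vec nx → Vec nx := fun p =>
    act D.A (p.1.2 - condMean ν p.1.1) + (p.2 - GelbrichControl.distMean γ ν p.1.1) with he
  have heL : MemLp e 2 (distLaw γ ν) := h.predErr D.A
  have hstep : ∀ p, (step D π ν p).2 - g (step D π ν p).1 =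
      act (1 - L * D.C) (e p.1) + act (-L) p.2 := by
    intro p
    have h1 : (step D π ν p).2 = predMean D π γ ν p.1.1.1 + e p.1 :=
      next_state_eq D π γ ν p.1
    have h2 : g (step D π ν p).1 = predMean D π γ ν p.1.1.1 + act L
        (act D.C (step D π ν p).2 + p.2 - act D.C (predMean D π γ ν p.1.1.1)) := by
      simp only [hg, step, Info.extend, Fin.init_snoc, Fin.snoc_last]
    rw [h2, h1, act_add D.C, sub_act, one_act, mul_act, neg_act,
      show act D.C (predMean D π γ ν p.1.1.1) + act D.C (e p.1) + p.2 -
        act D.C (predMean D π γ ν p.1.1.1) = act D.C (e p.1) + p.2 by abel, act_add]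
    abel
  have hf1 : MemLp (fun p : ((Info ny nu t × Vec nx) × Vec nx) × Vec ny => e p.1) 2
      ((distLaw γ ν).prod ρ) := heL.comp_fst _
  have hf2 : MemLp (fun p : ((Info ny nu t × Vec nx) × Vec nx) × Vec ny => p.2) 2
      ((distLaw γ ν).prod ρ) := (memLp_gaussian 0 D.M).comp_snd _
  have hsum := memLp_add (MemLp.act hf1 (1 - L * D.C)) (MemLp.act hf2 (-L))
  have hd : MemLp (fun p : Info ny nu (t + 1) × Vec nx => p.2 - g p.1) 2
      (nextLaw D π γ ν : Measure (Info ny nu (t + 1) × Vec nx)) := by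
    have hmeas : Measurable fun p : Info ny nu (t + 1) × Vec nx => p.2 - g p.1 :=
      measurable_snd.sub (hgm.comp measurable_fst)
    rw [← hm.map_eq, memLp_map_measure_iff hmeas.aestronglyMeasurable hm.measurable.aemeasurable]
    exact (memLp_congr_ae (Eventually.of_forall hstep)).2 hsum
  -- Square integrability of the estimate follows from that of the state and of the error.
  have hgL : MemLp (fun p : Info ny nu (t + 1) × Vec nx => g p.1) 2
      (nextLaw D π γ ν : Measure (Info ny nu (t + 1) × Vec nx)) := by
    have := memLp_sub (h.next_state D) hd
    simpa only [sub_sub_cancel] using this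
  refine (errCov_le (h.next_state D) hmean hgL).trans (le_of_eq ?_)
  rw [← crossMom_comp hm hd hd]
  simp only [hstep]
  have horth : crossMom ((distLaw γ ν).prod ρ) (fun p => act (1 - L * D.C) (e p.1))
      (fun p => act (-L) p.2) = 0 := by
    rw [crossMom_act_left hf1 (MemLp.act hf2 _), crossMom_act_right hf1 hf2,
      crossMom_prod_gaussian D.M e, Matrix.zero_mul, Matrix.mul_zero]
  rw [crossMom_add_self (MemLp.act hf1 _) (MemLp.act hf2 _) horth, crossMom_act_self hf1,
    crossMom_act_self hf2, crossMom_comp measurePreserving_fst heL heL,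
    crossMom_comp measurePreserving_snd (memLp_gaussian 0 D.M) (memLp_gaussian 0 D.M),
    crossMom_gaussian hM, he, h.crossMom_predErr D.A, gainMap, Matrix.neg_mul, Matrix.transpose_neg,
    Matrix.mul_neg, Matrix.neg_mul, neg_neg]

end StepL2

end Step

/-! ### Linear images of independent Gaussian vectors -/

section Gaussian

variable {k l m n : ℕ}

lemma integral_inner_mul_inner {Ω : Type*} [MeasurableSpace Ω] {μ : Measure Ω} {f : Ω → Vec m}
    {g : Ω → Vec n} (hf : MemLp f 2 μ) (hg : MemLp g 2 μ) (x : Vec m) (y : Vec n) :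
    ∫ ω, inner ℝ x (f ω) * inner ℝ y (g ω) ∂μ = x.ofLp ⬝ᵥ crossMom μ f g *ᵥ y.ofLp := by
  have h := integral_inner_act hf hg (Matrix.vecMulVec x.ofLp y.ofLp)
  rw [Matrix.vecMulVec_mul, Matrix.trace_vecMulVec, ← Matrix.mulVec_transpose,
    crossMom_transpose] at h
  rw [← h]
  congr 1
  ext ω
  simp only [inner_eq_dotProduct, act, Matrix.vecMulVec_mulVec, op_smul_eq_smul, dotProduct_smul,
    smul_eq_mul]
  rw [dotProduct_comm (f ω).ofLp, mul_comm]

lemma isGaussian_prod (μ : Measure (Vec m)) (ν : Measure (Vec n)) [IsGaussian μ] [IsGaussian ν] :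
    IsGaussian (μ.prod ν) := by
  have h1 : HasGaussianLaw (Prod.fst : Vec m × Vec n → Vec m) (μ.prod ν) :=
    ⟨by rw [measurePreserving_fst.map_eq]; infer_instance⟩
  have h2 : HasGaussianLaw (Prod.snd : Vec m × Vec n → Vec n) (μ.prod ν) :=
    ⟨by rw [measurePreserving_snd.map_eq]; infer_instance⟩
  have h3 : IndepFun (Prod.fst : Vec m × Vec n → Vec m) Prod.snd (μ.prod ν) := by
    rw [indepFun_iff_map_prod_eq_prod_map_map measurable_fst.aemeasurable
      measurable_snd.aemeasurable, measurePreserving_fst.map_eq, measurePreserving_snd.map_eq]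
    exact Measure.map_id
  have h4 := (h3.hasGaussianLaw h1 h2).isGaussian_map
  have h5 : (μ.prod ν).map (fun ω => (ω.1, ω.2)) = μ.prod ν := Measure.map_id
  rwa [h5] at h4

/-- The characteristic function of a Gaussian measure is determined by its mean and covariance. -/
lemma eq_multivariateGaussian {μ : Measure (Vec n)} [IsGaussian μ] {S : Mat n n}
    (hS : S.PosSemidef) (h0 : ∫ x, x ∂μ = 0) (h : crossMom μ (fun x => x) (fun x => x) = S) :
    μ = multivariateGaussian 0 S := by
  refine Measure.ext_of_charFun ?_
  ext t
  have hL : MemLp (fun x : Vec n => x) 2 μ := IsGaussian.memLp_two_id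
  have h1 : ∫ x, inner ℝ t x ∂μ = (0 : ℝ) := by
    rw [integral_inner (hL.integrable (by norm_num)), h0, inner_zero_right]
  rw [charFun_multivariateGaussian hS, IsGaussian.charFun_eq, integral_complex_ofReal, h1,
    inner_zero_right, variance_of_integral_eq_zero (by fun_prop) h1]
  have h2 := integral_inner_mul_inner hL hL t t
  rw [h] at h2
  simp only [sq, h2]

lemma integral_gaussian (M : Mat n n) : ∫ x, x ∂(multivariateGaussian (0 : Vec n) M) = 0 :=
  integral_id_multivariateGaussian

variable {W : Mat m m} {M : Mat n n}

lemma memLp_lin (W : Mat m m) (M : Mat n n) (F : Mat k m) (G : Mat k n) :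
    MemLp (fun p : Vec m × Vec n => act F p.1 + act G p.2) 2
      ((multivariateGaussian 0 W).prod (multivariateGaussian 0 M)) :=
  memLp_add (MemLp.act ((memLp_gaussian 0 W).comp_fst _) F)
    (MemLp.act ((memLp_gaussian 0 M).comp_snd _) G)

lemma measurable_lin (F : Mat k m) (G : Mat k n) :
    Measurable fun p : Vec m × Vec n => act F p.1 + act G p.2 :=
  ((measurable_act F).comp measurable_fst).add ((measurable_act G).comp measurable_snd)

lemma crossMom_lin (hW : W.PosSemidef) (hM : M.PosSemidef) (F : Mat k m) (G : Mat k n)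
    (F' : Mat l m) (G' : Mat l n) :
    crossMom ((multivariateGaussian (0 : Vec m) W).prod (multivariateGaussian (0 : Vec n) M))
      (fun p => act F p.1 + act G p.2) (fun p => act F' p.1 + act G' p.2) =
      F * W * F'ᵀ + G * M * G'ᵀ := by
  set μ := (multivariateGaussian (0 : Vec m) W).prod (multivariateGaussian (0 : Vec n) M)
  have h1 : MemLp (fun p : Vec m × Vec n => p.1) 2 μ := (memLp_gaussian 0 W).comp_fst _
  have h2 : MemLp (fun p : Vec m × Vec n => p.2) 2 μ := (memLp_gaussian 0 M).comp_snd _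
  have h11 : crossMom μ (fun p => p.1) (fun p => p.1) = W :=
    (crossMom_comp measurePreserving_fst (memLp_gaussian 0 W) (memLp_gaussian 0 W)).trans
      (crossMom_gaussian hW)
  have h22 : crossMom μ (fun p => p.2) (fun p => p.2) = M :=
    (crossMom_comp measurePreserving_snd (memLp_gaussian 0 M) (memLp_gaussian 0 M)).trans
      (crossMom_gaussian hM)
  have h12 : crossMom μ (fun p => p.1) (fun p => p.2) = 0 :=
    crossMom_prod_gaussian M (fun x => x)
  have h21 : crossMom μ (fun p => p.2) (fun p => p.1) = 0 := crossMom_comm_zero h12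
  rw [crossMom_add_left (MemLp.act h1 F) (MemLp.act h2 G) (memLp_lin W M F' G'),
    crossMom_add_right (MemLp.act h1 F) (MemLp.act h1 F') (MemLp.act h2 G'),
    crossMom_add_right (MemLp.act h2 G) (MemLp.act h1 F') (MemLp.act h2 G')]
  rw [crossMom_act_left h1 (MemLp.act h1 F'), crossMom_act_left h1 (MemLp.act h2 G'),
    crossMom_act_left h2 (MemLp.act h1 F'), crossMom_act_left h2 (MemLp.act h2 G'),
    crossMom_act_right h1 h1, crossMom_act_right h1 h2, crossMom_act_right h2 h1,
    crossMom_act_right h2 h2, h11, h12, h21, h22]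
  simp [Matrix.mul_assoc]

lemma integral_lin (F : Mat k m) (G : Mat k n) :
    ∫ p, (act F p.1 + act G p.2)
      ∂((multivariateGaussian (0 : Vec m) W).prod (multivariateGaussian (0 : Vec n) M)) = 0 := by
  have h1 := ((memLp_gaussian 0 W).comp_fst (multivariateGaussian (0 : Vec n) M)).integrable
    (by norm_num)
  have h2 := ((memLp_gaussian 0 M).comp_snd (multivariateGaussian (0 : Vec m) W)).integrable
    (by norm_num)
  have e1 := (actCLM F).integral_comp_comm h1
  have e2 := (actCLM G).integral_comp_comm h2
  rw [integral_fun_fst (f := fun x : Vec m => x), integral_gaussian, smul_zero, map_zero] at e1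
  rw [integral_fun_snd (f := fun x : Vec n => x), integral_gaussian, smul_zero, map_zero] at e2
  refine (integral_add ((actCLM F).integrable_comp h1) ((actCLM G).integrable_comp h2)).trans ?_
  rw [e1, e2, add_zero]

lemma isGaussian_lin (W : Mat m m) (M : Mat n n) (F : Mat k m) (G : Mat k n) :
    IsGaussian (((multivariateGaussian (0 : Vec m) W).prod
      (multivariateGaussian (0 : Vec n) M)).map fun p => act F p.1 + act G p.2) := by
  have := isGaussian_prod (multivariateGaussian (0 : Vec m) W) (multivariateGaussian (0 : Vec n) M)
  exact isGaussian_map (μ := (multivariateGaussian (0 : Vec m) W).prod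
    (multivariateGaussian (0 : Vec n) M)) ((actCLM F).comp (ContinuousLinearMap.fst ℝ _ _) +
    (actCLM G).comp (ContinuousLinearMap.snd ℝ _ _))

/-- The law of `F X + G Y` for independent centered Gaussian vectors. -/
lemma map_lin (hW : W.PosSemidef) (hM : M.PosSemidef) (F : Mat k m) (G : Mat k n) :
    ((multivariateGaussian (0 : Vec m) W).prod (multivariateGaussian (0 : Vec n) M)).map
      (fun p => act F p.1 + act G p.2) = multivariateGaussian 0 (F * W * Fᵀ + G * M * Gᵀ) := by
  have := isGaussian_lin W M F G
  refine eq_multivariateGaussian ((PosSemidef.conj hW F).add (PosSemidef.conj hM G)) ?_ ?_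
  · rw [integral_map (measurable_lin F G).aemeasurable (by fun_prop), integral_lin]
  · rw [crossMom_map (measurable_lin F G) measurable_id' measurable_id']
    exact crossMom_lin hW hM F G F G

/-- Uncorrelated linear images of independent centered Gaussian vectors are independent. -/
lemma map_lin_prod (hW : W.PosSemidef) (hM : M.PosSemidef) (F : Mat k m) (G : Mat k n)
    (F' : Mat l m) (G' : Mat l n) (h : F * W * F'ᵀ + G * M * G'ᵀ = 0) :
    ((multivariateGaussian (0 : Vec m) W).prod (multivariateGaussian (0 : Vec n) M)).map
      (fun p => (act F p.1 + act G p.2, act F' p.1 + act G' p.2)) =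
      (((multivariateGaussian (0 : Vec m) W).prod (multivariateGaussian (0 : Vec n) M)).map
        fun p => act F p.1 + act G p.2).prod
      (multivariateGaussian 0 (F' * W * F'ᵀ + G' * M * G'ᵀ)) := by
  have hG := isGaussian_prod (multivariateGaussian (0 : Vec m) W)
    (multivariateGaussian (0 : Vec n) M)
  set μ := (multivariateGaussian (0 : Vec m) W).prod (multivariateGaussian (0 : Vec n) M) with hμ
  have hlaw : HasGaussianLaw (fun p : Vec m × Vec n =>
      (act F p.1 + act G p.2, act F' p.1 + act G' p.2)) μ :=
    ⟨isGaussian_map (μ := μ) (((actCLM F).comp (ContinuousLinearMap.fst ℝ _ _) +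
      (actCLM G).comp (ContinuousLinearMap.snd ℝ _ _)).prod
      ((actCLM F').comp (ContinuousLinearMap.fst ℝ _ _) +
      (actCLM G').comp (ContinuousLinearMap.snd ℝ _ _)))⟩
  have hX := memLp_lin W M F G
  have hY := memLp_lin W M F' G'
  rw [← hμ] at hX hY
  have h0 : ∀ {j : ℕ} {f : Vec m × Vec n → Vec j} (_ : MemLp f 2 μ) (_ : ∫ p, f p ∂μ = 0)
      (x : Vec j), ∫ p, inner ℝ x (f p) ∂μ = (0 : ℝ) := fun hf h x => by
    rw [integral_inner (hf.integrable (by norm_num)), h, inner_zero_right]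
  have hind := hlaw.indepFun_of_covariance_inner fun x y => by
    rw [covariance, h0 hX (integral_lin F G), h0 hY (integral_lin F' G')]
    simp only [sub_zero]
    rw [integral_inner_mul_inner hX hY, hμ, crossMom_lin hW hM, h]
    simp
  rw [indepFun_iff_map_prod_eq_prod_map_map (measurable_lin F G).aemeasurable
    (measurable_lin F' G').aemeasurable, map_lin hW hM F' G'] at hind
  exact hind

/-- Gaussian filtering: a Gaussian vector is the best linear estimate from a noisy observation plus
an error that is independent of the observation. -/
lemma map_innovation {C : Mat n m} (hW : W.PosSemidef) (hM : M.PosDef) :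
    ((multivariateGaussian (0 : Vec m) W).prod (multivariateGaussian (0 : Vec n) M)).map
      (fun p => (act C p.1 + p.2, p.1 - act (optGain C M W) (act C p.1 + p.2))) =
      (((multivariateGaussian (0 : Vec m) W).prod (multivariateGaussian (0 : Vec n) M)).map
        fun p => act C p.1 + p.2).prod (multivariateGaussian 0 (filt C M W)) := by
  set L := optGain C M W with hL
  have hV := innovation_posDef hM hW C
  -- The residual is uncorrelated with the observation: this is the normal equation `(CWCᵀ + M)Lᵀ =
  -- CW`.
  have h0 : C * W * (1 - L * C)ᵀ + 1 * M * (-L)ᵀ = 0 := by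
    have e1 : Lᵀ = (C * W * Cᵀ + M)⁻¹ * (C * W) := by
      rw [hL, optGain, Matrix.transpose_mul, Matrix.transpose_mul, Matrix.transpose_transpose,
        PosSemidef.transpose_eq hW, PosSemidef.transpose_eq hV.inv.posSemidef]
    have e2 : (C * W * Cᵀ + M) * Lᵀ = C * W := by
      rw [e1, ← Matrix.mul_assoc, PosDef.mul_inv hV, Matrix.one_mul]
    rw [Matrix.transpose_sub, Matrix.transpose_one, Matrix.transpose_mul, Matrix.mul_sub,
      Matrix.mul_one, Matrix.one_mul, Matrix.transpose_neg, Matrix.mul_neg, ← Matrix.mul_assoc]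
    nth_rewrite 1 [← e2]
    rw [Matrix.add_mul]
    abel
  have h := map_lin_prod hW hM.posSemidef C 1 (1 - L * C) (-L) h0
  have e : (1 - L * C) * W * (1 - L * C)ᵀ + -L * M * (-L)ᵀ = filt C M W := by
    rw [filt_eq_gainMap hM hW, gainMap]; simp [hL]
  rw [e] at h
  simp only [one_act, sub_act, neg_act, mul_act] at h
  rw [← h]
  congr 1
  ext1 p
  rw [act_add]
  congr 1
  abel

end Gaussian

/-! ### A lower bound on the conditional covariance -/

section Genie

variable {α : Type*} [MeasurableSpace α] {n : ℕ}

lemma multivariateGaussian_eq_map (b : Vec n) (S : Mat n n) :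
    multivariateGaussian b S = (multivariateGaussian 0 S).map (fun x => b + x) := by
  rw [multivariateGaussian, multivariateGaussian, Measure.map_map (by fun_prop) (by fun_prop)]
  congr 1
  ext1 x
  simp

/-- There is side information, revealing at least the first component, given which the second
component is Gaussian with covariance matrix `Z`. -/
def GaussianGiven (ν : Measure (α × Vec n)) (Z : Mat n n) : Prop :=
  ∃ η : Measure (α × Vec n), IsProbabilityMeasure η ∧
    ν = (η.prod (multivariateGaussian 0 Z)).map fun p => (p.1.1, p.1.2 + p.2)

lemma measurable_genie :
    Measurable fun p : (α × Vec n) × Vec n => ((p.1.1, p.1.2 + p.2) : α × Vec n) := by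
  fun_prop

/-- The error is `ξ - x̄` plus a Gaussian vector independent of `(I, ξ)`, where `(I, ξ)` is the side
information; the latter alone contributes `Z`. -/
lemma GaussianGiven.le_errCov {ν : ProbabilityMeasure (α × Vec n)} {Z : Mat n n}
    (h : GaussianGiven (ν : Measure (α × Vec n)) Z) (hZ : Z.PosSemidef)
    (hx : MemLp (fun p : α × Vec n => p.2) 2 (ν : Measure (α × Vec n)))
    (hm : MemLp (fun p : α × Vec n => condMean ν p.1) 2 (ν : Measure (α × Vec n))) :
    Z ≤ errCov ν := by
  obtain ⟨η, hη, he⟩ := h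
  have hT : MeasurePreserving (fun p : (α × Vec n) × Vec n => ((p.1.1, p.1.2 + p.2) : α × Vec n))
      (η.prod (multivariateGaussian 0 Z)) (ν : Measure (α × Vec n)) :=
    ⟨measurable_genie, he.symm⟩
  have hd := memLp_sub hx hm
  have h2 : MemLp (fun p : (α × Vec n) × Vec n => p.2) 2 (η.prod (multivariateGaussian 0 Z)) :=
    (memLp_gaussian 0 Z).comp_snd _
  have h1 : MemLp (fun p : (α × Vec n) × Vec n => p.1.2 - condMean ν p.1.1) 2
      (η.prod (multivariateGaussian 0 Z)) := by
    refine (memLp_congr_ae (Eventually.of_forall fun p => ?_)).1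
      (memLp_sub (hd.comp_measurePreserving hT) h2)
    simp only [Function.comp_apply]
    abel
  have h3 := crossMom_add_self h1 h2
    (crossMom_prod_gaussian Z fun q : α × Vec n => q.2 - condMean ν q.1)
  have h4 : crossMom (η.prod (multivariateGaussian 0 Z)) (fun p : (α × Vec n) × Vec n => p.2)
      (fun p => p.2) = Z :=
    (crossMom_comp measurePreserving_snd (memLp_gaussian 0 Z) (memLp_gaussian 0 Z)).trans
      (crossMom_gaussian hZ)
  have h5 : errCov ν = crossMom (η.prod (multivariateGaussian 0 Z))
      (fun p => p.1.2 - condMean ν p.1.1 + p.2) (fun p => p.1.2 - condMean ν p.1.1 + p.2) := by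
    rw [errCov, ← crossMom_comp hT hd hd]
    simp only [sub_add_eq_add_sub]
  rw [h5, h3, h4]
  exact le_add_of_nonneg_left (crossMom_self_posSemidef h1).nonneg

/-- The genie reveals the state itself, so no Gaussian assumption on the initial law is needed. -/
lemma gaussianGiven_zero (ν : ProbabilityMeasure (α × Vec n)) :
    GaussianGiven (ν : Measure (α × Vec n)) 0 := by
  refine ⟨ν, inferInstance, ?_⟩
  have h : multivariateGaussian (0 : Vec n) 0 = Measure.dirac 0 := by
    rw [multivariateGaussian]
    simp
  rw [h, Measure.prod_dirac, Measure.map_map measurable_genie (by fun_prop)]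
  have : (fun p : (α × Vec n) × Vec n => ((p.1.1, p.1.2 + p.2) : α × Vec n)) ∘
      (fun x => (x, (0 : Vec n))) = id := by
    ext1 p; simp
  rw [this, Measure.map_id]

variable {nx nu ny : ℕ} {D : Data nx nu ny} {π : ControlPolicy nx nu ny} {t : ℕ}

lemma measurable_extend {ny nu t : ℕ} :
    Measurable fun q : Info ny nu t × (Vec ny × Vec nu) => q.1.extend q.2.1 q.2.2 :=
  (measurable_snoc.comp ((measurable_fst.comp measurable_fst).prodMk
    (measurable_fst.comp measurable_snd))).prodMk
    (measurable_snoc.comp ((measurable_snd.comp measurable_fst).prodMk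
      (measurable_snd.comp measurable_snd)))

/-- Against the stationary Gaussian adversary, the genie-aided error covariance follows the filter
Riccati recursion. -/
lemma GaussianGiven.next (hM : D.M.PosDef) {P Sig Z : Mat nx nx} (hSig : Sig.PosSemidef)
    (hZ : Z.PosSemidef) {ν : ProbabilityMeasure (Info ny nu t × Vec nx)}
    (h : GaussianGiven (ν : Measure (Info ny nu t × Vec nx)) Z) :
    GaussianGiven (nextLaw D π (D.gammaSS P Sig) ν : Measure (Info ny nu (t + 1) × Vec nx))
      (filt D.C D.M (D.A * Z * D.Aᵀ + Sig)) := by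
  obtain ⟨η, hη, he⟩ := h
  set W := D.A * Z * D.Aᵀ + Sig with hW
  have hWp : W.PosSemidef := prior_posSemidef hZ hSig D.A
  set L := optGain D.C D.M W with hL
  set inn : Measure (Vec ny) := ((multivariateGaussian (0 : Vec nx) W).prod
    (multivariateGaussian (0 : Vec ny) D.M)).map fun p => act D.C p.1 + p.2 with hinn
  have hA := measurable_act D.A
  have hB := measurable_act D.B
  have hC := measurable_act D.C
  have hLm := measurable_act L
  have hlin : Measurable fun p : Vec nx × Vec ny => act D.C p.1 + p.2 := by fun_prop
  have hinnP : IsProbabilityMeasure inn := Measure.isProbabilityMeasure_map hlin.aemeasurable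
  set u : Info ny nu t → Vec nu := control π ν
  have hu : Measurable u := measurable_control π ν
  set b : Info ny nu t → Vec nx := fun I => act (D.Hss P) (condMean ν I) + D.Gss P
  have hb : Measurable b :=
    ((measurable_act _).comp (measurable_condMean ν)).add measurable_const
  -- The mean of the next state given the side information. Control and disturbance mean depend on
  -- `I` only, so they are known to the genie for any policy.
  set c : Info ny nu t × Vec nx → Vec nx := fun q => act D.A q.2 + act D.B (u q.1) + b q.1 with hc
  have hcm : Measurable c := by fun_prop
  -- The updated side information: the new information vector and the genie's estimate, formed from
  -- the old side information and an independent innovation.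
  set T : (Info ny nu t × Vec nx) × Vec ny → Info ny nu (t + 1) × Vec nx := fun p =>
    (p.1.1.extend (act D.C (c p.1) + p.2) (u p.1.1), c p.1 + act L p.2) with hT
  have hTm : Measurable T :=
    (measurable_extend.comp (Measurable.prodMk (by fun_prop)
      (Measurable.prodMk (by fun_prop)
        (hu.comp (measurable_fst.comp measurable_fst))))).prodMk (by fun_prop)
  refine ⟨(η.prod inn).map T, Measure.isProbabilityMeasure_map hTm.aemeasurable, ?_⟩
  -- Nonnegative test functions allow Tonelli without integrability conditions.
  refine Measure.ext_of_lintegral _ fun f hf => ?_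
  have hstep := measurable_step D π ν
  have hfs := hf.comp hstep
  have hbn : ∀ z : Info ny nu t × Vec nx, disturbance (D.gammaSS P Sig) ν z =
      (multivariateGaussian 0 Sig).map (fun x => b z.1 + x) := fun z =>
    multivariateGaussian_eq_map _ _
  have hF1 : Measurable fun p : (Info ny nu t × Vec nx) × Vec nx =>
      ∫⁻ v, f (step D π ν (p, v)) ∂(multivariateGaussian 0 D.M) :=
    hfs.lintegral_prod_right'
  have hF2 : Measurable fun z : Info ny nu t × Vec nx =>
      ∫⁻ w, ∫⁻ v, f (step D π ν ((z, b z.1 + w), v)) ∂(multivariateGaussian 0 D.M)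
        ∂(multivariateGaussian 0 Sig) :=
    Measurable.lintegral_prod_right' (f := fun p : (Info ny nu t × Vec nx) × Vec nx =>
      ∫⁻ v, f (step D π ν ((p.1, b p.1.1 + p.2), v)) ∂(multivariateGaussian 0 D.M))
      (hF1.comp (by fun_prop))
  have hleft : ∫⁻ p, f p ∂(nextLaw D π (D.gammaSS P Sig) ν : Measure _) =
      ∫⁻ q, ∫⁻ n₁, ∫⁻ w, ∫⁻ v, f (step D π ν (((q.1, q.2 + n₁), b q.1 + w), v))
        ∂(multivariateGaussian 0 D.M) ∂(multivariateGaussian 0 Sig)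
        ∂(multivariateGaussian 0 Z) ∂η := by
    change ∫⁻ p, f p ∂(Measure.map (step D π ν) (Measure.prod _ _)) = _
    rw [lintegral_map hf hstep, lintegral_prod (fun p => f (step D π ν p)) hfs.aemeasurable,
      Measure.lintegral_compProd hF1]
    have e1 : ∀ z : Info ny nu t × Vec nx,
        ∫⁻ w, ∫⁻ v, f (step D π ν ((z, w), v)) ∂(multivariateGaussian 0 D.M)
          ∂(disturbance (D.gammaSS P Sig) ν z) =
        ∫⁻ w, ∫⁻ v, f (step D π ν ((z, b z.1 + w), v)) ∂(multivariateGaussian 0 D.M)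
          ∂(multivariateGaussian 0 Sig) := by
      intro z
      have hz : Measurable fun w : Vec nx =>
          ∫⁻ v, f (step D π ν ((z, w), v)) ∂(multivariateGaussian 0 D.M) :=
        hF1.comp (by fun_prop)
      rw [hbn, lintegral_map hz (by fun_prop)]
    simp only [e1]
    rw [he, lintegral_map hF2 measurable_genie]
    exact lintegral_prod _ (hF2.comp measurable_genie).aemeasurable
  have hright : ∫⁻ p, f p ∂(((η.prod inn).map T).prod
      (multivariateGaussian 0 (filt D.C D.M W))).map (fun p => (p.1.1, p.1.2 + p.2)) =
      ∫⁻ q, ∫⁻ i, ∫⁻ n₂, f ((T (q, i)).1, (T (q, i)).2 + n₂)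
        ∂(multivariateGaussian 0 (filt D.C D.M W)) ∂inn ∂η := by
    have hF3 : Measurable fun p : Info ny nu (t + 1) × Vec nx =>
        ∫⁻ n₂, f (p.1, p.2 + n₂) ∂(multivariateGaussian 0 (filt D.C D.M W)) :=
      Measurable.lintegral_prod_right' (f := fun p : (Info ny nu (t + 1) × Vec nx) × Vec nx =>
        f (p.1.1, p.1.2 + p.2)) (hf.comp measurable_genie)
    rw [lintegral_map hf measurable_genie,
      lintegral_prod (fun p : (Info ny nu (t + 1) × Vec nx) × Vec nx => f (p.1.1, p.1.2 + p.2))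
        (hf.comp measurable_genie).aemeasurable, lintegral_map hF3 hTm]
    exact lintegral_prod _ (hF3.comp hTm).aemeasurable
  rw [hleft, hright]
  refine lintegral_congr fun q => ?_
  -- the Gaussian part, for fixed side information
  set φ : Vec nx × Vec ny → ℝ≥0∞ := fun p =>
    f (q.1.extend (act D.C (c q + p.1) + p.2) (u q.1), c q + p.1) with hφ
  have hφm : Measurable φ :=
    hf.comp ((measurable_extend.comp (Measurable.prodMk measurable_const
      (Measurable.prodMk (by fun_prop) measurable_const))).prodMk (by fun_prop))
  have e1 : ∀ n₁ w v, f (step D π ν (((q.1, q.2 + n₁), b q.1 + w), v)) =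
      φ (act D.A n₁ + w, v) := by
    intro n₁ w v
    have : act D.A (q.2 + n₁) + act D.B (u q.1) + (b q.1 + w) = c q + (act D.A n₁ + w) := by
      simp only [hc, act_add]; ac_rfl
    simp only [step, hφ]
    rw [this]
  simp only [e1]
  have hφ1 : Measurable fun x : Vec nx => ∫⁻ v, φ (x, v) ∂(multivariateGaussian 0 D.M) :=
    hφm.lintegral_prod_right'
  have hsum : Measurable fun p : Vec nx × Vec nx => act D.A p.1 + act (1 : Mat nx nx) p.2 :=
    measurable_lin _ _
  -- The propagated genie error plus the disturbance noise is Gaussian with covariance `W`.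
  have e2 : ∫⁻ n₁, ∫⁻ w, ∫⁻ v, φ (act D.A n₁ + w, v) ∂(multivariateGaussian 0 D.M)
        ∂(multivariateGaussian 0 Sig) ∂(multivariateGaussian 0 Z) =
      ∫⁻ x, ∫⁻ v, φ (x, v) ∂(multivariateGaussian 0 D.M) ∂(multivariateGaussian 0 W) := by
    have hmap := map_lin hZ hSig D.A (1 : Mat nx nx)
    rw [Matrix.transpose_one, Matrix.one_mul, Matrix.mul_one, ← hW] at hmap
    rw [← hmap, lintegral_map hφ1 hsum]
    refine Eq.trans ?_ (lintegral_prod _ (hφ1.comp hsum).aemeasurable).symm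
    simp only [Function.comp_apply, one_act]
  set ψ : Vec ny × Vec nx → ℝ≥0∞ := fun p => f ((T (q, p.1)).1, (T (q, p.1)).2 + p.2) with hψ
  have hψm : Measurable ψ := by
    have h1 : Measurable fun p : Vec ny × Vec nx => T (q, p.1) := hTm.comp (by fun_prop)
    exact hf.comp ((measurable_fst.comp h1).prodMk ((measurable_snd.comp h1).add measurable_snd))
  -- In the coordinates innovation and residual, the two Gaussian factors become independent by
  -- `map_innovation`.
  have e3 : ∀ p, φ p = ψ (act D.C p.1 + p.2, p.1 - act L (act D.C p.1 + p.2)) := by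
    intro p
    simp only [hφ, hψ, hT]
    congr 2
    · rw [act_add, add_assoc]
    · abel
  have hinnov : Measurable fun p : Vec nx × Vec ny =>
      (act D.C p.1 + p.2, p.1 - act L (act D.C p.1 + p.2)) := by fun_prop
  rw [e2, ← lintegral_prod _ hφm.aemeasurable]
  simp only [e3]
  rw [← lintegral_map hψm hinnov, map_innovation hWp hM, ← hinn, lintegral_prod _ hψm.aemeasurable]

lemma gaussianGiven_closedLoop (hM : D.M.PosDef) {P Sig : Mat nx nx} (hSig : Sig.PosSemidef)
    (π : ControlPolicy nx nu ny) (t : ℕ) :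
    GaussianGiven (closedLoop D π (D.gammaSS P Sig) t : Measure (Info ny nu t × Vec nx))
      (riccatiIter D.A D.C D.M Sig 0 t) := by
  induction t with
  | zero => exact gaussianGiven_zero _
  | succ t ih =>
    exact GaussianGiven.next hM hSig (riccatiIter_posSemidef hM hSig Matrix.PosSemidef.zero t) ih

end Genie

/-! ### The Gelbrich bound -/

section Gelbrich

variable {n : ℕ}

lemma memLp_two_of_lintegral {Ω : Type*} [MeasurableSpace Ω] {μ : Measure Ω} {f : Ω → Vec n}
    (hf : AEStronglyMeasurable f μ) (h : ∫⁻ ω, ENNReal.ofReal (‖f ω‖ ^ 2) ∂μ ≠ ⊤) :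
    MemLp f 2 μ := by
  rw [memLp_two_iff_integrable_sq_norm hf]
  refine ⟨hf.norm.pow 2, ?_⟩
  rw [hasFiniteIntegral_iff_ofReal (Eventually.of_forall fun _ => by positivity)]
  exact h.lt_top

lemma ofReal_integral_le {Ω : Type*} [MeasurableSpace Ω] {μ : Measure Ω} {f : Ω → ℝ}
    (hf : Integrable f μ) :
    ENNReal.ofReal (∫ ω, f ω ∂μ) ≤ ∫⁻ ω, ENNReal.ofReal (f ω) ∂μ := by
  rw [integral_eq_lintegral_pos_part_sub_lintegral_neg_part hf]
  exact (ENNReal.ofReal_le_ofReal (sub_le_self _ ENNReal.toReal_nonneg)).trans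
    ENNReal.ofReal_toReal_le

lemma covMat_eq_crossMom {μ : Measure (Vec n)} [IsProbabilityMeasure μ]
    (h : MemLp (fun x : Vec n => x) 2 μ) :
    covMat μ = crossMom μ (fun x => x - meanVec μ) (fun x => x - meanVec μ) := by
  ext i j
  simp only [covMat, covariance, crossMom, Matrix.of_apply, PiLp.sub_apply,
    meanVec_apply (h.integrable one_le_two)]

lemma covMat_posSemidef {μ : Measure (Vec n)} [IsProbabilityMeasure μ]
    (h : MemLp (fun x : Vec n => x) 2 μ) : (covMat μ).PosSemidef := by
  rw [covMat_eq_crossMom h]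
  exact crossMom_self_posSemidef (memLp_sub h (memLp_const _))

lemma norm_sq_eq_quad (x : Vec n) : ‖x‖ ^ 2 = quad 1 x := by
  rw [quad, one_act, real_inner_self_eq_norm_sq]

lemma integral_norm_sq {μ : Measure (Vec n)} [IsProbabilityMeasure μ]
    (h : MemLp (fun x : Vec n => x) 2 μ) :
    ∫ x, ‖x‖ ^ 2 ∂μ = ‖meanVec μ‖ ^ 2 + (covMat μ).trace := by
  have hm : MemLp (fun _ : Vec n => meanVec μ) 2 μ := memLp_const _
  have hd := memLp_sub h hm
  have h1 : (covMat μ).trace = ∫ x, ‖x - meanVec μ‖ ^ 2 ∂μ := by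
    rw [covMat_eq_crossMom h]
    simp only [norm_sq_eq_quad]
    rw [integral_quad hd, Matrix.one_mul]
  have h2 : ∀ x : Vec n, ‖x‖ ^ 2 = ‖x - meanVec μ‖ ^ 2 +
      (2 * inner ℝ (meanVec μ) x - ‖meanVec μ‖ ^ 2) := by
    intro x
    rw [norm_sub_sq_real, real_inner_comm]; ring
  have h3 : ∫ x, inner ℝ (meanVec μ) x ∂μ = ‖meanVec μ‖ ^ 2 := by
    rw [integral_inner (h.integrable one_le_two), ← meanVec, real_inner_self_eq_norm_sq]
  have i1 : Integrable (fun x : Vec n => ‖x - meanVec μ‖ ^ 2) μ := by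
    simp only [norm_sq_eq_quad]; exact MemLp.integrable_quad hd 1
  have i2 : Integrable (fun x : Vec n => 2 * inner ℝ (meanVec μ) x) μ :=
    (MemLp.integrable_inner hm h).const_mul 2
  have i3 : Integrable (fun x : Vec n => 2 * inner ℝ (meanVec μ) x - ‖meanVec μ‖ ^ 2) μ :=
    i2.sub (integrable_const _)
  rw [integral_congr_ae (Eventually.of_forall h2), integral_add i1 i3,
    integral_sub i2 (integrable_const _), integral_const_mul, h3, ← h1]
  simp
  ring

lemma buresSq_eq (S T : Mat n n) : buresSq S T =
    S.trace + T.trace - 2 * (CFC.sqrt (CFC.sqrt T * S * CFC.sqrt T)).trace := by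
  rw [buresSq, Matrix.trace_sub, Matrix.trace_add, Matrix.trace_smul, smul_eq_mul]

lemma buresSq_nonneg {S T : Mat n n} (hS : S.PosSemidef) (hT : T.PosSemidef) :
    0 ≤ buresSq S T := by
  have := two_trace_sqrt_conj_le hS hT one_pos
  rw [buresSq_eq]
  linarith

/-- Coercivity of the Bures term, from `two_trace_sqrt_conj_le` with `c = 2`. -/
lemma trace_le_buresSq {S T : Mat n n} (hS : S.PosSemidef) (hT : T.PosSemidef) :
    S.trace ≤ 2 * buresSq S T + 2 * T.trace := by
  have := two_trace_sqrt_conj_le hS hT two_pos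
  rw [buresSq_eq]
  linarith

lemma le_buresSq {S : Mat n n} (hS : S.PosSemidef) (T : Mat n n) {U : Mat n n}
    (hU : U.PosDef) :
    S.trace + T.trace - (U.trace + (U⁻¹ * (CFC.sqrt T * S * CFC.sqrt T)).trace) ≤
      buresSq S T := by
  rw [buresSq_eq]
  linarith [two_trace_sqrt_le (sqrt_conj_posSemidef hS T) hU]

lemma gelbrich_sq {μ ν : Measure (Vec n)} [IsProbabilityMeasure μ] [IsProbabilityMeasure ν]
    (hμ : MemLp (fun x : Vec n => x) 2 μ) (hν : MemLp (fun x : Vec n => x) 2 ν) :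
    gelbrich μ ν ^ 2 = ‖meanVec μ - meanVec ν‖ ^ 2 + buresSq (covMat μ) (covMat ν) :=
  Real.sq_sqrt (add_nonneg (by positivity)
    (buresSq_nonneg (covMat_posSemidef hμ) (covMat_posSemidef hν)))

end Gelbrich

/-! ### The penalty of one step -/

section Penalty

variable {nx nu ny : ℕ} {D : Data nx nu ny} {π : ControlPolicy nx nu ny}
  {γ : DistPolicy nx nu ny} {t : ℕ} {ν : ProbabilityMeasure (Info ny nu t × Vec nx)}

/-- The covariance matrix of the disturbance given the information. -/
def infoCov (γ : DistPolicy nx nu ny) {t : ℕ} (ν : ProbabilityMeasure (Info ny nu t × Vec nx))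
    (I : Info ny nu t) : Mat nx nx :=
  covMat (γ.law t (I, condMean ν I))

lemma infoCov_posSemidef (γ : DistPolicy nx nu ny)
    (ν : ProbabilityMeasure (Info ny nu t × Vec nx)) (I : Info ny nu t) :
    (infoCov γ ν I).PosSemidef := by
  have := γ.markov t
  exact covMat_posSemidef (γ.sq_integrable t _)

lemma integral_norm_sq_law (γ : DistPolicy nx nu ny)
    (ν : ProbabilityMeasure (Info ny nu t × Vec nx)) (I : Info ny nu t) :
    ∫ x, ‖x‖ ^ 2 ∂(γ.law t (I, condMean ν I)) =
      ‖distMean γ ν I‖ ^ 2 + (infoCov γ ν I).trace := by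
  have := γ.markov t
  exact integral_norm_sq (γ.sq_integrable t _)

lemma gelbrich_law_sq (γ : DistPolicy nx nu ny)
    (ν : ProbabilityMeasure (Info ny nu t × Vec nx)) (I : Info ny nu t) {q : Measure (Vec nx)}
    [IsProbabilityMeasure q] (hq : MemLp (fun x : Vec nx => x) 2 q) :
    gelbrich (γ.law t (I, condMean ν I)) q ^ 2 =
      ‖distMean γ ν I - meanVec q‖ ^ 2 + buresSq (infoCov γ ν I) (covMat q) := by
  have := γ.markov t
  exact gelbrich_sq (γ.sq_integrable t _) hq

/-- The expected penalty of one step, relative to the nominal distribution `q`. -/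
def lawPenalty (lam : ℝ) (γ : DistPolicy nx nu ny) {t : ℕ}
    (ν : ProbabilityMeasure (Info ny nu t × Vec nx)) (q : Measure (Vec nx)) : ℝ≥0∞ :=
  ∫⁻ z, ENNReal.ofReal (lam * gelbrich (γ.law t (z.1, condMean ν z.1)) q ^ 2)
    ∂(ν : Measure (Info ny nu t × Vec nx))

/-- Coercivity of the Gelbrich penalty: the second moment is at most `2G²` plus a constant depending
on the nominal law. -/
lemma lintegral_secondMoment_ne_top {lam : ℝ} (hlam : 0 < lam) {q : Measure (Vec nx)}
    [IsProbabilityMeasure q] (hq : MemLp (fun x : Vec nx => x) 2 q)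
    (h : lawPenalty lam γ ν q ≠ ⊤) :
    ∫⁻ z, ENNReal.ofReal (‖distMean γ ν z.1‖ ^ 2 + (infoCov γ ν z.1).trace)
      ∂(ν : Measure (Info ny nu t × Vec nx)) ≠ ⊤ := by
  set c : ℝ := 2 * ‖meanVec q‖ ^ 2 + 2 * (covMat q).trace with hc
  have hle : ∀ z : Info ny nu t × Vec nx,
      ENNReal.ofReal (‖distMean γ ν z.1‖ ^ 2 + (infoCov γ ν z.1).trace) ≤
        ENNReal.ofReal (2 / lam) *
          ENNReal.ofReal (lam * gelbrich (γ.law t (z.1, condMean ν z.1)) q ^ 2) +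
          ENNReal.ofReal c := by
    intro z
    rw [← ENNReal.ofReal_mul (by positivity)]
    refine (ENNReal.ofReal_le_ofReal ?_).trans ENNReal.ofReal_add_le
    rw [← mul_assoc, div_mul_cancel₀ _ hlam.ne', gelbrich_law_sq γ ν z.1 hq]
    have h1 := trace_le_buresSq (infoCov_posSemidef γ ν z.1) (covMat_posSemidef hq)
    have h2 : ‖distMean γ ν z.1‖ ^ 2 ≤
        2 * ‖distMean γ ν z.1 - meanVec q‖ ^ 2 + 2 * ‖meanVec q‖ ^ 2 := by
      have h3 := norm_sub_norm_le (distMean γ ν z.1) (meanVec q)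
      have h4 := norm_nonneg (distMean γ ν z.1)
      have h5 := norm_nonneg (distMean γ ν z.1 - meanVec q)
      have h6 : ‖distMean γ ν z.1‖ ≤ ‖distMean γ ν z.1 - meanVec q‖ + ‖meanVec q‖ := by linarith
      nlinarith [sq_nonneg (‖distMean γ ν z.1 - meanVec q‖ - ‖meanVec q‖),
        mul_self_le_mul_self h4 h6]
    linarith
  refine ((lintegral_mono hle).trans_lt ?_).ne
  rw [lintegral_add_right _ measurable_const, lintegral_const_mul' _ _ ENNReal.ofReal_ne_top,
    lintegral_const]
  simp only [measure_univ, mul_one]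
  exact ENNReal.add_lt_top.2 ⟨ENNReal.mul_lt_top ENNReal.ofReal_lt_top h.lt_top,
    ENNReal.ofReal_lt_top⟩

/-- A finite penalty makes the disturbance square integrable. -/
lemma StepL2.of_lawPenalty {lam : ℝ} (hlam : 0 < lam) {q : Measure (Vec nx)}
    [IsProbabilityMeasure q] (hq : MemLp (fun x : Vec nx => x) 2 q)
    (h : lawPenalty lam γ ν q ≠ ⊤)
    (hx : MemLp (fun p : Info ny nu t × Vec nx => p.2) 2 (ν : Measure (Info ny nu t × Vec nx)))
    (hm : MemLp (fun p : Info ny nu t × Vec nx => condMean ν p.1) 2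
      (ν : Measure (Info ny nu t × Vec nx)))
    (hu : MemLp (fun p : Info ny nu t × Vec nx => control π ν p.1) 2
      (ν : Measure (Info ny nu t × Vec nx))) : StepL2 π γ ν := by
  have hfin := lintegral_secondMoment_ne_top hlam hq h
  have hmark := γ.markov t
  refine ⟨hx, hm, hu, ?_, ?_⟩
  · refine memLp_two_of_lintegral measurable_snd.aestronglyMeasurable ?_
    rw [distLaw, Measure.lintegral_compProd (by fun_prop)]
    refine ne_of_eq_of_ne (lintegral_congr fun z => ?_) hfin
    rw [← integral_norm_sq_law γ ν z.1, ofReal_integral_eq_lintegral_ofReal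
      ((γ.sq_integrable t _).integrable_norm_pow two_ne_zero)
      (Eventually.of_forall fun _ => by positivity)]
    rfl
  · refine memLp_two_of_lintegral
      ((measurable_distMean γ ν).comp measurable_fst).aestronglyMeasurable ?_
    refine ((lintegral_mono fun z => ENNReal.ofReal_le_ofReal ?_).trans_lt hfin.lt_top).ne
    exact le_add_of_nonneg_right (infoCov_posSemidef γ ν z.1).trace_nonneg

namespace StepL2

lemma integrable_infoCov (h : StepL2 π γ ν) (i j : Fin nx) :
    Integrable (fun z : Info ny nu t × Vec nx => infoCov γ ν z.1 i j)
      (ν : Measure (Info ny nu t × Vec nx)) ∧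
    distCov γ ν i j = ∫ z, infoCov γ ν z.1 i j ∂(ν : Measure (Info ny nu t × Vec nx)) := by
  have hint := MemLp.integrable_coord_mul h.distNoise h.distNoise i j
  have hmark := γ.markov t
  have he : ∀ z : Info ny nu t × Vec nx, infoCov γ ν z.1 i j =
      ∫ w, (w - GelbrichControl.distMean γ ν z.1) i * (w - GelbrichControl.distMean γ ν z.1) j
        ∂(disturbance γ ν z) := by
    intro z
    rw [infoCov, covMat_eq_crossMom (γ.sq_integrable t _)]
    rfl
  simp only [he]
  refine ⟨?_, ?_⟩
  -- The fibre integrals are integrable by Fubini for kernels over a one-point base; this spares a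
  -- separate measurability proof for `infoCov`.
  · exact MeasureTheory.Integrable.integral_compProd
      (κ := Kernel.const Unit (ν : Measure (Info ny nu t × Vec nx)))
      (η := Kernel.prodMkLeft Unit (disturbance γ ν)) (a := ()) hint
  · rw [distCov, crossMom, Matrix.of_apply]
    exact Measure.integral_compProd hint

lemma integrable_trace_infoCov (h : StepL2 π γ ν) (W : Mat nx nx) :
    Integrable (fun z : Info ny nu t × Vec nx => (W * infoCov γ ν z.1).trace)
      (ν : Measure (Info ny nu t × Vec nx)) := by
  simp only [Matrix.trace, Matrix.diag_apply, Matrix.mul_apply]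
  exact integrable_finsetSum _ fun i _ => integrable_finsetSum _ fun j _ =>
    (h.integrable_infoCov j i).1.const_mul _

lemma trace_distCov (h : StepL2 π γ ν) (W : Mat nx nx) :
    (W * distCov γ ν).trace =
      ∫ z, (W * infoCov γ ν z.1).trace ∂(ν : Measure (Info ny nu t × Vec nx)) := by
  simp only [Matrix.trace, Matrix.diag_apply, Matrix.mul_apply]
  refine Eq.trans ?_ (integral_finsetSum _ fun i _ => integrable_finsetSum _ fun j _ =>
    (h.integrable_infoCov j i).1.const_mul _).symm
  refine Finset.sum_congr rfl fun i _ => ?_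
  rw [integral_finsetSum _ fun j _ => (h.integrable_infoCov j i).1.const_mul _]
  refine Finset.sum_congr rfl fun j _ => ?_
  rw [integral_const_mul, (h.integrable_infoCov j i).2]

lemma integrable_sq_distMean (h : StepL2 π γ ν) (w : Vec nx) :
    Integrable (fun z : Info ny nu t × Vec nx => ‖GelbrichControl.distMean γ ν z.1 - w‖ ^ 2)
      (ν : Measure (Info ny nu t × Vec nx)) := by
  simp only [norm_sq_eq_quad]
  exact MemLp.integrable_quad (memLp_sub h.distMean (memLp_const w)) 1

/-- A lower bound of the penalty which is linear in the covariance matrix of the disturbance. -/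
lemma le_lawPenalty (h : StepL2 π γ ν) {lam : ℝ} (hlam : 0 < lam) {q : Measure (Vec nx)}
    [IsProbabilityMeasure q] (hq : MemLp (fun x : Vec nx => x) 2 q)
    (hfin : lawPenalty lam γ ν q ≠ ⊤) {U : Mat nx nx} (hU : U.PosDef) :
    lam * (∫ z, ‖GelbrichControl.distMean γ ν z.1 - meanVec q‖ ^ 2
        ∂(ν : Measure (Info ny nu t × Vec nx)) + (distCov γ ν).trace + (covMat q).trace -
      (U.trace + (U⁻¹ * (CFC.sqrt (covMat q) * distCov γ ν * CFC.sqrt (covMat q))).trace)) ≤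
      (lawPenalty lam γ ν q).toReal := by
  set s := CFC.sqrt (covMat q) with hs
  have hcyc : ∀ V : Mat nx nx, (U⁻¹ * (s * V * s)).trace = (s * U⁻¹ * s * V).trace := by
    intro V
    rw [show U⁻¹ * (s * V * s) = (U⁻¹ * s * V) * s by simp only [Matrix.mul_assoc],
      Matrix.trace_mul_comm]
    simp only [Matrix.mul_assoc]
  set c : ℝ := (covMat q).trace - U.trace with hc
  have i1 := h.integrable_sq_distMean (meanVec q)
  have i2 := h.integrable_trace_infoCov 1
  have i3 := h.integrable_trace_infoCov (s * U⁻¹ * s)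
  have hint : Integrable (fun z : Info ny nu t × Vec nx =>
      lam * (‖GelbrichControl.distMean γ ν z.1 - meanVec q‖ ^ 2 + ((1 * infoCov γ ν z.1).trace -
        (s * U⁻¹ * s * infoCov γ ν z.1).trace) + c)) (ν : Measure (Info ny nu t × Vec nx)) :=
    ((i1.add (i2.sub i3)).add (integrable_const c)).const_mul lam
  -- The affine minorant may be negative, so it is compared through its positive part.
  have h1 := (ofReal_integral_le hint).trans
    (lintegral_mono fun z => ENNReal.ofReal_le_ofReal (q := lam *
      gelbrich (γ.law t (z.1, condMean ν z.1)) q ^ 2) (by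
      rw [gelbrich_law_sq γ ν z.1 hq]
      have := le_buresSq (infoCov_posSemidef γ ν z.1) (covMat q) hU
      rw [← hs, hcyc] at this
      rw [Matrix.one_mul, hc]
      refine mul_le_mul_of_nonneg_left ?_ hlam.le
      linarith))
  have h2 := (ENNReal.ofReal_le_iff_le_toReal hfin).1 h1
  refine le_of_eq_of_le ?_ h2
  have e1 := integral_add (i1.add (i2.sub i3)) (integrable_const c)
  have e2 := integral_add i1 (i2.sub i3)
  have e3 := integral_sub i2 i3
  simp only [Pi.add_apply, Pi.sub_apply] at e1 e2 e3
  rw [integral_const_mul, e1, e2, e3, ← h.trace_distCov, ← h.trace_distCov, hcyc, Matrix.one_mul,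
    integral_const, hc, probReal_univ, one_smul]
  ring

end StepL2

end Penalty

/-! ### The cost balance of one step -/

section Balance

variable {nx nu ny : ℕ} {D : Data nx nu ny} {π : ControlPolicy nx nu ny}
  {γ : DistPolicy nx nu ny} {t : ℕ} {ν : ProbabilityMeasure (Info ny nu t × Vec nx)}

/-- The cost-to-go, up to a constant, as a function of the conditional mean. -/
def relValue (D : Data nx nu ny) (P : Mat nx nx) (m : Vec nx) : ℝ :=
  quad P m + 2 * inner ℝ (D.rss P) m

lemma integrable_relValue {Ω : Type*} [MeasurableSpace Ω] {μ : Measure Ω} [IsProbabilityMeasure μ]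
    {f : Ω → Vec nx} (hf : MemLp f 2 μ) (P : Mat nx nx) :
    Integrable (fun ω => relValue D P (f ω)) μ :=
  (MemLp.integrable_quad hf P).add
    ((MemLp.integrable_inner (memLp_const (D.rss P)) hf).const_mul 2)

lemma integral_relValue {Ω : Type*} [MeasurableSpace Ω] {μ : Measure Ω} [IsProbabilityMeasure μ]
    {f : Ω → Vec nx} (hf : MemLp f 2 μ) (P : Mat nx nx) :
    ∫ ω, relValue D P (f ω) ∂μ =
      ∫ ω, quad P (f ω) ∂μ + 2 * ∫ ω, inner ℝ (D.rss P) (f ω) ∂μ := by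
  simp only [relValue]
  rw [integral_add (MemLp.integrable_quad hf P)
    ((MemLp.integrable_inner (memLp_const (D.rss P)) hf).const_mul 2), integral_const_mul]

/-- Since `P ≻ 0`, the quadratic part absorbs the linear term after completing the square. -/
lemma exists_norm_sq_le_relValue (D : Data nx nu ny) {P : Mat nx nx} (hP : P.PosDef) :
    ∃ c : ℝ, 0 < c ∧ ∃ b : ℝ, ∀ m, ‖m‖ ^ 2 ≤ c * relValue D P m + b := by
  obtain ⟨c, hc, h⟩ := exists_norm_sq_le_quad hP
  refine ⟨2 * c, by positivity, 4 * c ^ 2 * ‖D.rss P‖ ^ 2, fun m => ?_⟩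
  have h1 := (abs_le.1 (abs_real_inner_le_norm (D.rss P) m)).1
  have h2 := mul_le_mul_of_nonneg_left h1 hc.le
  have h3 := sq_nonneg (‖m‖ - 2 * c * ‖D.rss P‖)
  rw [relValue]
  linarith [h m]

/-- The expected cost of one step, before the penalty. -/
def stepCost (D : Data nx nu ny) (π : ControlPolicy nx nu ny) {t : ℕ}
    (ν : ProbabilityMeasure (Info ny nu t × Vec nx)) : ℝ :=
  ∫ p, (quad D.Q p.2 + quad D.R (control π ν p.1)) ∂(ν : Measure (Info ny nu t × Vec nx))

namespace StepL2

lemma integrable_stageFn (h : StepL2 π γ ν) (D : Data nx nu ny) (P : Mat nx nx) :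
    Integrable (fun p : Info ny nu t × Vec nx =>
      stageFn D P (condMean ν p.1) (control π ν p.1) (GelbrichControl.distMean γ ν p.1))
      (ν : Measure (Info ny nu t × Vec nx)) ∧
    ∫ p, stageFn D P (condMean ν p.1) (control π ν p.1) (GelbrichControl.distMean γ ν p.1)
      ∂(ν : Measure (Info ny nu t × Vec nx)) =
    ∫ p, quad D.Q (condMean ν p.1) ∂(ν : Measure (Info ny nu t × Vec nx)) +
      ∫ p, quad D.R (control π ν p.1) ∂(ν : Measure (Info ny nu t × Vec nx)) -
      D.lam * ∫ p, ‖GelbrichControl.distMean γ ν p.1 - D.wHat‖ ^ 2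
        ∂(ν : Measure (Info ny nu t × Vec nx)) +
      ∫ p, relValue D P (predMean D π γ ν p.1) ∂(ν : Measure (Info ny nu t × Vec nx)) := by
  have i1 := MemLp.integrable_quad h.mean D.Q
  have i2 := MemLp.integrable_quad h.ctrl D.R
  have i3 := (h.integrable_sq_distMean D.wHat).const_mul D.lam
  have i4 := integrable_relValue (D := D) (h.pred D) P
  have he : ∀ p : Info ny nu t × Vec nx,
      stageFn D P (condMean ν p.1) (control π ν p.1) (GelbrichControl.distMean γ ν p.1) =
      quad D.Q (condMean ν p.1) + quad D.R (control π ν p.1) -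
        D.lam * ‖GelbrichControl.distMean γ ν p.1 - D.wHat‖ ^ 2 +
        relValue D P (predMean D π γ ν p.1) := fun p => add_assoc _ _ _
  simp only [he]
  have e1 := integral_add ((i1.add i2).sub i3) i4
  have e2 := integral_sub (i1.add i2) i3
  have e3 := integral_add i1 i2
  simp only [Pi.add_apply, Pi.sub_apply] at e1 e2 e3
  exact ⟨((i1.add i2).sub i3).add i4, by rw [e1, e2, e3, integral_const_mul]⟩

lemma stepCost_eq (h : StepL2 π γ ν) (D : Data nx nu ny) : stepCost D π ν =
    ∫ p, quad D.Q (condMean ν p.1) ∂(ν : Measure (Info ny nu t × Vec nx)) +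
      (D.Q * errCov ν).trace +
      ∫ p, quad D.R (control π ν p.1) ∂(ν : Measure (Info ny nu t × Vec nx)) := by
  rw [stepCost, integral_add (MemLp.integrable_quad h.state D.Q)
    (MemLp.integrable_quad h.ctrl D.R), integral_quad_state h.state h.mean]

/-- The dynamic programming identity for one step. -/
lemma balance (h : StepL2 π γ ν) (P : Mat nx nx)
    (hm : MemLp (fun p : Info ny nu (t + 1) × Vec nx => condMean (nextLaw D π γ ν) p.1) 2
      (nextLaw D π γ ν : Measure (Info ny nu (t + 1) × Vec nx))) :
    stepCost D π ν + ∫ p, relValue D P (condMean (nextLaw D π γ ν) p.1)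
        ∂(nextLaw D π γ ν : Measure (Info ny nu (t + 1) × Vec nx)) +
        (P * errCov (nextLaw D π γ ν)).trace =
      ∫ p, stageFn D P (condMean ν p.1) (control π ν p.1) (GelbrichControl.distMean γ ν p.1)
        ∂(ν : Measure (Info ny nu t × Vec nx)) +
      D.lam * ∫ p, ‖GelbrichControl.distMean γ ν p.1 - D.wHat‖ ^ 2
        ∂(ν : Measure (Info ny nu t × Vec nx)) +
      (D.Sss P * errCov ν).trace + (P * errCov ν).trace + (P * distCov γ ν).trace := by
  have h1 := integral_quad_state (h.next_state D) hm P
  have h2 := integral_inner_condMean (h.next_state D) hm (D.rss P)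
  rw [h.integral_next_quad] at h1
  rw [h.integral_next_inner] at h2
  have h3 : (P * (D.A * errCov ν * D.Aᵀ + distCov γ ν)).trace =
      (D.Aᵀ * P * D.A * errCov ν).trace + (P * distCov γ ν).trace := by
    rw [Matrix.mul_add, Matrix.trace_add, ← Matrix.mul_assoc, Matrix.trace_mul_comm]
    simp only [Matrix.mul_assoc]
  -- `S` is exactly the weight left on the error covariance when `Q` and `AᵀPA` are collected and
  -- `P` is kept in the potential.
  have h4 : (D.Sss P * errCov ν).trace = (D.Q * errCov ν).trace +
      (D.Aᵀ * P * D.A * errCov ν).trace - (P * errCov ν).trace := by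
    rw [Data.Sss, Matrix.sub_mul, Matrix.add_mul, Matrix.trace_sub, Matrix.trace_add]
  rw [h.stepCost_eq, (h.integrable_stageFn D P).2, integral_relValue hm,
    integral_relValue (h.pred D), h2, h4]
  linarith

end StepL2

end Balance

/-! ### The closed loop over a finite horizon -/

section Horizon

variable {nx nu ny : ℕ} {D : Data nx nu ny} {π : ControlPolicy nx nu ny}
  {γ : DistPolicy nx nu ny} {P X Sig : Mat nx nx}

lemma memLp_initLaw (hinit : MemLp (fun x : Vec nx => x) 2 (D.init : Measure (Vec nx))) :
    MemLp (fun p : Info ny nu 0 × Vec nx => p.2) 2 (initLaw D : Measure (Info ny nu 0 × Vec nx)) := by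
  change MemLp _ 2 (Measure.map _ _)
  rw [memLp_map_measure_iff measurable_snd.aestronglyMeasurable]
  · exact hinit.comp_fst _
  · refine (Measurable.prodMk (Measurable.prodMk ?_ measurable_const) measurable_fst).aemeasurable
    exact measurable_pi_iff.2 fun _ => ((measurable_act D.C).comp measurable_fst).add measurable_snd

/-- The cost-to-go is coercive, so integrability of the bias bounds `E‖x̄_t‖²`. -/
lemma Data.BiasVanishes.memLp_condMean (h : D.BiasVanishes P X π γ) (hP : P.PosDef) (t : ℕ) :
    MemLp (fun p : Info ny nu t × Vec nx => condMean (closedLoop D π γ t) p.1) 2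
      (closedLoop D π γ t : Measure (Info ny nu t × Vec nx)) := by
  obtain ⟨c, -, b, hb⟩ := exists_norm_sq_le_relValue D hP
  have hmeas : AEStronglyMeasurable
      (fun p : Info ny nu t × Vec nx => condMean (closedLoop D π γ t) p.1)
      (closedLoop D π γ t : Measure (Info ny nu t × Vec nx)) :=
    ((measurable_condMean _).comp measurable_fst).aestronglyMeasurable
  have h1 : Integrable
      (fun p : Info ny nu t × Vec nx => relValue D P (condMean (closedLoop D π γ t) p.1))
      (closedLoop D π γ t : Measure (Info ny nu t × Vec nx)) := by
    have := (h.1 t).sub (integrable_const (((D.Sss P + P) * X).trace))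
    refine this.congr (Eventually.of_forall fun p => ?_)
    simp only [Pi.sub_apply, Data.bias, relValue, xbar, add_sub_cancel_right]
  rw [memLp_two_iff_integrable_sq_norm hmeas]
  refine ((h1.const_mul c).add (integrable_const b)).mono' (hmeas.norm.pow 2)
    (Eventually.of_forall fun p => ?_)
  rw [Real.norm_of_nonneg (by positivity)]
  exact hb _

/-- Induction on time: a finite penalty makes `w_t` square integrable, which carries square
integrability from `x_t` to `x_{t+1}`. -/
lemma stepL2_closedLoop (hlam : 0 < D.lam)
    (hinit : MemLp (fun x : Vec nx => x) 2 (D.init : Measure (Vec nx)))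
    (hnom : ∀ t, MemLp (fun x : Vec nx => x) 2 (D.nominal t : Measure (Vec nx)))
    (hm : ∀ t, MemLp (fun p : Info ny nu t × Vec nx => condMean (closedLoop D π γ t) p.1) 2
      (closedLoop D π γ t : Measure (Info ny nu t × Vec nx)))
    (hu : ∀ t, MemLp (fun p : Info ny nu t × Vec nx => control π (closedLoop D π γ t) p.1) 2
      (closedLoop D π γ t : Measure (Info ny nu t × Vec nx)))
    (hpen : ∀ t, stagePenalty D π γ t ≠ ⊤) (t : ℕ) : StepL2 π γ (closedLoop D π γ t) := by
  have key : ∀ t, MemLp (fun p : Info ny nu t × Vec nx => p.2) 2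
      (closedLoop D π γ t : Measure (Info ny nu t × Vec nx)) → StepL2 π γ (closedLoop D π γ t) :=
    fun t hx => StepL2.of_lawPenalty hlam (hnom t) (hpen t) hx (hm t) (hu t)
  induction t with
  | zero => exact key 0 (memLp_initLaw hinit)
  | succ t ih => exact key (t + 1) (ih.next_state D)

lemma stageCost_eq (hQ : D.Q.PosSemidef) (hR : D.R.PosSemidef) {t : ℕ}
    (h : StepL2 π γ (closedLoop D π γ t)) :
    stageCost D π γ t = ENNReal.ofReal (stepCost D π (closedLoop D π γ t)) := by
  exact (ofReal_integral_eq_lintegral_ofReal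
    ((MemLp.integrable_quad h.state D.Q).add (MemLp.integrable_quad h.ctrl D.R))
    (Eventually.of_forall fun p => add_nonneg (quad_nonneg hQ _) (quad_nonneg hR _))).symm

lemma stepCost_nonneg (hQ : D.Q.PosSemidef) (hR : D.R.PosSemidef) {t : ℕ}
    (ν : ProbabilityMeasure (Info ny nu t × Vec nx)) : 0 ≤ stepCost D π ν :=
  integral_nonneg fun _ => add_nonneg (quad_nonneg hQ _) (quad_nonneg hR _)

lemma horizonCost_eq (hQ : D.Q.PosSemidef) (hR : D.R.PosSemidef)
    (h : ∀ t, StepL2 π γ (closedLoop D π γ t)) (hpen : ∀ t, stagePenalty D π γ t ≠ ⊤) (T : ℕ) :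
    horizonCost D π γ T = ((∑ t ∈ Finset.range T,
      (stepCost D π (closedLoop D π γ t) - (stagePenalty D π γ t).toReal) : ℝ) : EReal) := by
  have h1 : ∑ t ∈ Finset.range T, stageCost D π γ t =
      ENNReal.ofReal (∑ t ∈ Finset.range T, stepCost D π (closedLoop D π γ t)) := by
    rw [ENNReal.ofReal_sum_of_nonneg fun t _ => stepCost_nonneg hQ hR _]
    exact Finset.sum_congr rfl fun t _ => stageCost_eq hQ hR (h t)
  have h2 : ∑ t ∈ Finset.range T, stagePenalty D π γ t =
      ENNReal.ofReal (∑ t ∈ Finset.range T, (stagePenalty D π γ t).toReal) := by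
    rw [ENNReal.ofReal_sum_of_nonneg fun t _ => ENNReal.toReal_nonneg]
    exact Finset.sum_congr rfl fun t _ => (ENNReal.ofReal_toReal (hpen t)).symm
  rw [horizonCost, h1, h2, EReal.coe_ennreal_ofReal, EReal.coe_ennreal_ofReal,
    max_eq_left (Finset.sum_nonneg fun t _ => stepCost_nonneg hQ hR _),
    max_eq_left (Finset.sum_nonneg fun t _ => ENNReal.toReal_nonneg), ← EReal.coe_sub,
    Finset.sum_sub_distrib]

lemma avgCost_eq_bot {s : ℕ} (h : stagePenalty D π γ s = ⊤) : avgCost D π γ = ⊥ := by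
  have h1 : ∀ᶠ T : ℕ in atTop, horizonCost D π γ T / ((T : ℝ) : EReal) = ⊥ := by
    filter_upwards [eventually_gt_atTop s] with T hT
    have h2 : ∑ t ∈ Finset.range T, stagePenalty D π γ t = ⊤ :=
      ENNReal.sum_eq_top.2 ⟨s, Finset.mem_range.2 hT, h⟩
    have hT0 : (0 : ℝ) < T := by exact_mod_cast (Nat.zero_le s).trans_lt hT
    -- Subtracting `⊤` gives `⊥` even when the accumulated cost is `⊤`.
    rw [horizonCost, h2, EReal.coe_ennreal_top, EReal.sub_top]
    exact EReal.bot_div_of_pos_ne_top (EReal.coe_pos.2 hT0) (EReal.coe_ne_top _)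
  rw [avgCost, limsup_congr h1, limsup_const]

lemma avgCost_eq_top {s : ℕ} (h : stageCost D π γ s = ⊤)
    (hpen : ∀ t, stagePenalty D π γ t ≠ ⊤) : avgCost D π γ = ⊤ := by
  have h1 : ∀ᶠ T : ℕ in atTop, horizonCost D π γ T / ((T : ℝ) : EReal) = ⊤ := by
    filter_upwards [eventually_gt_atTop s] with T hT
    have h2 : ∑ t ∈ Finset.range T, stageCost D π γ t = ⊤ :=
      ENNReal.sum_eq_top.2 ⟨s, Finset.mem_range.2 hT, h⟩
    have h3 : ∑ t ∈ Finset.range T, stagePenalty D π γ t ≠ ⊤ :=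
      ENNReal.sum_ne_top.2 fun t _ => hpen t
    have hT0 : (0 : ℝ) < T := by exact_mod_cast (Nat.zero_le s).trans_lt hT
    rw [horizonCost, h2, EReal.coe_ennreal_top, ← ENNReal.ofReal_toReal h3,
      EReal.coe_ennreal_ofReal, EReal.top_sub_coe]
    exact EReal.top_div_of_pos_ne_top (EReal.coe_pos.2 hT0) (EReal.coe_ne_top _)
  rw [avgCost, limsup_congr h1, limsup_const]

/-- A finite stage cost makes the control square integrable. -/
lemma memLp_control (hQ : D.Q.PosSemidef) (hR : D.R.PosDef) {t : ℕ}
    (h : stageCost D π γ t ≠ ⊤) :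
    MemLp (fun p : Info ny nu t × Vec nx => control π (closedLoop D π γ t) p.1) 2
      (closedLoop D π γ t : Measure (Info ny nu t × Vec nx)) := by
  obtain ⟨c, hc, hb⟩ := exists_norm_sq_le_quad hR
  refine memLp_two_of_lintegral
    ((measurable_control π _).comp measurable_fst).aestronglyMeasurable ?_
  have hle : ∀ p : Info ny nu t × Vec nx,
      ENNReal.ofReal (‖control π (closedLoop D π γ t) p.1‖ ^ 2) ≤
      ENNReal.ofReal c * ENNReal.ofReal (quad D.Q p.2 +
        quad D.R (π.toFun t (p.1, xbar D π γ t p.1))) := by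
    intro p
    rw [← ENNReal.ofReal_mul hc.le]
    refine ENNReal.ofReal_le_ofReal ((hb _).trans (mul_le_mul_of_nonneg_left ?_ hc.le))
    exact le_add_of_nonneg_left (quad_nonneg hQ _)
  refine ((lintegral_mono hle).trans_lt ?_).ne
  rw [lintegral_const_mul' _ _ ENNReal.ofReal_ne_top]
  exact ENNReal.mul_lt_top ENNReal.ofReal_lt_top h.lt_top

lemma rho_eq (P X Sig : Mat nx nx) : D.rho P X Sig =
    meanValue D P - D.lam * D.SigmaHat.trace + D.covObjective P X Sig := by
  rw [Data.rho, meanValue]; ring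

end Horizon

/-! ### The stationary adversary -/

section Adversary

variable {nx nu ny : ℕ} {D : Data nx nu ny} {π : ControlPolicy nx nu ny} {P Sig : Mat nx nx} {t : ℕ}

lemma covMat_gaussian (hSig : Sig.PosSemidef) (w : Vec nx) :
    covMat (multivariateGaussian w Sig) = Sig := by
  ext i j
  rw [covMat, Matrix.of_apply, covariance_eval_multivariateGaussian hSig]

lemma distMean_gammaSS (P Sig : Mat nx nx) (ν : ProbabilityMeasure (Info ny nu t × Vec nx))
    (I : Info ny nu t) :
    distMean (D.gammaSS P Sig) ν I = act (D.Hss P) (condMean ν I) + D.Gss P :=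
  integral_id_multivariateGaussian

lemma infoCov_gammaSS (hSig : Sig.PosSemidef) (P : Mat nx nx)
    (ν : ProbabilityMeasure (Info ny nu t × Vec nx)) (I : Info ny nu t) :
    infoCov (D.gammaSS P Sig) ν I = Sig :=
  covMat_gaussian hSig _

lemma distCov_gammaSS (hSig : Sig.PosSemidef) {ν : ProbabilityMeasure (Info ny nu t × Vec nx)}
    (h : StepL2 π (D.gammaSS P Sig) ν) : distCov (D.gammaSS P Sig) ν = Sig := by
  ext i j
  rw [(h.integrable_infoCov i j).2]
  simp only [infoCov_gammaSS hSig, integral_const, probReal_univ, one_smul]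

/-- The conditional covariance is constant, so the Bures term factors out and only the mean varies
with the information. -/
lemma lawPenalty_gammaSS (hSig : Sig.PosSemidef) {lam : ℝ} (hlam : 0 < lam) {q : Measure (Vec nx)}
    [IsProbabilityMeasure q] (hq : MemLp (fun x : Vec nx => x) 2 q)
    {ν : ProbabilityMeasure (Info ny nu t × Vec nx)}
    (hm : MemLp (fun p : Info ny nu t × Vec nx => condMean ν p.1) 2
      (ν : Measure (Info ny nu t × Vec nx))) :
    lawPenalty lam (D.gammaSS P Sig) ν q = ENNReal.ofReal (lam *
      (∫ z, ‖distMean (D.gammaSS P Sig) ν z.1 - meanVec q‖ ^ 2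
        ∂(ν : Measure (Info ny nu t × Vec nx)) + buresSq Sig (covMat q))) := by
  have hd : MemLp (fun p : Info ny nu t × Vec nx => distMean (D.gammaSS P Sig) ν p.1) 2
      (ν : Measure (Info ny nu t × Vec nx)) := by
    simp only [distMean_gammaSS]
    exact memLp_add (MemLp.act hm _) (memLp_const _)
  have hi : Integrable (fun z : Info ny nu t × Vec nx =>
      ‖distMean (D.gammaSS P Sig) ν z.1 - meanVec q‖ ^ 2)
      (ν : Measure (Info ny nu t × Vec nx)) := by
    simp only [norm_sq_eq_quad]
    exact MemLp.integrable_quad (memLp_sub hd (memLp_const _)) 1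
  have hb := buresSq_nonneg hSig (covMat_posSemidef hq)
  have h1 : ∫ z, lam * (‖distMean (D.gammaSS P Sig) ν z.1 - meanVec q‖ ^ 2 +
      buresSq Sig (covMat q)) ∂(ν : Measure (Info ny nu t × Vec nx)) = lam *
      (∫ z, ‖distMean (D.gammaSS P Sig) ν z.1 - meanVec q‖ ^ 2
        ∂(ν : Measure (Info ny nu t × Vec nx)) + buresSq Sig (covMat q)) := by
    rw [integral_const_mul, integral_add hi (integrable_const _), integral_const, probReal_univ,
      one_smul]
  rw [← h1]
  refine Eq.trans ?_ (ofReal_integral_eq_lintegral_ofReal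
    ((hi.add (integrable_const _)).const_mul lam) (Eventually.of_forall fun z =>
      mul_nonneg hlam.le (add_nonneg (sq_nonneg _) hb))).symm
  refine lintegral_congr fun z => ?_
  rw [gelbrich_law_sq _ ν z.1 hq, infoCov_gammaSS hSig]
  rfl

end Adversary

/-! ### The two bounds on the average cost -/

section Bounds

variable {nx nu ny : ℕ} {D : Data nx nu ny} {P X Xm Sig : Mat nx nx}

lemma Data.CovFeasible.fixedPoint (h : D.CovFeasible X Xm Sig) :
    X = filt D.C D.M (D.A * X * D.Aᵀ + Sig) := by
  rw [← h.2.2.2.1]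
  exact h.2.2.2.2

lemma avgCost_le_of_horizonCost_le {π : ControlPolicy nx nu ny} {γ : DistPolicy nx nu ny}
    {a K : ℝ} (h : ∀ T : ℕ, 0 < T → horizonCost D π γ T ≤ ((T * a + K : ℝ) : EReal)) :
    avgCost D π γ ≤ (a : EReal) := by
  have h1 : Tendsto (fun T : ℕ => ((a + K / T : ℝ) : EReal)) atTop (𝓝 ((a + 0 : ℝ) : EReal)) :=
    (continuous_coe_real_ereal.tendsto _).comp
      (tendsto_const_nhds.add (tendsto_const_div_atTop_nhds_zero_nat K))
  rw [add_zero] at h1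
  rw [← h1.limsup_eq]
  refine limsup_le_limsup ?_
  filter_upwards [eventually_gt_atTop 0] with T hT
  have hT0 : (0 : ℝ) < T := by exact_mod_cast hT
  have h2 := EReal.div_le_div_right_of_nonneg (EReal.coe_nonneg.2 hT0.le) (h T hT)
  refine h2.trans (le_of_eq ?_)
  rw [← EReal.coe_div]
  congr 1
  field_simp

lemma le_avgCost_of_forall {π : ControlPolicy nx nu ny} {γ : DistPolicy nx nu ny} {a : ℝ}
    (h : ∀ ε : ℝ, 0 < ε → ∀ᶠ T : ℕ in atTop,
      ((T * (a - ε) : ℝ) : EReal) ≤ horizonCost D π γ T) : (a : EReal) ≤ avgCost D π γ := by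
  refine EReal.ge_of_forall_gt_iff_ge.1 fun z hz => ?_
  have hz' : z < a := EReal.coe_lt_coe_iff.1 hz
  refine le_trans (le_liminf_of_le (by isBoundedDefault) ?_) (liminf_le_limsup)
  filter_upwards [h (a - z) (by linarith), eventually_gt_atTop 0] with T hT hT0
  have hT0 : (0 : ℝ) < T := by exact_mod_cast hT0
  refine le_trans (le_of_eq ?_) (EReal.div_le_div_right_of_nonneg (EReal.coe_nonneg.2 hT0.le) hT)
  rw [← EReal.coe_div]
  congr 1
  field_simp
  ring

/-- The stationary control policy guarantees the average cost `ρ`. -/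
lemma avgCost_piSS_le (hQ : D.Q.PosSemidef) (hR : D.R.PosDef) (hM : D.M.PosDef)
    (hlam : 0 < D.lam) (hinit : MemLp (fun x : Vec nx => x) 2 (D.init : Measure (Vec nx)))
    (hnom : ∀ t, MemLp (fun x : Vec nx => x) 2 (D.nominal t : Measure (Vec nx)))
    (hmean : ∀ t, meanVec (D.nominal t : Measure (Vec nx)) = D.wHat)
    (hcov : ∀ t, covMat (D.nominal t : Measure (Vec nx)) = D.SigmaHat)
    (hPhi : D.Phi.PosSemidef) (hobs : IsObservable D.A (CFC.sqrt D.Q))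
    (hP : D.IsRiccatiSolution P) (hpen : (D.lam • (1 : Mat nx nx) - P).PosDef)
    (hopt : D.IsCovOptimal P X Xm Sig) (hdet : IsDetectable D.A D.C) {γ : DistPolicy nx nu ny}
    (hγ : D.BiasVanishes P X (D.piSS P) γ) :
    avgCost D (D.piSS P) γ ≤ ((D.rho P X Sig : ℝ) : EReal) := by
  -- An adversary with an infinite expected penalty only reaches `-∞`.
  by_cases hfin : ∀ t, stagePenalty D (D.piSS P) γ t ≠ ⊤
  swap
  · push Not at hfin
    obtain ⟨s, hs⟩ := hfin
    rw [avgCost_eq_bot hs]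
    exact bot_le
  have hPd := riccati_posDef hQ hPhi hobs hP
  have hS := Sss_posSemidef hPhi hP
  have hunit := isUnit_one_sub hQ hPhi hobs hP
  set ν := closedLoop D (D.piSS P) γ with hν
  have hm := fun t => hγ.memLp_condMean hPd t
  have hstep : ∀ t, StepL2 (D.piSS P) γ (ν t) := stepL2_closedLoop hlam hinit hnom hm
    (fun t => memLp_add (MemLp.act (hm t) (D.Kss P)) (memLp_const (D.Lss P))) hfin
  obtain ⟨c, hc, b, hb⟩ := exists_norm_sq_le_relValue D hPd
  set B : ℕ → ℝ := fun t => ∫ p, relValue D P (condMean (ν t) p.1)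
    ∂(ν t : Measure (Info ny nu t × Vec nx)) with hB
  set E : ℕ → Mat nx nx := fun t => errCov (ν t) with hE
  set V : ℕ → Mat nx nx := fun t => distCov γ (ν t) with hV
  have hEp : ∀ t, (E t).PosSemidef := fun t => errCov_posSemidef (hstep t).state (hm t)
  -- A uniform lower bound on the potential controls the end term `-B T` of the telescoping sum.
  have hBlow : ∀ t, -(b / c) ≤ B t := by
    intro t
    have h1 : ∀ m : Vec nx, -(b / c) ≤ relValue D P m := fun m => by
      have := hb m
      rw [← neg_div, div_le_iff₀ hc]
      nlinarith [sq_nonneg ‖m‖]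
    have h2 := integral_mono (integrable_const (-(b / c))) (integrable_relValue (D := D) (hm t) P)
      fun p => h1 _
    rwa [integral_const, probReal_univ, one_smul] at h2
  refine avgCost_le_of_horizonCost_le (K := B 0 + b / c + (P * E 0).trace +
    ((D.Sss P * E 0).trace + D.lam * (D.A * E 0 * D.Aᵀ).trace + D.lam * nx)) fun T hT => ?_
  obtain ⟨U, hU, hsum⟩ := sum_covObjective_le hM hlam hdet hP.1 hS hopt hEp
    (fun t => (hstep t).distCov_posSemidef)
    (fun t L => (hstep t).errCov_next_le hM.posSemidef (hm (t + 1)) L) hT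
  rw [horizonCost_eq hQ hR.posSemidef hstep hfin, EReal.coe_le_coe_iff]
  -- Balance, saddle inequality and linearized penalty combined: telescoping differences, the
  -- constant part of `ρ`, and the summand of `sum_covObjective_le`.
  have hone : ∀ t, stepCost D (D.piSS P) (ν t) - (stagePenalty D (D.piSS P) γ t).toReal ≤
      (B t - B (t + 1)) + ((P * E t).trace - (P * E (t + 1)).trace) +
      (meanValue D P - D.lam * D.SigmaHat.trace) +
      ((D.Sss P * E t).trace + ((P - D.lam • (1 : Mat nx nx)) * V t).trace +
        D.lam * (U.trace + (U⁻¹ * (CFC.sqrt D.SigmaHat * V t * CFC.sqrt D.SigmaHat)).trace)) := by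
    intro t
    have h1 := (hstep t).balance P (hm (t + 1))
    have h2 := (hstep t).le_lawPenalty hlam (hnom t) (hfin t) hU
    rw [hmean, hcov] at h2
    have h3 : ∫ p, stageFn D P (condMean (ν t) p.1) (control (D.piSS P) (ν t) p.1)
        (distMean γ (ν t) p.1) ∂(ν t : Measure (Info ny nu t × Vec nx)) ≤
        B t + meanValue D P := by
      have h4 := integral_mono ((hstep t).integrable_stageFn D P).1
        ((integrable_relValue (D := D) (hm t) P).add (integrable_const (meanValue D P)))
        fun p => stageFn_le hPhi hP hR hlam hpen hunit (condMean (ν t) p.1) (distMean γ (ν t) p.1)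
      refine h4.trans (le_of_eq ?_)
      refine (integral_add (integrable_relValue (D := D) (hm t) P) (integrable_const _)).trans ?_
      rw [integral_const, probReal_univ, one_smul]
    have h5 : ((P - D.lam • (1 : Mat nx nx)) * V t).trace =
        (P * V t).trace - D.lam * (V t).trace := by
      rw [Matrix.sub_mul, Matrix.trace_sub, Matrix.smul_mul, Matrix.one_mul, Matrix.trace_smul,
        smul_eq_mul]
    change stepCost D (D.piSS P) (ν t) + B (t + 1) + (P * E (t + 1)).trace = _ at h1
    rw [h5]
    change _ ≤ (stagePenalty D (D.piSS P) γ t).toReal at h2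
    simp only [hE, hV] at *
    linarith
  refine (Finset.sum_le_sum fun t _ => hone t).trans ?_
  rw [Finset.sum_add_distrib, Finset.sum_add_distrib, Finset.sum_add_distrib,
    Finset.sum_range_sub', Finset.sum_range_sub' (fun t => (P * E t).trace), Finset.sum_const,
    Finset.card_range, nsmul_eq_mul, rho_eq]
  have h1 := hBlow T
  have h2 := trace_mul_nonneg hP.1 (hEp T)
  linarith

/-- The stationary adversary enforces the average cost `ρ`. -/
lemma le_avgCost_gammaSS (hQ : D.Q.PosSemidef) (hR : D.R.PosDef) (hM : D.M.PosDef)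
    (hlam : 0 < D.lam) (hinit : MemLp (fun x : Vec nx => x) 2 (D.init : Measure (Vec nx)))
    (hnom : ∀ t, MemLp (fun x : Vec nx => x) 2 (D.nominal t : Measure (Vec nx)))
    (hmean : ∀ t, meanVec (D.nominal t : Measure (Vec nx)) = D.wHat)
    (hcov : ∀ t, covMat (D.nominal t : Measure (Vec nx)) = D.SigmaHat)
    (hPhi : D.Phi.PosSemidef) (hobs : IsObservable D.A (CFC.sqrt D.Q))
    (hP : D.IsRiccatiSolution P) (hpen : (D.lam • (1 : Mat nx nx) - P).PosDef)
    (hfeas : D.CovFeasible X Xm Sig) (hdet : IsDetectable D.A D.C)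
    (hstab : IsStabilizable D.A (CFC.sqrt Sig)) {π : ControlPolicy nx nu ny}
    (hπ : D.BiasVanishes P X π (D.gammaSS P Sig)) :
    ((D.rho P X Sig : ℝ) : EReal) ≤ avgCost D π (D.gammaSS P Sig) := by
  have hSig := hfeas.2.2.1
  have hPd := riccati_posDef hQ hPhi hobs hP
  have hS := Sss_posSemidef hPhi hP
  have hunit := isUnit_one_sub hQ hPhi hobs hP
  set ν := closedLoop D π (D.gammaSS P Sig) with hν
  have hm := fun t => hπ.memLp_condMean hPd t
  have hpenEq : ∀ t, stagePenalty D π (D.gammaSS P Sig) t = ENNReal.ofReal (D.lam *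
      (∫ z, ‖distMean (D.gammaSS P Sig) (ν t) z.1 - D.wHat‖ ^ 2
        ∂(ν t : Measure (Info ny nu t × Vec nx)) + buresSq Sig D.SigmaHat)) := by
    intro t
    have h := lawPenalty_gammaSS (D := D) (P := P) hSig hlam (hnom t) (hm t)
    rw [hmean, hcov] at h
    exact h
  have hfin : ∀ t, stagePenalty D π (D.gammaSS P Sig) t ≠ ⊤ := fun t => by
    rw [hpenEq]; exact ENNReal.ofReal_ne_top
  -- An infinite stage cost makes the average cost `+∞`, because all penalties are finite.
  by_cases hcost : ∀ t, stageCost D π (D.gammaSS P Sig) t ≠ ⊤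
  swap
  · push Not at hcost
    obtain ⟨s, hs⟩ := hcost
    rw [avgCost_eq_top hs hfin]
    exact le_top
  have hstep : ∀ t, StepL2 π (D.gammaSS P Sig) (ν t) := stepL2_closedLoop hlam hinit hnom hm
    (fun t => memLp_control hQ hR (hcost t)) hfin
  set B : ℕ → ℝ := fun t => ∫ p, relValue D P (condMean (ν t) p.1)
    ∂(ν t : Measure (Info ny nu t × Vec nx)) with hB
  set E : ℕ → Mat nx nx := fun t => errCov (ν t) with hE
  set Z : ℕ → Mat nx nx := riccatiIter D.A D.C D.M Sig 0 with hZ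
  have hbures : 0 ≤ buresSq Sig D.SigmaHat := by
    rw [← hcov 0]; exact buresSq_nonneg hSig (covMat_posSemidef (hnom 0))
  have hEp : ∀ t, (E t).PosSemidef := fun t => errCov_posSemidef (hstep t).state (hm t)
  have hZE : ∀ t, Z t ≤ E t := fun t =>
    (gaussianGiven_closedLoop hM hSig π t).le_errCov
      (riccatiIter_posSemidef hM hSig Matrix.PosSemidef.zero t) (hstep t).state (hm t)
  -- The end term `-Tr(P E_T)` has the unfavorable sign here, so an upper bound is needed:
  -- detectability bounds `Tr E_T`, and `P ≺ λI` transfers it.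
  obtain ⟨e, he⟩ : ∃ e, ∀ t, (P * E t).trace ≤ e := by
    obtain ⟨c, hc⟩ := bounded_trace_of_le_riccati hM hSig hdet hEp fun t => by
      have h := (hstep t).errCov_next_le hM.posSemidef (hm (t + 1))
        (optGain D.C D.M (D.A * E t * D.Aᵀ + Sig))
      rw [distCov_gammaSS hSig (hstep t),
        ← filt_eq_gainMap hM (prior_posSemidef (hEp t) hSig D.A)] at h
      exact h
    refine ⟨D.lam * c, fun t => ?_⟩
    have h := trace_mul_nonneg hpen.posSemidef (hEp t)
    rw [Matrix.sub_mul, Matrix.trace_sub, Matrix.smul_mul, Matrix.one_mul, Matrix.trace_smul,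
      smul_eq_mul] at h
    linarith [mul_le_mul_of_nonneg_left (hc t) hlam.le]
  set κ : ℝ := (D.Sss P * X).trace with hκ
  -- The genie's `Z t` replaces `E t` in the `S`-term, which is legitimate as `S ⪰ 0`; `ρ - κ` is
  -- `ρ` without its stationary `S`-term.
  have hone : ∀ t, (B t - B (t + 1)) + ((P * E t).trace - (P * E (t + 1)).trace) +
      (D.rho P X Sig - κ) + (D.Sss P * Z t).trace ≤
      stepCost D π (ν t) - (stagePenalty D π (D.gammaSS P Sig) t).toReal := by
    intro t
    have h1 := (hstep t).balance P (hm (t + 1))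
    change stepCost D π (ν t) + B (t + 1) + (P * E (t + 1)).trace = _ at h1
    have h2 : (stagePenalty D π (D.gammaSS P Sig) t).toReal = _ :=
      (congrArg ENNReal.toReal (hpenEq t)).trans (ENNReal.toReal_ofReal
        (mul_nonneg hlam.le (add_nonneg (integral_nonneg fun _ => sq_nonneg _) hbures)))
    rw [distCov_gammaSS hSig (hstep t)] at h1
    have h3 : B t + meanValue D P ≤ ∫ p, stageFn D P (condMean (ν t) p.1) (control π (ν t) p.1)
        (distMean (D.gammaSS P Sig) (ν t) p.1) ∂(ν t : Measure (Info ny nu t × Vec nx)) := by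
      have h4 := integral_mono
        ((integrable_relValue (D := D) (hm t) P).add (integrable_const (meanValue D P)))
        ((hstep t).integrable_stageFn D P).1
        fun p => by
          rw [distMean_gammaSS]
          exact le_stageFn hPhi hP hR hlam hpen hunit (condMean (ν t) p.1) (control π (ν t) p.1)
      refine le_trans (le_of_eq ?_) h4
      symm
      refine (integral_add (integrable_relValue (D := D) (hm t) P) (integrable_const _)).trans ?_
      rw [integral_const, probReal_univ, one_smul]
    have h5 : ((P - D.lam • (1 : Mat nx nx)) * Sig).trace =
        (P * Sig).trace - D.lam * Sig.trace := by
      rw [Matrix.sub_mul, Matrix.trace_sub, Matrix.smul_mul, Matrix.one_mul, Matrix.trace_smul,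
        smul_eq_mul]
    have h6 := trace_mul_mono hS (hZE t)
    rw [buresSq_eq] at h2
    rw [h2, rho_eq, covObjective_eq, h5]
    simp only [hE] at *
    linarith
  have hces : Tendsto (fun T : ℕ => (T : ℝ)⁻¹ * ∑ t ∈ Finset.range T, (D.Sss P * Z t).trace)
      atTop (𝓝 κ) := by
    refine Filter.Tendsto.cesaro ?_
    have hlim := riccatiIter_zero_tendsto hM hSig hstab hfeas.1 hfeas.fixedPoint
    exact ((Continuous.matrix_trace (continuous_const.matrix_mul continuous_id)).tendsto X).comp hlim
  -- The error `ε` is shared equally by the terminal bias, the constants divided by `T`, and the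
  -- Cesàro convergence to `κ`.
  refine le_avgCost_of_forall fun ε hε => ?_
  have hbias := eventually_lt_of_limsup_lt (hπ.2.trans_lt
    (EReal.coe_pos.2 (show (0 : ℝ) < ε / 3 by positivity)))
  set d : ℝ := B 0 + (P * E 0).trace - e + ((D.Sss P + P) * X).trace with hd
  have hconst : ∀ᶠ T : ℕ in atTop, -(ε / 3) < d / T :=
    (tendsto_const_div_atTop_nhds_zero_nat d).eventually (lt_mem_nhds (by linarith))
  have hces' := hces.eventually (lt_mem_nhds (show κ - ε / 3 < κ by linarith))
  filter_upwards [hbias, hconst, hces', eventually_gt_atTop 0] with T h1 h2 h3 hT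
  have hT0 : (0 : ℝ) < T := by exact_mod_cast hT
  rw [horizonCost_eq hQ hR.posSemidef hstep hfin, EReal.coe_le_coe_iff]
  refine le_trans ?_ (Finset.sum_le_sum fun t _ => hone t)
  rw [Finset.sum_add_distrib, Finset.sum_add_distrib, Finset.sum_add_distrib,
    Finset.sum_range_sub', Finset.sum_range_sub' (fun t => (P * E t).trace), Finset.sum_const,
    Finset.card_range, nsmul_eq_mul]
  have h1' : B T + ((D.Sss P + P) * X).trace < T * (ε / 3) := by
    have h4 := EReal.coe_lt_coe_iff.1 h1
    rw [one_div, inv_mul_lt_iff₀ hT0] at h4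
    refine lt_of_eq_of_lt ?_ h4
    symm
    refine (integral_add (integrable_relValue (D := D) (hm T) P) (integrable_const _)).trans ?_
    rw [integral_const, probReal_univ, one_smul]
  rw [lt_div_iff₀ hT0] at h2
  rw [lt_inv_mul_iff₀ hT0] at h3
  have h5 := he T
  linarith

end Bounds

end GelbrichControl

end

theorem mainTheorem7 {nx nu ny : ℕ} (D : GelbrichControl.Data nx nu ny)
    -- standing assumptions
    (hQ : D.Q.PosSemidef) (hR : D.R.PosDef) (hM : D.M.PosDef) (hlam : 0 < D.lam)
    (hinit : MemLp (fun x : GelbrichControl.Vec nx => x) 2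
      (D.init : Measure (GelbrichControl.Vec nx)))
    (hnom : ∀ t, MemLp (fun x : GelbrichControl.Vec nx => x) 2
      (D.nominal t : Measure (GelbrichControl.Vec nx)))
    -- the nominal distributions have a stationary mean vector and covariance matrix
    (hmean : ∀ t, GelbrichControl.meanVec (D.nominal t : Measure (GelbrichControl.Vec nx)) = D.wHat)
    (hcov : ∀ t, GelbrichControl.covMat (D.nominal t : Measure (GelbrichControl.Vec nx)) =
      D.SigmaHat)
    -- conditions on the control side
    (hPhi : D.Phi.PosSemidef)
    (hstab : GelbrichControl.IsStabilizable D.A (CFC.sqrt D.Phi))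
    (hobs : GelbrichControl.IsObservable D.A (CFC.sqrt D.Q))
    -- the steady-state Riccati matrix and the penalty condition
    (P : GelbrichControl.Mat nx nx) (hP : D.IsRiccatiSolution P)
    (hpen : (D.lam • (1 : GelbrichControl.Mat nx nx) - P).PosDef)
    -- the stationary worst-case covariance matrix
    (X Xm Sig : GelbrichControl.Mat nx nx) (hopt : D.IsCovOptimal P X Xm Sig)
    -- conditions on the filtering side
    (hdet : GelbrichControl.IsDetectable D.A D.C)
    (hstabSig : GelbrichControl.IsStabilizable D.A (CFC.sqrt Sig))
    -- the policy spaces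
    (PiBar : Set (GelbrichControl.ControlPolicy nx nu ny))
    (GammaBar : Set (GelbrichControl.DistPolicy nx nu ny))
    (hpi_mem : D.piSS P ∈ PiBar) (hgamma_mem : D.gammaSS P Sig ∈ GammaBar)
    (hPi : ∀ π ∈ PiBar, D.BiasVanishes P X π (D.gammaSS P Sig))
    (hGamma : ∀ γ ∈ GammaBar, D.BiasVanishes P X (D.piSS P) γ) :
    -- `ρ` is the average cost of the stationary pair
    GelbrichControl.avgCost D (D.piSS P) (D.gammaSS P Sig) = ((D.rho P X Sig : ℝ) : EReal) ∧
    -- the stationary pair is a saddle point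
    (∀ π ∈ PiBar, GelbrichControl.avgCost D (D.piSS P) (D.gammaSS P Sig) ≤
      GelbrichControl.avgCost D π (D.gammaSS P Sig)) ∧
    (∀ γ ∈ GammaBar, GelbrichControl.avgCost D (D.piSS P) γ ≤
      GelbrichControl.avgCost D (D.piSS P) (D.gammaSS P Sig)) ∧
    -- `π_ss^*` attains the outer minimum, `γ_ss^*` the inner maximum, and the value is `ρ`
    (⨆ γ ∈ GammaBar, GelbrichControl.avgCost D (D.piSS P) γ) = ((D.rho P X Sig : ℝ) : EReal) ∧
    (⨅ π ∈ PiBar, ⨆ γ ∈ GammaBar, GelbrichControl.avgCost D π γ) =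
      ((D.rho P X Sig : ℝ) : EReal) := by
  have hle := fun γ hγ => GelbrichControl.avgCost_piSS_le hQ hR hM hlam hinit hnom hmean hcov hPhi
    hobs hP hpen hopt hdet (hGamma γ hγ)
  have hge := fun π hπ => GelbrichControl.le_avgCost_gammaSS hQ hR hM hlam hinit hnom hmean hcov
    hPhi hobs hP hpen hopt.1 hdet hstabSig (hPi π hπ)
  have heq := le_antisymm (hle _ hgamma_mem) (hge _ hpi_mem)
  have hsup : (⨆ γ ∈ GammaBar, GelbrichControl.avgCost D (D.piSS P) γ) =
      ((D.rho P X Sig : ℝ) : EReal) :=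
    le_antisymm (iSup₂_le hle) (heq.ge.trans (le_iSup₂_of_le _ hgamma_mem le_rfl))
  -- For the value, the infimum is at most the supremum at `piSS`, while every inner supremum is at
  -- least the cost against `gammaSS`.
  refine ⟨heq, fun π hπ => heq.le.trans (hge π hπ), fun γ hγ => (hle γ hγ).trans heq.ge, hsup,
    le_antisymm ((iInf₂_le _ hpi_mem).trans hsup.le) (le_iInf₂ fun π hπ =>
      (hge π hπ).trans (le_iSup₂_of_le _ hgamma_mem le_rfl))⟩
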